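/- Let $\kappa>0$ and $R>0$, let $B_R=\{x\in\mathbb R^3:|x|<R\}$, $\Gamma_R=\partial B_R$, and let $\nu$ be the unit outward normal on $\Gamma_R$. Let $\mathbb X(B_R)$ be the closure in $L^2(B_R)^3$ (complex vector fields) of the set of all $\xi\in H(\mathrm{curl},B_R)$ that satisfy $$\int_{B_R}\big((\nabla\times\xi)\cdot(\nabla\times\psi)-\kappa^2\,\xi\cdot\psi\big)\,dx=0\qquad\text{for all }\psi\in C_0^\infty(B_R)^3 .$$ For $J\in L^2(B_R)^3$, extended by zero to $\mathbb R^3$, let $E$ be the electric field radiated by $J$, that is, the weak solution $E\in H_{\mathrm{loc}}(\mathrm{curl},\mathbb R^3)$ of $$\nabla\times(\nabla\times E)-\kappa^2E=\mathrm i\kappa J\quad\text{in }\mathbb R^3$$ that satisfies the Silver--Müller radiation condition $(\nabla\times E)\times x-\mathrm i\kappa|x|E\to0$ as $|x|\to\infty$, uniformly in all directions. The tangential trace $E\times\nu$ on $\Gamma_R$ is understood in the weak sense, $\langle E\times\nu,\varphi\rangle_{\Gamma_R}=\int_{B_R}\big(E\cdot(\nabla\times\varphi)-(\nabla\times E)\cdot\varphi\big)\,dx$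 for $\varphi\in C_0^\infty(\mathbb R^3)^3$. Then, at the fixed wavenumber $\kappa$, a current density $J\in\mathbb X(B_R)$ is uniquely determined by the data $E\times\nu$ on $\Gamma_R$: if $J_1,J_2\in\mathbb X(B_R)$ radiate the electric fields $E_1,E_2$ and $E_1\times\nu=E_2\times\nu$ on $\Gamma_R$, then $J_1=J_2$. -/

import Mathlib

open MeasureTheory Filter Topology TopologicalSpace
open scoped ContDiff Distributions

noncomputable section

namespace MaxwellSource

/-- Physical space `ℝ³` with its Euclidean norm. -/
abbrev Space : Type := EuclideanSpace ℝ (Fin 3)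

/-- Values of the fields: `ℂ³` with its Hermitian norm. -/
abbrev CVec : Type := EuclideanSpace ℂ (Fin 3)

/-- The bilinear product `u · v = u₁ v₁ + u₂ v₂ + u₃ v₃` on `ℂ³` (no conjugation). -/
def cdot (u v : CVec) : ℂ := ∑ i, u i * v i

/-- The cross product on `ℂ³`. -/
def cross (u v : CVec) : CVec := WithLp.toLp 2 (crossProduct u.ofLp v.ofLp)

/-- A real vector regarded as a complex one. -/
def toCVec (x : Space) : CVec := WithLp.toLp 2 fun i => (x i : ℂ)

/-- The classical partial derivative `∂_i F_j` at `x`. -/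
def partialDeriv (F : Space → CVec) (i j : Fin 3) (x : Space) : ℂ :=
  (fderiv ℝ F x (EuclideanSpace.single i 1)) j

/-- The classical curl `∇ × F`. -/
def curl (F : Space → CVec) (x : Space) : CVec :=
  !₂[partialDeriv F 1 2 x - partialDeriv F 2 1 x,
     partialDeriv F 2 0 x - partialDeriv F 0 2 x,
     partialDeriv F 0 1 x - partialDeriv F 1 0 x]

/-- The open ball `B_R = {x : |x| < R}` as an open set. -/
def openBall (R : ℝ) : Opens Space := ⟨Metric.ball 0 R, Metric.isOpen_ball⟩

/-- Lebesgue measure on `B_R`. -/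
def ballMeasure (R : ℝ) : Measure Space := volume.restrict (Metric.ball 0 R)

/-- The Hilbert space `L²(B_R)³` of complex vector fields. -/
abbrev L2Ball (R : ℝ) : Type := Lp CVec 2 (ballMeasure R)

/-- `w` is the weak curl of `u` in the open set `Ω`:
`∫_Ω u · (∇ × φ) = ∫_Ω w · φ` for all `φ ∈ C_c^∞(Ω)³`. -/
def HasWeakCurl (Ω : Opens Space) (u w : Space → CVec) : Prop :=
  ∀ φ : 𝓓(Ω, CVec),
    ∫ x in (Ω : Set Space), cdot (u x) (curl φ x) = ∫ x in (Ω : Set Space), cdot (w x) (φ x)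

/-- `u ∈ H(curl, B_R)` with `∇ × u = w` in `B_R`. -/
structure MemHCurl (R : ℝ) (u w : Space → CVec) : Prop where
  memLp : MemLp u 2 (ballMeasure R)
  memLp_curl : MemLp w 2 (ballMeasure R)
  hasWeakCurl : HasWeakCurl (openBall R) u w

/-- `u ∈ H_loc(curl, ℝ³)` with `∇ × u = w` in `ℝ³`. -/
structure MemHCurlLoc (u w : Space → CVec) : Prop where
  memLp : ∀ r : ℝ, MemLp u 2 (ballMeasure r)
  memLp_curl : ∀ r : ℝ, MemLp w 2 (ballMeasure r)
  hasWeakCurl : HasWeakCurl ⊤ u w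

/-- `ξ ∈ H(curl, B_R)` is a weak solution of `∇ × (∇ × ξ) - κ² ξ = 0` in `B_R`:
`∫_{B_R} ((∇ × ξ) · (∇ × ψ) - κ² ξ · ψ) = 0` for all `ψ ∈ C_c^∞(B_R)³`. -/
def IsHomogeneousMaxwellSolution (κ R : ℝ) (ξ : Space → CVec) : Prop :=
  ∃ w, MemHCurl R ξ w ∧ ∀ ψ : 𝓓(openBall R, CVec),
    ∫ x, (cdot (w x) (curl ψ x) - (κ : ℂ) ^ 2 * cdot (ξ x) (ψ x)) ∂(ballMeasure R) = 0

/-- The space `𝕏(B_R)` of radiating sources: the closure in `L²(B_R)³` of the set of weak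
solutions `ξ ∈ H(curl, B_R)` of `∇ × (∇ × ξ) - κ² ξ = 0` in `B_R`. -/
def radiatingSpace (κ R : ℝ) : Set (L2Ball R) :=
  closure {ξ : L2Ball R | IsHomogeneousMaxwellSolution κ R ξ}

/-- The Silver–Müller radiation condition
`(∇ × E) × x - i κ |x| E → 0` as `|x| → ∞`, uniformly in all directions.
The field `E` is given up to equality almost everywhere and the condition is read on its smooth
version outside the ball of radius `R`; by interior ellipticity every weak solution whose source
is supported in the closed ball of radius `R` has one, and it is unique. -/
def IsSilverMueller (κ R : ℝ) (E : Space → CVec) : Prop :=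
  ∃ F : Space → CVec, ContDiffOn ℝ ∞ F {x | R < ‖x‖} ∧
    (∀ᵐ x : Space, R < ‖x‖ → E x = F x) ∧
    Tendsto (fun x => cross (curl F x) (toCVec x) - (Complex.I * κ * ‖x‖) • F x)
      (cocompact Space) (𝓝 0)

/-- `E ∈ H_loc(curl, ℝ³)` is the electric field radiated by the current density `J ∈ L²(B_R)³`
(extended by zero): the weak solution of `∇ × (∇ × E) - κ² E = i κ J` in `ℝ³` that satisfies the
Silver–Müller radiation condition. -/
def IsRadiatedField (κ R : ℝ) (J : L2Ball R) (E : Space → CVec) : Prop :=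
  (∃ w, MemHCurlLoc E w ∧ ∀ φ : 𝓓((⊤ : Opens Space), CVec),
    ∫ x, (cdot (w x) (curl φ x) - (κ : ℂ) ^ 2 * cdot (E x) (φ x))
      = Complex.I * κ * ∫ x, cdot (J x) (φ x) ∂(ballMeasure R)) ∧
  IsSilverMueller κ R E

/-- `τ` is the tangential trace `E × ν` on the sphere `Γ_R = ∂B_R` of a field
`E ∈ H(curl, B_R)`, in the usual weak sense: it acts on (the boundary values of) smooth fields
`φ` by Green's formula
`⟨E × ν, φ⟩_{Γ_R} = ∫_{B_R} (E · (∇ × φ) - (∇ × E) · φ)`,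
which for smooth `E` is the surface integral `∫_{Γ_R} (E × ν) · φ dγ`. -/
def HasTangentialTrace (R : ℝ) (E : Space → CVec) (τ : 𝓓((⊤ : Opens Space), CVec) → ℂ) : Prop :=
  ∃ w, MemHCurl R E w ∧ ∀ φ : 𝓓((⊤ : Opens Space), CVec),
    τ φ = ∫ x, (cdot (E x) (curl φ x) - cdot (w x) (φ x)) ∂(ballMeasure R)

end MaxwellSource

end

open MaxwellSource

/-! Write E, J for the differences of the fields and sources and w for the weak curl of E. The proof
has three steps: E vanishes outside the ball, hence J is orthogonal to all homogeneous solutions,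
hence J = 0.

Exterior vanishing (`exterior_eq_zero`, `ae_eq_zero_of_trace_eq_zero`). Equality of the traces means
that E, replaced by zero inside the ball, still has a weak curl on the whole space, namely w
replaced by zero inside: this is the perfectly conducting boundary condition. Pair the exterior
fields with polynomial fields V on each sphere |x| = r. Testing Maxwell's equations with G(|x|)V(x),
V homogeneous, gives first order equations in r for these moments (`IsMaxwellMoments`), a boundary
condition at R and a radiation condition at infinity. For V = p x, with p homogeneous of degree k,
the system closes up to a term with the Laplacian of p, of lower degree, which vanishes by induction
on k. What remains is the Riccati–Bessel equation y'' + (κ² − k(k+1)/r²)y = 0 with a Neumann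
condition (electric moments) or a Dirichlet condition (magnetic moments). An energy and Wronskian
argument replaces the asymptotics of Hankel functions: `eq_zero_of_bessel_of_radiating` gives y = 0.
The fields p x, ∇p and x × ∇p span all polynomial fields on the unit sphere
(`PVec.linearMap_eq_zero`), so every electric moment vanishes, and by Stone–Weierstrass so does the
exterior field. Working with all homogeneous polynomials avoids a basis of spherical harmonics.

Orthogonality (`integral_cdot_curl_curl`). Now E and w vanish outside the ball, so E, mollified and
slightly contracted, is an admissible test field for a homogeneous solution ξ. In the limit ξ pairs
to zero with curl curl E − κ²E = iκJ.

Conclusion (`eq_zero_of_mem_radiatingSpace`). Since κ is real, complex conjugation preserves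
homogeneous solutions, so the bilinear orthogonality is also a Hermitian one. It passes to the
closure, which contains both sources, and J is orthogonal to itself. -/

namespace MaxwellSource

/-! ### Algebra of `cdot`, `cross` and `curl` -/

theorem cdot_apply (u v : CVec) : cdot u v = u 0 * v 0 + u 1 * v 1 + u 2 * v 2 := by
  simp [cdot, Fin.sum_univ_three]

theorem cdot_sub_left (u v w : CVec) : cdot (u - v) w = cdot u w - cdot v w := by
  simp [cdot_apply]; ring

theorem cdot_add_right (u v w : CVec) : cdot u (v + w) = cdot u v + cdot u w := by
  simp [cdot_apply]; ring

theorem cdot_smul_left (c : ℂ) (u v : CVec) : cdot (c • u) v = c * cdot u v := by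
  simp [cdot_apply]; ring

theorem cdot_smul_right (c : ℂ) (u v : CVec) : cdot u (c • v) = c * cdot u v := by
  simp [cdot_apply]; ring

theorem cdot_real_smul_right (c : ℝ) (u v : CVec) : cdot u (c • v) = c * cdot u v := by
  simp [cdot_apply]; ring

theorem cdot_zero_left (v : CVec) : cdot 0 v = 0 := by simp [cdot_apply]

theorem cdot_zero_right (v : CVec) : cdot v 0 = 0 := by simp [cdot_apply]

theorem cross_apply_zero (u v : CVec) : cross u v 0 = u 1 * v 2 - u 2 * v 1 := by
  simp [cross, crossProduct]

theorem cross_apply_one (u v : CVec) : cross u v 1 = u 2 * v 0 - u 0 * v 2 := by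
  simp [cross, crossProduct]

theorem cross_apply_two (u v : CVec) : cross u v 2 = u 0 * v 1 - u 1 * v 0 := by
  simp [cross, crossProduct]

theorem continuous_cdot : Continuous fun p : CVec × CVec => cdot p.1 p.2 := by
  simp only [cdot_apply]; fun_prop

theorem norm_cdot_le (u v : CVec) : ‖cdot u v‖ ≤ ‖u‖ * ‖v‖ := by
  have h : cdot u v = inner ℂ (WithLp.toLp 2 fun i => star (u i)) v := by
    simp [cdot, PiLp.inner_apply, mul_comm]
  rw [h]
  refine (norm_inner_le_norm _ _).trans_eq ?_
  simp [EuclideanSpace.norm_eq]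

theorem partialDeriv_eq {F : Space → CVec} {x : Space} (hF : DifferentiableAt ℝ F x) (i j : Fin 3) :
    partialDeriv F i j x = fderiv ℝ (fun y => F y j) x (EuclideanSpace.single i 1) := by
  have h := ((EuclideanSpace.proj (𝕜 := ℂ) j).restrictScalars ℝ).hasFDerivAt.comp x hF.hasFDerivAt
  have h' : HasFDerivAt (fun y => F y j)
    (((EuclideanSpace.proj (𝕜 := ℂ) j).restrictScalars ℝ).comp (fderiv ℝ F x)) x := h
  rw [h'.fderiv]
  rfl

theorem curl_apply_zero (F : Space → CVec) (x : Space) :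
    curl F x 0 = partialDeriv F 1 2 x - partialDeriv F 2 1 x := rfl

theorem curl_apply_one (F : Space → CVec) (x : Space) :
    curl F x 1 = partialDeriv F 2 0 x - partialDeriv F 0 2 x := rfl

theorem curl_apply_two (F : Space → CVec) (x : Space) :
    curl F x 2 = partialDeriv F 0 1 x - partialDeriv F 1 0 x := rfl

theorem CVec.ext_three {u v : CVec} (h0 : u 0 = v 0) (h1 : u 1 = v 1) (h2 : u 2 = v 2) : u = v := by
  ext i; fin_cases i <;> assumption

theorem partialDeriv_sub {F G : Space → CVec} {x : Space} (hF : DifferentiableAt ℝ F x)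
    (hG : DifferentiableAt ℝ G x) (i j : Fin 3) :
    partialDeriv (F - G) i j x = partialDeriv F i j x - partialDeriv G i j x := by
  simp [partialDeriv, fderiv_sub hF hG]

theorem curl_sub {F G : Space → CVec} {x : Space} (hF : DifferentiableAt ℝ F x)
    (hG : DifferentiableAt ℝ G x) : curl (F - G) x = curl F x - curl G x := by
  apply CVec.ext_three <;>
    simp only [PiLp.sub_apply, curl_apply_zero, curl_apply_one, curl_apply_two,
      partialDeriv_sub hF hG] <;> ring

/-- The curl is a linear function of the derivative. -/
theorem exists_curlL : ∃ L : (Space →L[ℝ] CVec) →L[ℝ] CVec,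
    ∀ (F : Space → CVec) (x : Space), curl F x = L (fderiv ℝ F x) := by
  let L : (Space →L[ℝ] CVec) →ₗ[ℝ] CVec :=
    { toFun := fun A => !₂[A (EuclideanSpace.single 1 1) 2 - A (EuclideanSpace.single 2 1) 1,
        A (EuclideanSpace.single 2 1) 0 - A (EuclideanSpace.single 0 1) 2,
        A (EuclideanSpace.single 0 1) 1 - A (EuclideanSpace.single 1 1) 0]
      map_add' := fun A B => by
        apply CVec.ext_three <;> simp <;> ring
      map_smul' := fun c A => by
        apply CVec.ext_three <;> simp <;> ring }
  exact ⟨LinearMap.toContinuousLinearMap L, fun F x => rfl⟩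

theorem ContDiffOn.curl_of_isOpen {F : Space → CVec} {U : Set Space} (hU : IsOpen U)
    (hF : ContDiffOn ℝ ∞ F U) : ContDiffOn ℝ ∞ (curl F) U := by
  obtain ⟨L, hL⟩ := exists_curlL
  have h := hF.fderiv_of_isOpen (m := ∞) hU (by simp)
  have : curl F = fun x => L (fderiv ℝ F x) := funext (hL F)
  rw [this]
  exact L.contDiff.comp_contDiffOn h

theorem ContDiff.curl {F : Space → CVec} (hF : ContDiff ℝ ∞ F) : ContDiff ℝ ∞ (curl F) := by
  rw [← contDiffOn_univ] at hF ⊢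
  exact ContDiffOn.curl_of_isOpen isOpen_univ hF

theorem tsupport_curl_subset (F : Space → CVec) : tsupport (curl F) ⊆ tsupport F := by
  obtain ⟨L, hL⟩ := exists_curlL
  refine (closure_minimal ?_ isClosed_closure).trans (tsupport_fderiv_subset ℝ (f := F))
  intro x hx
  apply subset_closure
  intro h
  apply hx
  rw [hL, h, map_zero]

/-! ### Integrability -/

theorem memLp_component {μ : Measure Space} {u : Space → CVec} (hu : MemLp u 2 μ) (i : Fin 3) :
    MemLp (fun x => u x i) 2 μ :=
  (EuclideanSpace.proj (𝕜 := ℂ) i).comp_memLp' hu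

theorem integrable_cdot {μ : Measure Space} {u v : Space → CVec} (hu : MemLp u 2 μ)
    (hv : MemLp v 2 μ) : Integrable (fun x => cdot (u x) (v x)) μ := by
  simp only [cdot]
  exact integrable_finsetSum _ fun i _ => (memLp_component hu i).integrable_mul (memLp_component hv i)

theorem memLp_of_continuous {μ : Measure Space} [IsFiniteMeasureOnCompacts μ] {φ : Space → CVec}
    (h : Continuous φ) (hc : HasCompactSupport φ) : MemLp φ 2 μ :=
  h.memLp_of_hasCompactSupport hc

theorem exists_radius {φ : Space → CVec} (hc : HasCompactSupport φ) :
    ∃ r : ℝ, 0 < r ∧ tsupport φ ⊆ Metric.ball 0 r := by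
  obtain ⟨r, hr⟩ := hc.isCompact.isBounded.subset_ball (0 : Space)
  exact ⟨max r 1, by positivity, hr.trans (Metric.ball_subset_ball (le_max_left _ _))⟩

/-- A locally square integrable field can be paired with a compactly supported one. -/
theorem integrable_cdot_of_local {u φ : Space → CVec} (hu : ∀ r, MemLp u 2 (ballMeasure r))
    (h : Continuous φ) (hc : HasCompactSupport φ) : Integrable (fun x => cdot (u x) (φ x)) := by
  obtain ⟨r, -, hr⟩ := exists_radius hc
  have h1 : IntegrableOn (fun x => cdot (u x) (φ x)) (Metric.ball 0 r) :=
    integrable_cdot (hu r) (memLp_of_continuous h hc)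
  refine (integrableOn_iff_integrable_of_support_subset ?_).1 h1
  intro x hx
  apply hr
  apply subset_closure
  intro h0
  apply hx
  simp [h0, cdot_zero_right]

/-! ### Integration by parts and the fundamental lemma -/

theorem continuous_mul_of_tsupport_subset {U : Set Space} (hU : IsOpen U) {f g : Space → ℂ}
    (hf : ContinuousOn f U) (hg : Continuous g) (hgU : tsupport g ⊆ U) :
    Continuous fun x => f x * g x := by
  refine ContinuousOn.continuous_of_tsupport_subset (hf.mul hg.continuousOn) hU ?_
  exact (tsupport_mul_subset_right (f := f) (g := g)).trans hgU

/-- Integration by parts for one partial derivative. -/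
theorem integral_partialDeriv_mul {U : Set Space} (hU : IsOpen U) {F φ : Space → CVec}
    (hF : ContDiffOn ℝ ∞ F U) (hφ : ContDiff ℝ ∞ φ) (hc : HasCompactSupport φ)
    (hs : tsupport φ ⊆ U) (i j k : Fin 3) :
    Integrable (fun x => F x j * partialDeriv φ i k x) ∧
    Integrable (fun x => partialDeriv F i j x * φ x k) ∧
    ∫ x, F x j * partialDeriv φ i k x = - ∫ x, partialDeriv F i j x * φ x k := by
  set f : Space → ℂ := fun x => F x j
  set g : Space → ℂ := fun x => φ x k
  have hf : ContDiffOn ℝ ∞ f U :=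
    ((EuclideanSpace.proj (𝕜 := ℂ) j).restrictScalars ℝ).contDiff.comp_contDiffOn hF
  have hg : ContDiff ℝ ∞ g :=
    ((EuclideanSpace.proj (𝕜 := ℂ) k).restrictScalars ℝ).contDiff.comp hφ
  have hgs : tsupport g ⊆ tsupport φ := by
    apply closure_mono
    intro x hx h0
    apply hx
    simp [g, h0]
  have hgc : HasCompactSupport g := hc.mono' (subset_closure.trans hgs)
  have hgU := hgs.trans hs
  set v : Space := EuclideanSpace.single i 1
  have e1 : (fun x => F x j * partialDeriv φ i k x) = fun x => f x * fderiv ℝ g x v := by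
    ext x
    rw [partialDeriv_eq (hφ.differentiable (by simp) x)]
  have e2 : (fun x => partialDeriv F i j x * φ x k) = fun x => fderiv ℝ f x v * g x := by
    ext x
    -- Off U nothing is known about the derivative of F, but there the factor φ_k is zero.
    by_cases hx : x ∈ U
    · rw [partialDeriv_eq ((hF.differentiableOn (by simp)).differentiableAt (hU.mem_nhds hx))]
    · have : φ x k = 0 := image_eq_zero_of_notMem_tsupport (f := g) fun h => hx (hgU h)
      simp [g, this]
  have hdg : Continuous fun x => fderiv ℝ g x v := by
    have := hg.continuous_fderiv (by simp)
    fun_prop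
  have hdgs : tsupport (fun x => fderiv ℝ g x v) ⊆ tsupport g :=
    tsupport_fderiv_apply_subset ℝ v
  have hdf : ContinuousOn (fun x => fderiv ℝ f x v) U :=
    (hf.continuousOn_fderiv_of_isOpen hU (by simp)).clm_apply continuousOn_const
  have i1 : Integrable fun x => f x * fderiv ℝ g x v :=
    (continuous_mul_of_tsupport_subset hU hf.continuousOn hdg (hdgs.trans hgU)).integrable_of_hasCompactSupport
      ((hgc.mono' (subset_closure.trans hdgs)).mul_left)
  have i2 : Integrable fun x => fderiv ℝ f x v * g x :=
    (continuous_mul_of_tsupport_subset hU hdf hg.continuous hgU).integrable_of_hasCompactSupport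
      hgc.mul_left
  have i3 : Integrable fun x => f x * g x :=
    (continuous_mul_of_tsupport_subset hU hf.continuousOn hg.continuous hgU).integrable_of_hasCompactSupport
      hgc.mul_left
  refine ⟨e1 ▸ i1, e2 ▸ i2, ?_⟩
  rw [e1, e2]
  exact integral_mul_fderiv_eq_neg_fderiv_mul_of_integrable i2 i1 i3
    (fun x hx => (hf.differentiableOn (by simp)).differentiableAt (hU.mem_nhds (hgU hx)))
    (fun x _ => hg.differentiable (by simp) x)

theorem integral_alternating_sum {μ : Measure Space} {a b c d e f : Space → ℂ}
    (ha : Integrable a μ) (hb : Integrable b μ) (hc : Integrable c μ) (hd : Integrable d μ)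
    (he : Integrable e μ) (hf : Integrable f μ) :
    ∫ x, ((a x - b x) + (c x - d x) + (e x - f x)) ∂μ =
      ((∫ x, a x ∂μ - ∫ x, b x ∂μ) + (∫ x, c x ∂μ - ∫ x, d x ∂μ)) +
        (∫ x, e x ∂μ - ∫ x, f x ∂μ) := by
  have h1 : Integrable (fun x => a x - b x) μ := ha.sub hb
  have h2 : Integrable (fun x => c x - d x) μ := hc.sub hd
  have h3 : Integrable (fun x => e x - f x) μ := he.sub hf
  rw [integral_add (f := fun x => (a x - b x) + (c x - d x)) (h1.add h2) h3, integral_add h1 h2,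
    integral_sub ha hb, integral_sub hc hd, integral_sub he hf]

/-- Each of the six terms is a scalar integration by parts without boundary term, because φ has
compact support inside U. Smoothness of F is needed on U only. -/
theorem integral_cdot_curl {U : Set Space} (hU : IsOpen U) {F φ : Space → CVec}
    (hF : ContDiffOn ℝ ∞ F U) (hφ : ContDiff ℝ ∞ φ) (hc : HasCompactSupport φ)
    (hs : tsupport φ ⊆ U) :
    ∫ x, cdot (F x) (curl φ x) = ∫ x, cdot (curl F x) (φ x) := by
  have H := integral_partialDeriv_mul hU hF hφ hc hs
  have L : ∀ x, cdot (F x) (curl φ x) =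
      (F x 0 * partialDeriv φ 1 2 x - F x 0 * partialDeriv φ 2 1 x) +
      (F x 1 * partialDeriv φ 2 0 x - F x 1 * partialDeriv φ 0 2 x) +
      (F x 2 * partialDeriv φ 0 1 x - F x 2 * partialDeriv φ 1 0 x) := fun x => by
    rw [cdot_apply, curl_apply_zero, curl_apply_one, curl_apply_two]; ring
  have R : ∀ x, cdot (curl F x) (φ x) =
      (partialDeriv F 1 2 x * φ x 0 - partialDeriv F 2 1 x * φ x 0) +
      (partialDeriv F 2 0 x * φ x 1 - partialDeriv F 0 2 x * φ x 1) +
      (partialDeriv F 0 1 x * φ x 2 - partialDeriv F 1 0 x * φ x 2) := fun x => by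
    rw [cdot_apply, curl_apply_zero, curl_apply_one, curl_apply_two]; ring
  simp only [L, R]
  have hl := fun i j k => (H i j k).1
  have hr := fun i j k => (H i j k).2.1
  rw [integral_alternating_sum (hl _ _ _) (hl _ _ _) (hl _ _ _) (hl _ _ _) (hl _ _ _) (hl _ _ _),
    integral_alternating_sum (hr _ _ _) (hr _ _ _) (hr _ _ _) (hr _ _ _) (hr _ _ _) (hr _ _ _)]
  simp only [(H _ _ _).2.2]
  ring

/-- The fundamental lemma of the calculus of variations for vector fields. -/
theorem ae_eq_zero_of_integral_cdot {U : Set Space} (hU : IsOpen U) {u : Space → CVec}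
    (hu : LocallyIntegrableOn u U)
    (h : ∀ φ : Space → CVec, ContDiff ℝ ∞ φ → HasCompactSupport φ → tsupport φ ⊆ U →
      ∫ x, cdot (u x) (φ x) = 0) : ∀ᵐ x : Space, x ∈ U → u x = 0 := by
  have key : ∀ j : Fin 3, ∀ᵐ x : Space, x ∈ U → u x j = 0 := by
    intro j
    refine hU.ae_eq_zero_of_integral_contDiff_smul_eq_zero (f := fun x => u x j) ?_ ?_
    · intro x hx
      obtain ⟨s, hs, hi⟩ := hu x hx
      exact ⟨s, hs, (EuclideanSpace.proj (𝕜 := ℂ) j).integrable_comp hi⟩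
    · intro g hg hgc hgU
      have := h (fun x => g x • EuclideanSpace.single j (1 : ℂ)) (hg.smul contDiff_const)
        hgc.smul_right ((tsupport_smul_subset_left g _).trans hgU)
      rw [← this]
      congr 1
      ext x
      simp [cdot, mul_comm]
  filter_upwards [key 0, key 1, key 2] with x h0 h1 h2 hx
  exact CVec.ext_three (h0 hx) (h1 hx) (h2 hx)

end MaxwellSource

namespace MaxwellSource

/-! ### One-dimensional lemmas -/

theorem integrableOn_Ioi_mul {R b : ℝ} {f g : ℝ → ℂ} (hf : IntegrableOn f (Set.Ioc R b))
    (hg : Continuous g) (hb : ∀ r, b ≤ r → g r = 0) :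
    IntegrableOn (fun r => f r * g r) (Set.Ioi R) := by
  have h : IntegrableOn (fun r => f r * g r) (Set.Ioc R b) :=
    hf.mul_continuousOn_of_subset hg.continuousOn measurableSet_Ioc isCompact_Icc
      Set.Ioc_subset_Icc_self
  refine h.of_forall_sdiff_eq_zero measurableSet_Ioi fun x hx => ?_
  have : b ≤ x := by
    by_contra hlt
    exact hx.2 ⟨hx.1, (not_le.1 hlt).le⟩
  simp [hb x this]

/-- A weak first order equation on `(R, ∞)`, tested with functions that need not vanish at `R`,
holds classically and carries a homogeneous boundary condition. -/
theorem hasDerivAt_and_tendsto_of_weak {R : ℝ} {m n : ℝ → ℂ}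
    (hm : ContinuousOn m (Set.Ioi R)) (hn : ContinuousOn n (Set.Ioi R))
    (hmi : ∀ b, IntegrableOn m (Set.Ioc R b)) (hni : ∀ b, IntegrableOn n (Set.Ioc R b))
    (h : ∀ G : ℝ → ℝ, ContDiff ℝ ∞ G → (∃ a > R, ∃ c, ∀ r < a, G r = c) →
      (∃ b, ∀ r, b ≤ r → G r = 0) →
      ∫ r in Set.Ioi R, (m r * ((deriv G r : ℝ) : ℂ) + n r * (G r : ℂ)) = 0) :
    (∀ r > R, HasDerivAt m (n r) r) ∧ Tendsto m (𝓝[>] R) (𝓝 0) := by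
  -- N is the primitive of n with value 0 at R. Both conclusions follow once m = N on (R, ∞).
  set N : ℝ → ℂ := fun r => ∫ t in R..r, n t with hN
  have hnI : ∀ b, R ≤ b → IntervalIntegrable n volume R b := fun b hb => by
    rw [intervalIntegrable_iff_integrableOn_Ioc_of_le hb]
    exact hni b
  have hNd : ∀ r > R, HasDerivAt N (n r) r := fun r hr =>
    intervalIntegral.integral_hasDerivAt_right (hnI r hr.le)
      (hn.stronglyMeasurableAtFilter isOpen_Ioi r hr) (hn.continuousAt (Ioi_mem_nhds hr))
  have hNc : ContinuousOn N (Set.Ioi R) := fun r hr => (hNd r hr).continuousAt.continuousWithinAt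
  have hNcc : ∀ b, R < b → ContinuousOn N (Set.Icc R b) := fun b hb => by
    have := intervalIntegral.continuousOn_primitive_interval (μ := volume) (f := n) (a := R)
      (b := b) (by
        rw [Set.uIcc_of_le hb.le, integrableOn_Icc_iff_integrableOn_Ioc]
        exact hni b)
    rwa [Set.uIcc_of_le hb.le] at this
  have hN0 : Tendsto N (𝓝[>] R) (𝓝 0) := by
    have h1 := hNcc (R + 1) (by linarith) R ⟨le_rfl, by linarith⟩
    have h2 : N R = 0 := by simp [hN]
    rw [ContinuousWithinAt, h2] at h1
    refine h1.mono_left ?_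
    rw [← nhdsWithin_Ioo_eq_nhdsGT (show R < R + 1 by linarith)]
    exact nhdsWithin_mono _ Set.Ioo_subset_Icc_self
  have hNi : ∀ b, IntegrableOn N (Set.Ioc R b) := fun b => by
    rcases le_or_gt b R with hb | hb
    · simp [Set.Ioc_eq_empty (not_lt.2 hb)]
    · exact ((hNcc b hb).integrableOn_compact isCompact_Icc).mono_set Set.Ioc_subset_Icc_self
  have key : ∀ᵐ r : ℝ, r ∈ Set.Ioi R → m r - N r = 0 := by
    refine isOpen_Ioi.ae_eq_zero_of_integral_contDiff_smul_eq_zero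
      ((hm.sub hNc).locallyIntegrableOn measurableSet_Ioi) ?_
    intro g hg hgc hgs
    obtain ⟨a, b, ha, hab⟩ : ∃ a b : ℝ, R < a ∧ tsupport g ⊆ Set.Icc a b := by
      rcases (tsupport g).eq_empty_or_nonempty with he | hne
      · exact ⟨R + 1, R + 1, by linarith, by simp [he]⟩
      · obtain ⟨a, ha, hal⟩ := hgc.isCompact.exists_isLeast hne
        obtain ⟨b, hb, hbl⟩ := hgc.isCompact.exists_isGreatest hne
        exact ⟨a, b, hgs ha, fun x hx => ⟨hal hx, hbl hx⟩⟩
    have hg0 : ∀ r, r ∉ Set.Icc a b → g r = 0 := fun r hr =>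
      image_eq_zero_of_notMem_tsupport fun h' => hr (hab h')
    -- The primitive of g that vanishes to the right of its support. To the left it is constant but
    -- usually not zero; admitting such test functions is what forces the boundary value of m.
    set G : ℝ → ℝ := fun r => ∫ t in (max a b)..r, g t with hG
    have hGd : ∀ r, HasDerivAt G (g r) r := fun r =>
      intervalIntegral.integral_hasDerivAt_right (hg.continuous.intervalIntegrable _ _)
        hg.continuous.stronglyMeasurable.stronglyMeasurableAtFilter hg.continuous.continuousAt
    have hGderiv : deriv G = g := funext fun r => (hGd r).deriv
    have hGs : ContDiff ℝ ∞ G :=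
      contDiff_infty_iff_deriv.2 ⟨fun r => (hGd r).differentiableAt, hGderiv ▸ hg⟩
    have hGb : ∀ r, max a b ≤ r → G r = 0 := by
      intro r hr
      refine (intervalIntegral.integral_congr_ae (g := fun _ => 0)
        (Eventually.of_forall fun x hx => ?_)).trans (by simp)
      rw [Set.uIoc_of_le hr] at hx
      exact hg0 x fun h' => absurd (h'.2.trans (le_max_right a b)) (not_le.2 hx.1)
    -- The constant value is read off at an arbitrary point to the left of a.
    have hGa : ∀ r < a, G r = G (a - (a - R) / 2 - 1) := by
      intro r hr
      have : ∀ s, s < a → G s = ∫ t in (max a b)..a, g t := by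
        intro s hs
        rw [hG]
        simp only
        rw [← intervalIntegral.integral_add_adjacent_intervals (b := a)
          (hg.continuous.intervalIntegrable _ _) (hg.continuous.intervalIntegrable _ _)]
        have : ∫ t in a..s, g t = 0 := by
          rw [intervalIntegral.integral_symm, neg_eq_zero]
          refine (intervalIntegral.integral_congr_ae (g := fun _ => 0) ?_).trans (by simp)
          have h0 : ∀ᵐ x : ℝ, x ≠ a := by simp [ae_iff]
          filter_upwards [h0] with x hxa hx
          rw [Set.uIoc_of_le hs.le] at hx
          exact hg0 x fun h' => hxa (le_antisymm hx.2 h'.1)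
        rw [this, add_zero]
      rw [this r hr, this _ (by linarith)]
    have h1 := h G hGs ⟨a, ha, _, hGa⟩ ⟨_, hGb⟩
    rw [hGderiv] at h1
    have hgC : Continuous fun r => (g r : ℂ) := Complex.continuous_ofReal.comp hg.continuous
    have hGC : Continuous fun r => (G r : ℂ) := Complex.continuous_ofReal.comp hGs.continuous
    have hg0' : ∀ r, max a b + 1 ≤ r → (g r : ℂ) = 0 := fun r hr => by
      rw [hg0 r fun h' => ?_, Complex.ofReal_zero]
      have := h'.2.trans (le_max_right a b)
      linarith
    have hG0' : ∀ r, max a b ≤ r → (G r : ℂ) = 0 := fun r hr => by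
      rw [hGb r hr, Complex.ofReal_zero]
    have imG := integrableOn_Ioi_mul (hmi _) hgC hg0'
    have inG := integrableOn_Ioi_mul (hni _) hGC hG0'
    have iNG := integrableOn_Ioi_mul (hNi _) hgC hg0'
    -- This is ∫ N g = −∫ n G. The boundary term at R disappears because N tends to 0 there,
    -- although G need not.
    have h2 := integral_Ioi_mul_deriv_eq_deriv_mul (a := R) (u := N) (v := fun r => (G r : ℂ))
      (u' := n) (v' := fun r => (g r : ℂ)) (a' := 0) (b' := 0) hNd
      (fun x _ => (hGd x).ofReal_comp) iNG inG
      (by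
        have := hN0.mul (hGC.continuousAt.tendsto.mono_left (nhdsWithin_le_nhds (s := Set.Ioi R)))
        rw [zero_mul] at this
        exact this)
      (by
        refine tendsto_const_nhds.congr' ?_
        filter_upwards [eventually_ge_atTop (max a b)] with r hr
        simp [hGb r hr])
    rw [integral_add imG inG] at h1
    have h3 : ∫ r, g r • (m r - N r) = ∫ r in Set.Ioi R, (m r * (g r : ℂ) - N r * (g r : ℂ)) := by
      rw [← setIntegral_eq_integral_of_forall_compl_eq_zero (s := Set.Ioi R)]
      · congr 1
        ext r
        rw [Complex.real_smul]
        ring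
      · intro x hx
        have hx' : x ≤ R := not_lt.1 hx
        rw [hg0 x fun h' => absurd h'.1 (not_le.2 (hx'.trans_lt ha)), zero_smul]
    rw [h3, integral_sub imG iNG, h2]
    linear_combination h1
  have heq : Set.EqOn m N (Set.Ioi R) := by
    refine Measure.eqOn_open_of_ae_eq (μ := volume) ?_ isOpen_Ioi hm hNc
    rw [Filter.EventuallyEq, ae_restrict_iff' measurableSet_Ioi]
    filter_upwards [key] with r hr hr'
    exact sub_eq_zero.1 (hr hr')
  refine ⟨fun r hr => ?_, ?_⟩
  · exact (hNd r hr).congr_of_eventuallyEq (heq.eventuallyEq_of_mem (Ioi_mem_nhds hr))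
  · exact hN0.congr' (heq.symm.eventuallyEq_of_mem self_mem_nhdsWithin)

/-- As `hasDerivAt_and_tendsto_of_weak`, for test functions that vanish near `R`. -/
theorem hasDerivAt_of_weak {R : ℝ} {m n : ℝ → ℂ}
    (hm : ContinuousOn m (Set.Ioi R)) (hn : ContinuousOn n (Set.Ioi R))
    (hmi : ∀ b, IntegrableOn m (Set.Ioc R b)) (hni : ∀ b, IntegrableOn n (Set.Ioc R b))
    (h : ∀ G : ℝ → ℝ, ContDiff ℝ ∞ G → (∃ a > R, ∀ r < a, G r = 0) →
      (∃ b, ∀ r, b ≤ r → G r = 0) →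
      ∫ r in Set.Ioi R, (m r * ((deriv G r : ℝ) : ℂ) + n r * (G r : ℂ)) = 0) :
    ∀ r > R, HasDerivAt m (n r) r := by
  intro r₀ hr₀
  set a := (R + r₀) / 2 with ha
  set c := (R + a) / 2 with hc
  have hRc : R < c := by rw [hc, ha]; linarith
  have hca : c < a := by rw [hc, ha]; linarith
  have har : a < r₀ := by rw [ha]; linarith
  -- A cutoff that vanishes near R and equals 1 near r₀. The product mχ satisfies the weak equation
  -- with right side mχ' + nχ for all test functions G, since χG vanishes near R.
  set χ : ℝ → ℝ := fun r => Real.smoothTransition ((r - c) / (a - c)) with hχ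
  have hχs : ContDiff ℝ ∞ χ := Real.smoothTransition.contDiff.comp (by fun_prop)
  have hχ0 : ∀ r < c, χ r = 0 := fun r hr =>
    Real.smoothTransition.zero_of_nonpos (div_nonpos_of_nonpos_of_nonneg (by linarith) (by linarith))
  have hχ1 : ∀ r > a, χ r = 1 := fun r hr =>
    Real.smoothTransition.one_of_one_le ((one_le_div (by linarith)).2 (by linarith))
  have hχC : Continuous fun r => (χ r : ℂ) := Complex.continuous_ofReal.comp hχs.continuous
  have hχC' : Continuous fun r => ((deriv χ r : ℝ) : ℂ) :=
    Complex.continuous_ofReal.comp (hχs.continuous_deriv (by simp))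
  have mulc : ∀ {f : ℝ → ℂ} {g : ℝ → ℂ}, (∀ b, IntegrableOn f (Set.Ioc R b)) → Continuous g →
      ∀ b, IntegrableOn (fun r => f r * g r) (Set.Ioc R b) := fun hf hg b =>
    (hf b).mul_continuousOn_of_subset hg.continuousOn measurableSet_Ioc isCompact_Icc
      Set.Ioc_subset_Icc_self
  have key := (hasDerivAt_and_tendsto_of_weak (R := R) (m := fun r => m r * χ r)
    (n := fun r => m r * ((deriv χ r : ℝ) : ℂ) + n r * (χ r : ℂ)) (hm.mul hχC.continuousOn)
    ((hm.mul hχC'.continuousOn).add (hn.mul hχC.continuousOn)) (mulc hmi hχC)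
    (fun b => (mulc hmi hχC' b).add (mulc hni hχC b)) ?_).1 r₀ hr₀
  · have hd : deriv χ r₀ = 0 := by
      have : χ =ᶠ[𝓝 r₀] fun _ => 1 := by
        filter_upwards [Ioi_mem_nhds har] with r hr using hχ1 r hr
      rw [this.deriv_eq, deriv_const]
    simp only [hd, hχ1 r₀ har, Complex.ofReal_zero, Complex.ofReal_one, mul_zero, zero_add,
      mul_one] at key
    refine key.congr_of_eventuallyEq ?_
    filter_upwards [Ioi_mem_nhds har] with r hr
    simp [hχ1 r hr]
  · rintro G hG - ⟨b, hb⟩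
    have h1 := h (fun r => χ r * G r) (hχs.mul hG) ⟨c, hRc, fun r hr => by simp [hχ0 r hr]⟩
      ⟨b, fun r hr => by simp [hb r hr]⟩
    rw [← h1]
    congr 1
    ext r
    rw [deriv_fun_mul (hχs.differentiable (by simp) r) (hG.differentiable (by simp) r)]
    push_cast
    ring

/-- A radiating solution of a spherical Bessel equation on `(R, ∞)` with a homogeneous Dirichlet or
Neumann condition at `R` vanishes. -/
theorem eq_zero_of_bessel_of_radiating {κ R l : ℝ} (hκ : 0 < κ) (hR : 0 < R) (hl : 0 ≤ l)
    {y y₁ : ℝ → ℂ} (hy : ∀ r > R, HasDerivAt y (y₁ r) r)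
    (hy₁ : ∀ r > R, HasDerivAt y₁ (-((κ : ℂ) ^ 2 - l / (r : ℂ) ^ 2) * y r) r)
    (hbc : Tendsto y (𝓝[>] R) (𝓝 0) ∨ Tendsto y₁ (𝓝[>] R) (𝓝 0))
    (hrad : Tendsto (fun r => y₁ r - Complex.I * κ * y r) atTop (𝓝 0)) :
    ∀ r > R, y r = 0 := by
  set e : ℝ → ℝ := fun r => ‖y₁ r‖ ^ 2 + κ ^ 2 * ‖y r‖ ^ 2 with he
  -- With this C the energy satisfies |e'| ≤ (C / r²) e, by 2κ|y₁||y| ≤ e. Hence the factor exp(−C /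
  -- r) makes q nondecreasing.
  set C : ℝ := l / κ with hC
  have hC0 : 0 ≤ C := by positivity
  set q : ℝ → ℝ := fun r => e r * Real.exp (-(C * r⁻¹)) with hq
  have he0 : ∀ r, 0 ≤ e r := fun r => by positivity
  have hder : ∀ r > R, HasDerivAt q
      ((2 * (l / r ^ 2) * inner ℝ (y₁ r) (y r)) * Real.exp (-(C * r⁻¹)) +
        e r * (Real.exp (-(C * r⁻¹)) * (C / r ^ 2))) r := by
    intro r hr
    have hr0 : r ≠ 0 := by linarith
    have h1 : HasDerivAt e (2 * (l / r ^ 2) * inner ℝ (y₁ r) (y r)) r := by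
      have h := (hy₁ r hr).norm_sq.add ((hy r hr).norm_sq.const_mul (κ ^ 2))
      refine h.congr_deriv ?_
      have : -((κ : ℂ) ^ 2 - l / (r : ℂ) ^ 2) * y r = (-(κ ^ 2 - l / r ^ 2) : ℝ) • y r := by
        rw [Complex.real_smul]; push_cast; ring
      rw [this, real_inner_smul_right, real_inner_comm (y r) (y₁ r)]
      ring
    have h2 : HasDerivAt (fun r : ℝ => -(C * r⁻¹)) (C / r ^ 2) r := by
      have := ((hasDerivAt_inv hr0).const_mul C).neg
      exact this.congr_deriv (by field_simp)
    exact h1.mul h2.exp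
  have hmono : MonotoneOn q (Set.Ioi R) := by
    refine monotoneOn_of_deriv_nonneg (convex_Ioi R)
      (fun r hr => (hder r hr).continuousAt.continuousWithinAt) ?_ ?_
    · rw [interior_Ioi]
      exact fun r hr => (hder r hr).differentiableAt.differentiableWithinAt
    · rw [interior_Ioi]
      intro r hr
      have hr0 : 0 < r := hR.trans hr
      rw [(hder r hr).deriv]
      have h1 : |inner ℝ (y₁ r) (y r)| ≤ ‖y₁ r‖ * ‖y r‖ := abs_real_inner_le_norm _ _
      have h2 : 2 * (‖y₁ r‖ * ‖y r‖) * κ ≤ e r := by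
        rw [he]
        nlinarith [sq_nonneg (‖y₁ r‖ - κ * ‖y r‖)]
      have h3 : -(e r) ≤ 2 * κ * inner ℝ (y₁ r) (y r) := by
        have := neg_le_of_abs_le h1
        nlinarith
      have h4 : 0 ≤ 2 * (l / r ^ 2) * inner ℝ (y₁ r) (y r) + e r * (C / r ^ 2) := by
        have h5 : 2 * (l / r ^ 2) * inner ℝ (y₁ r) (y r) + e r * (C / r ^ 2) =
            (l / (κ * r ^ 2)) * (2 * κ * inner ℝ (y₁ r) (y r) + e r) := by
          rw [hC]; field_simp
        rw [h5]
        exact mul_nonneg (by positivity) (by linarith)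
      have := mul_nonneg h4 (Real.exp_pos (-(C * r⁻¹))).le
      linarith
  -- the Wronskian
  set W : ℝ → ℝ := fun r => inner ℝ (Complex.I * y r) (y₁ r) with hW
  -- The coefficient of the equation is real, so both terms of the derivative are real inner
  -- products of iz with a real multiple of z, and vanish.
  have hWd : ∀ r > R, HasDerivAt W 0 r := by
    intro r hr
    have h := ((hy r hr).const_mul Complex.I).inner ℝ (hy₁ r hr)
    refine h.congr_deriv ?_
    have : -((κ : ℂ) ^ 2 - l / (r : ℂ) ^ 2) = ((-(κ ^ 2 - l / r ^ 2) : ℝ) : ℂ) := by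
      push_cast; ring
    rw [this]
    generalize -(κ ^ 2 - l / r ^ 2) = c
    simp [Complex.inner]
    ring
  have hWc : ∀ r > R, ∀ s > R, W r = W s := fun r hr s hs =>
    isOpen_Ioi.is_const_of_deriv_eq_zero isPreconnected_Ioi
      (fun x hx => (hWd x hx).differentiableAt.differentiableWithinAt)
      (fun x hx => (hWd x hx).deriv) hr hs
  have hbd : ∀ᶠ r in 𝓝[>] R, e r ≤ q (R + 1) * Real.exp (C * R⁻¹) := by
    have hmem : Set.Ioo R (R + 1) ∈ 𝓝[>] R := Ioo_mem_nhdsGT (by linarith)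
    filter_upwards [hmem] with r hr
    have h1 : q r ≤ q (R + 1) := hmono hr.1 (by simp) hr.2.le
    have h2 : e r = q r * Real.exp (C * r⁻¹) := by
      rw [hq]; simp only; rw [mul_assoc, ← Real.exp_add]; simp
    rw [h2]
    have h3 : Real.exp (C * r⁻¹) ≤ Real.exp (C * R⁻¹) := by
      apply Real.exp_le_exp.2
      exact mul_le_mul_of_nonneg_left (inv_anti₀ hR hr.1.le) hC0
    have h4 : 0 ≤ q r := mul_nonneg (he0 r) (Real.exp_pos _).le
    exact mul_le_mul h1 h3 (Real.exp_pos _).le (h4.trans h1)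
  -- Monotonicity of q bounds both y and y₁ near R; the boundary condition sends one of them to 0,
  -- so the product does too.
  have hWt : Tendsto W (𝓝[>] R) (𝓝 0) := by
    set B := Real.sqrt (q (R + 1) * Real.exp (C * R⁻¹)) with hB
    have hb1 : ∀ᶠ r in 𝓝[>] R, ‖y₁ r‖ ≤ B := by
      filter_upwards [hbd] with r hr
      apply Real.le_sqrt_of_sq_le
      refine le_trans ?_ hr
      rw [he]
      nlinarith [sq_nonneg (κ * ‖y r‖)]
    have hb2 : ∀ᶠ r in 𝓝[>] R, ‖y r‖ ≤ B / κ := by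
      filter_upwards [hbd] with r hr
      rw [le_div_iff₀ hκ]
      apply Real.le_sqrt_of_sq_le
      refine le_trans ?_ hr
      rw [he]
      nlinarith [sq_nonneg (‖y₁ r‖)]
    have hWle : ∀ r, ‖W r‖ ≤ ‖y r‖ * ‖y₁ r‖ := fun r => by
      refine (norm_inner_le_norm (𝕜 := ℝ) _ _).trans_eq ?_
      simp
    rcases hbc with h0 | h0
    · refine squeeze_zero_norm' (a := fun r => ‖y r‖ * B) ?_ ?_
      · filter_upwards [hb1] with r hr
        exact (hWle r).trans (mul_le_mul_of_nonneg_left hr (norm_nonneg _))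
      · simpa using h0.norm.mul_const B
    · refine squeeze_zero_norm' (a := fun r => B / κ * ‖y₁ r‖) ?_ ?_
      · filter_upwards [hb2] with r hr
        exact (hWle r).trans (mul_le_mul_of_nonneg_right hr (norm_nonneg _))
      · simpa using h0.norm.const_mul (B / κ)
  have hW0 : ∀ r > R, W r = 0 := by
    intro r hr
    have h1 : Tendsto W (𝓝[>] R) (𝓝 (W r)) := by
      refine tendsto_const_nhds.congr' ?_
      filter_upwards [self_mem_nhdsWithin] with s hs using hWc r hr s hs
    exact tendsto_nhds_unique h1 hWt
  -- Once W = 0, the cross term in the square is absent and the energy is exactly the square of the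
  -- radiation defect.
  have hee : ∀ r > R, e r = ‖y₁ r - Complex.I * κ * y r‖ ^ 2 := by
    intro r hr
    have h1 := hW0 r hr
    rw [norm_sub_sq_real]
    have h2 : Complex.I * κ * y r = κ • (Complex.I * y r) := by
      rw [Complex.real_smul]; ring
    rw [h2, real_inner_smul_right, real_inner_comm]
    change inner ℝ (Complex.I * y r) (y₁ r) = 0 at h1
    rw [h1, he, norm_smul, norm_mul, Complex.norm_I, Real.norm_of_nonneg hκ.le]
    ring
  have het : Tendsto e atTop (𝓝 0) := by
    have : Tendsto (fun r => ‖y₁ r - Complex.I * κ * y r‖ ^ 2) atTop (𝓝 0) := by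
      simpa using hrad.norm.pow 2
    refine this.congr' ?_
    filter_upwards [eventually_gt_atTop R] with r hr using (hee r hr).symm
  intro r hr
  -- q is nondecreasing and lies below e, which tends to 0 at infinity.
  have hq0 : q r ≤ 0 := by
    refine ge_of_tendsto het ?_
    filter_upwards [eventually_ge_atTop r] with s hs
    have hs0 : 0 < s := by linarith
    refine (hmono hr (hr.trans_le hs) hs).trans ?_
    refine mul_le_of_le_one_right (he0 s) (Real.exp_le_one_iff.2 ?_)
    have : 0 ≤ C * s⁻¹ := by positivity
    linarith
  have he1 : e r ≤ 0 := by
    by_contra hlt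
    exact absurd hq0 (not_le.2 (mul_pos (not_le.1 hlt) (Real.exp_pos _)))
  have h1 : ‖y r‖ ^ 2 = 0 := by
    have h2 : 0 ≤ ‖y₁ r‖ ^ 2 := by positivity
    have h3 : 0 ≤ ‖y r‖ ^ 2 := by positivity
    have h4 : 0 < κ ^ 2 := by positivity
    have h5 : ‖y₁ r‖ ^ 2 + κ ^ 2 * ‖y r‖ ^ 2 ≤ 0 := he1
    nlinarith
  simpa using h1

end MaxwellSource

namespace MaxwellSource

/-! ### Polynomial vector fields -/

/-- Complex polynomials in the three coordinates. -/
abbrev Poly : Type := MvPolynomial (Fin 3) ℂ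

/-- Polynomial vector fields. -/
abbrev PVec : Type := Fin 3 → Poly

namespace PVec

open MvPolynomial

/-- The gradient of a polynomial. -/
noncomputable def grad (p : Poly) : PVec := fun i => pderiv i p

/-- The Laplacian of a polynomial. -/
noncomputable def lap (p : Poly) : Poly :=
  pderiv 0 (pderiv 0 p) + pderiv 1 (pderiv 1 p) + pderiv 2 (pderiv 2 p)

/-- The curl of a polynomial vector field. -/
noncomputable def pcurl (V : PVec) : PVec :=
  ![pderiv 1 (V 2) - pderiv 2 (V 1), pderiv 2 (V 0) - pderiv 0 (V 2),
    pderiv 0 (V 1) - pderiv 1 (V 0)]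

/-- The field `x × V(x)`. -/
noncomputable def xcross (V : PVec) : PVec :=
  ![X 1 * V 2 - X 2 * V 1, X 2 * V 0 - X 0 * V 2, X 0 * V 1 - X 1 * V 0]

/-- The polynomial `x · V(x)`. -/
noncomputable def xdot (V : PVec) : Poly := X 0 * V 0 + X 1 * V 1 + X 2 * V 2

/-- The field `p(x) x`. -/
noncomputable def radial (p : Poly) : PVec := fun i => X i * p

/-- The polynomial `|x|²`. -/
noncomputable def rsq : Poly := X 0 * X 0 + X 1 * X 1 + X 2 * X 2

/-- All components are homogeneous of degree `k`. -/
def Homog (V : PVec) (k : ℕ) : Prop := ∀ i, (V i).IsHomogeneous k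

theorem ext_three {V W : PVec} (h0 : V 0 = W 0) (h1 : V 1 = W 1) (h2 : V 2 = W 2) : V = W := by
  ext1 i; fin_cases i <;> assumption

theorem pderiv_comm (i j : Fin 3) (p : Poly) : pderiv i (pderiv j p) = pderiv j (pderiv i p) := by
  have h : ⁅pderiv (R := ℂ) i, pderiv (R := ℂ) j⁆ = 0 := by
    apply MvPolynomial.derivation_ext
    intro l
    simp [Derivation.commutator_apply, pderiv_X, Pi.single_apply]
    split_ifs <;> simp
  have := congrArg (fun D : Derivation ℂ Poly Poly => D p) h
  simpa [Derivation.commutator_apply, sub_eq_zero] using this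

theorem euler {p : Poly} {k : ℕ} (hp : p.IsHomogeneous k) :
    X 0 * pderiv 0 p + X 1 * pderiv 1 p + X 2 * pderiv 2 p = (k : Poly) * p := by
  have := hp.sum_X_mul_pderiv
  rwa [Fin.sum_univ_three, nsmul_eq_mul] at this

theorem euler_pderiv {p : Poly} {k : ℕ} (hp : p.IsHomogeneous k) (i : Fin 3) :
    X 0 * pderiv i (pderiv 0 p) + X 1 * pderiv i (pderiv 1 p) + X 2 * pderiv i (pderiv 2 p) +
      pderiv i p = (k : Poly) * pderiv i p := by
  have h := congrArg (pderiv i) (euler hp)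
  simp only [map_add, Derivation.leibniz, smul_eq_mul, Derivation.map_natCast, mul_zero,
    add_zero] at h
  rw [← h]
  fin_cases i <;> simp [pderiv_X] <;> ring

theorem pcurl_radial (p : Poly) : pcurl (radial p) = -xcross (grad p) := by
  apply ext_three <;> simp [pcurl, radial, xcross, grad, pderiv_X]

theorem xcross_radial (p : Poly) : xcross (radial p) = 0 := by
  apply ext_three <;> simp [radial, xcross] <;> ring

theorem pcurl_grad (p : Poly) : pcurl (grad p) = 0 := by
  apply ext_three <;> simp [pcurl, grad, pderiv_comm]

/-- The identity ∇×(x×A) = x(∇·A) − 2A − (x·∇)A for A = ∇p, where Euler's relation gives (x·∇)∇p =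
(k − 1)∇p. -/
theorem pcurl_xcross_grad {p : Poly} {k : ℕ} (hp : p.IsHomogeneous k) :
    pcurl (xcross (grad p)) = radial (lap p) - (k + 1) • grad p := by
  apply ext_three
  · have := euler_pderiv hp 0
    simp [pcurl, radial, xcross, grad, lap, pderiv_X, nsmul_eq_mul]
    rw [pderiv_comm 1 0, pderiv_comm 2 0]
    linear_combination -this
  · have := euler_pderiv hp 1
    simp [pcurl, radial, xcross, grad, lap, pderiv_X, nsmul_eq_mul]
    rw [pderiv_comm 0 1, pderiv_comm 2 1]
    linear_combination -this
  · have := euler_pderiv hp 2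
    simp [pcurl, radial, xcross, grad, lap, pderiv_X, nsmul_eq_mul]
    rw [pderiv_comm 0 2, pderiv_comm 1 2]
    linear_combination -this

theorem xcross_xcross (V : PVec) : xcross (xcross V) = radial (xdot V) - rsq • V := by
  apply ext_three <;> simp [radial, xcross, xdot, rsq] <;> ring

theorem xdot_grad {p : Poly} {k : ℕ} (hp : p.IsHomogeneous k) : xdot (grad p) = k • p := by
  rw [nsmul_eq_mul, ← euler hp]; rfl

theorem radial_nsmul (k : ℕ) (p : Poly) : radial (k • p) = k • radial p := by
  ext1 i; simp [radial]; ring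

/-- The identity ∇(x·V) = V + (x·∇)V + x×(∇×V), with (x·∇)V = kV by Euler's relation. -/
theorem grad_xdot {V : PVec} {k : ℕ} (hV : Homog V k) :
    grad (xdot V) = (k + 1) • V + xcross (pcurl V) := by
  apply ext_three
  · have := euler (hV 0)
    simp [pcurl, xcross, xdot, grad, pderiv_X, nsmul_eq_mul]
    linear_combination this
  · have := euler (hV 1)
    simp [pcurl, xcross, xdot, grad, pderiv_X, nsmul_eq_mul]
    linear_combination this
  · have := euler (hV 2)
    simp [pcurl, xcross, xdot, grad, pderiv_X, nsmul_eq_mul]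
    linear_combination this

theorem Homog.grad {p : Poly} {k : ℕ} (hp : p.IsHomogeneous k) : Homog (grad p) (k - 1) :=
  fun _ => hp.pderiv

theorem Homog.pcurl {V : PVec} {k : ℕ} (hV : Homog V k) : Homog (pcurl V) (k - 1) := by
  intro i
  fin_cases i
  · exact ((hV 2).pderiv).sub ((hV 1).pderiv)
  · exact ((hV 0).pderiv).sub ((hV 2).pderiv)
  · exact ((hV 1).pderiv).sub ((hV 0).pderiv)

theorem X_mul_homog {p : Poly} {k : ℕ} (hp : p.IsHomogeneous k) (i : Fin 3) :
    (X i * p : Poly).IsHomogeneous (k + 1) := by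
  rw [add_comm]; exact (isHomogeneous_X ℂ i).mul hp

theorem Homog.radial {p : Poly} {k : ℕ} (hp : p.IsHomogeneous k) : Homog (radial p) (k + 1) :=
  fun i => X_mul_homog hp i

theorem Homog.xcross {V : PVec} {k : ℕ} (hV : Homog V k) : Homog (xcross V) (k + 1) := by
  intro i
  fin_cases i
  · exact (X_mul_homog (hV 2) 1).sub (X_mul_homog (hV 1) 2)
  · exact (X_mul_homog (hV 0) 2).sub (X_mul_homog (hV 2) 0)
  · exact (X_mul_homog (hV 1) 0).sub (X_mul_homog (hV 0) 1)

theorem Homog.xdot {V : PVec} {k : ℕ} (hV : Homog V k) : (xdot V).IsHomogeneous (k + 1) :=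
  ((X_mul_homog (hV 0) 0).add (X_mul_homog (hV 1) 1)).add (X_mul_homog (hV 2) 2)

theorem lap_homog {p : Poly} {k : ℕ} (hp : p.IsHomogeneous k) : (lap p).IsHomogeneous (k - 1 - 1) :=
  ((hp.pderiv.pderiv).add hp.pderiv.pderiv).add hp.pderiv.pderiv

theorem pderiv_eq_zero {p : Poly} (hp : p.IsHomogeneous 0) (i : Fin 3) : pderiv i p = 0 := by
  rw [← totalDegree_zero_iff_isHomogeneous, totalDegree_eq_zero_iff_eq_C] at hp
  rw [hp, pderiv_C]

theorem grad_eq_zero {p : Poly} (hp : p.IsHomogeneous 0) : grad p = 0 :=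
  funext fun i => pderiv_eq_zero hp i

/-- Polynomial fields of the three types `p x`, `∇ p`, `x × ∇ p` span all polynomial fields on the
unit sphere. -/
theorem linearMap_eq_zero (L : PVec →ₗ[ℂ] ℂ) (hsq : ∀ V, L (rsq • V) = L V)
    (h1 : ∀ (k : ℕ) (p : Poly), p.IsHomogeneous k → L (radial p) = 0)
    (h2 : ∀ (k : ℕ) (p : Poly), p.IsHomogeneous k → L (grad p) = 0)
    (h3 : ∀ (k : ℕ) (p : Poly), p.IsHomogeneous k → L (xcross (grad p)) = 0) : L = 0 := by
  -- By `grad_xdot`, V is a gradient minus x × curl V, up to the factor k + 1, so only the last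
  -- field has to be treated.
  have key : ∀ (k : ℕ) (V : PVec), Homog V k → L V = 0 := by
    intro k
    induction k using Nat.strong_induction_on with
    | _ k ih =>
      intro V hV
      have e1 := congrArg L (grad_xdot hV)
      rw [h2 _ _ hV.xdot, map_add, map_nsmul] at e1
      suffices hx : L (xcross (pcurl V)) = 0 by
        rw [hx, add_zero, eq_comm, nsmul_eq_mul] at e1
        exact (mul_eq_zero.1 e1).resolve_left (by exact_mod_cast Nat.succ_ne_zero k)
      rcases Nat.eq_zero_or_pos k with rfl | hk
      · have : pcurl V = 0 := by
          apply ext_three <;> simp [pcurl, pderiv_eq_zero (hV _)]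
        have h0 : xcross (pcurl V) = 0 := by
          rw [this]; apply ext_three <;> simp [xcross]
        rw [h0, map_zero]
      · obtain ⟨j, rfl⟩ := Nat.exists_eq_succ_of_ne_zero hk.ne'
        have hW : Homog (pcurl V) j := hV.pcurl
        -- Apply `grad_xdot` to W = curl V and take the cross product with x. The double cross
        -- product leaves a radial field and |x|² curl W; on the sphere |x|² drops out, and curl W
        -- has degree below that of V. For j = 0 the truncated degree j − 1 = 0 is still below j +
        -- 1.
        have e2 : (j + 1) • xcross (pcurl V) =
            xcross (grad (xdot (pcurl V))) -
              (radial (xdot (pcurl (pcurl V))) - rsq • pcurl (pcurl V)) := by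
          rw [grad_xdot hW, ← xcross_xcross]
          apply ext_three <;> simp [xcross, nsmul_eq_mul] <;> ring
        have e3 := congrArg L e2
        rw [map_nsmul, map_sub, map_sub, h3 _ _ hW.xdot, h1 _ _ hW.pcurl.xdot, hsq,
          ih (j - 1) (by omega) _ hW.pcurl, nsmul_eq_mul] at e3
        simp only [sub_zero] at e3
        exact (mul_eq_zero.1 e3).resolve_left (by exact_mod_cast Nat.succ_ne_zero j)
  refine LinearMap.ext fun V => ?_
  have hV : V = ∑ i : Fin 3, ∑ n ∈ Finset.range ((V i).totalDegree + 1),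
      (Pi.single i (homogeneousComponent n (V i)) : PVec) := by
    conv_lhs => rw [← Finset.univ_sum_single V]
    refine Finset.sum_congr rfl fun i _ => ?_
    conv_lhs => rw [← sum_homogeneousComponent (V i)]
    exact map_sum (AddMonoidHom.single (fun _ : Fin 3 => Poly) i) _ _
  rw [hV, map_sum]
  refine Finset.sum_eq_zero fun i _ => ?_
  rw [map_sum]
  refine Finset.sum_eq_zero fun n _ => key n _ fun j => ?_
  rcases eq_or_ne j i with rfl | hj
  · rw [Pi.single_eq_same]
    exact homogeneousComponent_isHomogeneous n _
  · rw [Pi.single_eq_of_ne hj]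
    exact isHomogeneous_zero _ _ _

end PVec

end MaxwellSource

namespace MaxwellSource

open PVec

/-! ### Vanishing of the moments -/

theorem hasDerivAt_unique_of_eqOn {R : ℝ} {f g : ℝ → ℂ} {a b : ℂ} {r : ℝ} (hr : R < r)
    (h : ∀ s > R, f s = g s) (hf : HasDerivAt f a r) (hg : HasDerivAt g b r) : a = b := by
  refine hf.unique (hg.congr_of_eventuallyEq ?_)
  filter_upwards [Ioi_mem_nhds hr] with s hs using h s hs

/-- Reduction of the moment equations of degree `j + 1` to a spherical Bessel equation. -/
theorem bessel_of_moments {κ R : ℝ} (hR : 0 < R) (j : ℕ) {A B : ℝ → ℂ}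
    (h1 : ∀ r > R, HasDerivAt (fun r : ℝ => (r : ℂ) ^ (j + 3) * A r) ((r : ℂ) ^ (j + 2) * B r) r)
    (h2 : ∀ r > R, HasDerivAt (fun r : ℝ => (r : ℂ) ^ (j + 3) * ((j + 1) * A r - B r))
      (-((j + 2) * (r : ℂ) ^ (j + 2) * B r) + κ ^ 2 * (r : ℂ) ^ (j + 4) * A r) r) :
    (∀ r > R, HasDerivAt (fun r : ℝ => (r : ℂ) ^ 2 * A r) ((r : ℂ) * (B r - (j + 1) * A r)) r) ∧
    (∀ r > R, HasDerivAt (fun r : ℝ => (r : ℂ) * (B r - (j + 1) * A r))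
      (-((κ : ℂ) ^ 2 - (((j + 1) * (j + 2) : ℝ) : ℂ) / (r : ℂ) ^ 2) * ((r : ℂ) ^ 2 * A r)) r) := by
  have hpow : ∀ (n : ℕ) (r : ℝ), r ≠ 0 →
      HasDerivAt (fun r : ℝ => ((r : ℂ) ^ (n + 1))⁻¹) (-((n + 1) / (r : ℂ) ^ (n + 2))) r := by
    intro n r hr
    have hr' : (r : ℂ) ≠ 0 := by exact_mod_cast hr
    have h := ((hasDerivAt_id r).ofReal_comp.pow (n + 1)).inv (pow_ne_zero _ hr')
    refine h.congr_deriv ?_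
    simp only [id, Complex.ofReal_one, mul_one, Nat.add_sub_cancel, Pi.pow_apply]
    field_simp
    push_cast
    ring
  constructor
  · intro r hr
    have hr0 : r ≠ 0 := (hR.trans hr).ne'
    have hr' : (r : ℂ) ≠ 0 := by exact_mod_cast hr0
    -- Multiplying the first equation by r^(−(j+1)) turns r^(j+3) A into r² A.
    have h := (hpow j r hr0).mul (h1 r hr)
    refine (h.congr_deriv ?_).congr_of_eventuallyEq ?_
    · field_simp
      ring
    · filter_upwards [Ioi_mem_nhds hr] with s hs
      have : (s : ℂ) ≠ 0 := by exact_mod_cast (hR.trans hs).ne'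
      simp only [Pi.mul_apply]
      field_simp
      ring
  · intro r hr
    have hr0 : r ≠ 0 := (hR.trans hr).ne'
    have hr' : (r : ℂ) ≠ 0 := by exact_mod_cast hr0
    -- With the factor −r^(−(j+2)) the terms in B cancel, and (j+1)(j+2)A is what remains besides
    -- −κ²r²A.
    have h := ((hpow (j + 1) r hr0).mul (h2 r hr)).neg
    refine (h.congr_deriv ?_).congr_of_eventuallyEq ?_
    · push_cast
      field_simp
      ring
    · filter_upwards [Ioi_mem_nhds hr] with s hs
      have : (s : ℂ) ≠ 0 := by exact_mod_cast (hR.trans hs).ne'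
      simp only [Pi.mul_apply, Pi.neg_apply]
      field_simp
      ring

/-- The spherical moments `M`, `N` of an electric field and its curl outside `B_R`: the moment
equations of Maxwell's system, the perfectly conducting boundary condition at `R` and the radiation
condition. -/
structure IsMaxwellMoments (κ R : ℝ) (M N : ℝ → PVec →ₗ[ℂ] ℂ) : Prop where
  rsq_left : ∀ r V, M r (rsq • V) = M r V
  rsq_right : ∀ r V, N r (rsq • V) = N r V
  faraday : ∀ (k : ℕ) (V : PVec), Homog V k → ∀ r > R,
    HasDerivAt (fun r : ℝ => (r : ℂ) ^ (k + 2) * M r (xcross V))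
      ((r : ℂ) ^ (k + 1) * M r (pcurl V) - (r : ℂ) ^ (k + 2) * N r V) r
  boundary : ∀ (k : ℕ) (V : PVec), Homog V k →
    Tendsto (fun r : ℝ => (r : ℂ) ^ (k + 2) * M r (xcross V)) (𝓝[>] R) (𝓝 0)
  ampere : ∀ (k : ℕ) (V : PVec), Homog V k → ∀ r > R,
    HasDerivAt (fun r : ℝ => (r : ℂ) ^ (k + 2) * N r (xcross V))
      ((r : ℂ) ^ (k + 1) * N r (pcurl V) - (κ : ℂ) ^ 2 * (r : ℂ) ^ (k + 2) * M r V) r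
  radiation : ∀ V : PVec,
    Tendsto (fun r : ℝ => (r : ℂ) * (N r (xcross V) - Complex.I * κ * M r V)) atTop (𝓝 0)

theorem tendsto_of_pow_mul {R : ℝ} (hR : 0 < R) (n : ℕ) {f : ℝ → ℂ}
    (h : Tendsto (fun r : ℝ => (r : ℂ) ^ n * f r) (𝓝[>] R) (𝓝 0)) :
    Tendsto f (𝓝[>] R) (𝓝 0) := by
  have hR' : (R : ℂ) ^ n ≠ 0 := pow_ne_zero _ (by exact_mod_cast hR.ne')
  have h1 : Tendsto (fun r : ℝ => ((r : ℂ) ^ n)⁻¹) (𝓝[>] R) (𝓝 ((R : ℂ) ^ n)⁻¹) := by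
    refine Tendsto.inv₀ ?_ hR'
    exact ((Complex.continuous_ofReal.pow n).tendsto R).mono_left nhdsWithin_le_nhds
  have h2 := h1.mul h
  rw [mul_zero] at h2
  refine h2.congr' ?_
  filter_upwards [self_mem_nhdsWithin] with r hr
  have : (r : ℂ) ≠ 0 := by exact_mod_cast (hR.trans hr).ne'
  field_simp

namespace IsMaxwellMoments

variable {κ R : ℝ} {M N : ℝ → PVec →ₗ[ℂ] ℂ}

/-- Faraday's law for the radial field p x is algebraic: x × (p x) = 0 removes the derivative, and
curl(p x) = −x × ∇p. -/
theorem left_xcross_grad (h : IsMaxwellMoments κ R M N) (hR : 0 < R) {k : ℕ} {p : Poly}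
    (hp : p.IsHomogeneous k) {r : ℝ} (hr : R < r) :
    M r (xcross (grad p)) = -(r * N r (radial p)) := by
  have h1 := h.faraday _ _ (Homog.radial hp) r hr
  simp only [xcross_radial, map_zero, mul_zero, pcurl_radial, map_neg] at h1
  have h2 := (hasDerivAt_const r (0 : ℂ)).unique h1
  have hr' : (r : ℂ) ≠ 0 := by exact_mod_cast (hR.trans hr).ne'
  have h3 : (r : ℂ) ^ (k + 2) * (M r (xcross (grad p)) + r * N r (radial p)) = 0 := by
    linear_combination h2
  linear_combination (mul_eq_zero.1 h3).resolve_left (pow_ne_zero _ hr')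

theorem right_xcross_grad (h : IsMaxwellMoments κ R M N) (hR : 0 < R) {k : ℕ} {p : Poly}
    (hp : p.IsHomogeneous k) {r : ℝ} (hr : R < r) :
    N r (xcross (grad p)) = -(κ ^ 2 * r * M r (radial p)) := by
  have h1 := h.ampere _ _ (Homog.radial hp) r hr
  simp only [xcross_radial, map_zero, mul_zero, pcurl_radial, map_neg] at h1
  have h2 := (hasDerivAt_const r (0 : ℂ)).unique h1
  have hr' : (r : ℂ) ≠ 0 := by exact_mod_cast (hR.trans hr).ne'
  have h3 : (r : ℂ) ^ (k + 2) * (N r (xcross (grad p)) + κ ^ 2 * r * M r (radial p)) = 0 := by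
    linear_combination h2
  linear_combination (mul_eq_zero.1 h3).resolve_left (pow_ne_zero _ hr')

/-- The radial moments decouple: eliminating the x × ∇p moments leaves a Bessel equation for r² M(p
x) and another for r² N(p x). The Laplacian of p enters as a source of lower degree, so p need not
be harmonic if the induction is on the degree. -/
theorem radial_eq_zero (h : IsMaxwellMoments κ R M N) (hκ : 0 < κ) (hR : 0 < R) (k : ℕ) :
    ∀ p : Poly, p.IsHomogeneous k → ∀ r > R, M r (radial p) = 0 ∧ N r (radial p) = 0 := by
  have hκ' : (κ : ℂ) ≠ 0 := by exact_mod_cast hκ.ne'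
  induction k using Nat.strong_induction_on with
  | _ k ih =>
    intro p hp
    rcases Nat.eq_zero_or_pos k with rfl | hk
    · intro r hr
      have hr' : (r : ℂ) ≠ 0 := by exact_mod_cast (hR.trans hr).ne'
      have h1 := h.left_xcross_grad hR hp hr
      have h2 := h.right_xcross_grad hR hp hr
      have h0 : xcross (grad p) = 0 := by
        rw [grad_eq_zero hp]; apply ext_three <;> simp [xcross]
      rw [h0, map_zero, eq_comm, neg_eq_zero] at h1 h2
      exact ⟨(mul_eq_zero.1 h2).resolve_left (by simp [hκ', hr']),
        (mul_eq_zero.1 h1).resolve_left hr'⟩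
    obtain ⟨j, rfl⟩ := Nat.exists_eq_succ_of_ne_zero hk.ne'
    have hlap : ∀ r > R, M r (radial (lap p)) = 0 ∧ N r (radial (lap p)) = 0 :=
      ih (j - 1) (by omega) (lap p) (lap_homog hp)
    have hg : Homog (grad p) j := Homog.grad hp
    have hx : Homog (xcross (grad p)) (j + 1) := hg.xcross
    have exx : xcross (xcross (grad p)) = (j + 1) • radial p - rsq • grad p := by
      rw [xcross_xcross, xdot_grad hp, radial_nsmul]
    have hMxx : ∀ r, M r (xcross (xcross (grad p))) = (j + 1) * M r (radial p) - M r (grad p) := by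
      intro r
      rw [exx, map_sub, map_nsmul, h.rsq_left, nsmul_eq_mul]
      push_cast; ring
    have hNxx : ∀ r, N r (xcross (xcross (grad p))) = (j + 1) * N r (radial p) - N r (grad p) := by
      intro r
      rw [exx, map_sub, map_nsmul, h.rsq_right, nsmul_eq_mul]
      push_cast; ring
    have hL : (0 : ℝ) ≤ (j + 1) * (j + 2) := by positivity
    -- Ampère's law for ∇p and Faraday's law for x × ∇p form a closed system for M(p x) and M(∇p).
    -- For N the two laws exchange roles.
    have bM := bessel_of_moments (κ := κ) hR j (A := fun r => M r (radial p))
      (B := fun r => M r (grad p)) (fun r hr => by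
        have h1 := (h.ampere _ _ hg r hr).const_mul (-(κ ^ 2 : ℂ)⁻¹)
        refine (h1.congr_deriv ?_).congr_of_eventuallyEq ?_
        · rw [pcurl_grad, map_zero]; field_simp; ring
        · filter_upwards [Ioi_mem_nhds hr] with s hs
          rw [h.right_xcross_grad hR hp hs]; field_simp; ring) (fun r hr => by
        have h1 := h.faraday _ _ hx r hr
        simp only [hMxx] at h1
        refine h1.congr_deriv ?_
        rw [pcurl_xcross_grad hp, map_sub, (hlap r hr).1, map_nsmul, nsmul_eq_mul,
          h.right_xcross_grad hR hp hr]
        push_cast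
        ring)
    have bN := bessel_of_moments (κ := κ) hR j (A := fun r => N r (radial p))
      (B := fun r => N r (grad p)) (fun r hr => by
        have h1 := (h.faraday _ _ hg r hr).neg
        refine (h1.congr_deriv ?_).congr_of_eventuallyEq ?_
        · rw [pcurl_grad, map_zero]; ring
        · filter_upwards [Ioi_mem_nhds hr] with s hs
          simp only [Pi.neg_apply]
          rw [h.left_xcross_grad hR hp hs]; ring) (fun r hr => by
        have h1 := h.ampere _ _ hx r hr
        simp only [hNxx] at h1
        refine h1.congr_deriv ?_
        rw [pcurl_xcross_grad hp, map_sub, (hlap r hr).2, map_nsmul, nsmul_eq_mul,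
          h.left_xcross_grad hR hp hr]
        push_cast
        ring)
    have hpos : ∀ᶠ r : ℝ in atTop, R < r := eventually_gt_atTop R
    -- The conductor condition for x × ∇p controls M(∇p) − (j+1)M(p x), that is, the derivative of
    -- r² M(p x): a Neumann condition.
    have zM := eq_zero_of_bessel_of_radiating hκ hR hL bM.1 bM.2 (Or.inr (by
        have h1 := h.boundary _ _ hx
        simp only [hMxx] at h1
        have h2 : Tendsto (fun r : ℝ => (r : ℂ) ^ (j + 2) *
            ((r : ℂ) * (M r (grad p) - (j + 1) * M r (radial p)))) (𝓝[>] R) (𝓝 0) := by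
          have h3 := h1.neg
          rw [neg_zero] at h3
          refine h3.congr fun r => ?_
          ring
        exact tendsto_of_pow_mul hR _ h2)) (by
        -- The condition for ∇p supplies r M(∇p) − iκ r² M(p x). The one for p x says r M(p x) → 0
        -- and supplies the missing −(j+1) r M(p x).
        have h1 := (h.radiation (grad p)).const_mul (Complex.I / κ)
        have h2 := (h.radiation (radial p)).const_mul ((j + 1) / (Complex.I * κ))
        have h3 := h1.add h2
        rw [mul_zero, mul_zero, add_zero] at h3
        refine h3.congr' ?_
        filter_upwards [hpos] with r hr
        rw [h.right_xcross_grad hR hp hr, xcross_radial, map_zero]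
        have hI : Complex.I ^ 3 = -Complex.I := Complex.I_pow_three
        field_simp
        ring_nf
        rw [hI]
        ring)
    -- Here the conductor condition for ∇p says that M(x × ∇p) = −r N(p x) tends to 0: a Dirichlet
    -- condition.
    have zN := eq_zero_of_bessel_of_radiating hκ hR hL bN.1 bN.2 (Or.inl (by
        have h1 := h.boundary _ _ hg
        have h2 : Tendsto (fun r : ℝ => (r : ℂ) ^ (j + 1) *
            ((r : ℂ) ^ 2 * N r (radial p))) (𝓝[>] R) (𝓝 0) := by
          have h3 := h1.neg
          rw [neg_zero] at h3
          refine h3.congr' ?_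
          filter_upwards [self_mem_nhdsWithin] with r hr
          rw [h.left_xcross_grad hR hp hr]
          ring
        exact tendsto_of_pow_mul hR _ h2)) (by
        have h1 := (h.radiation (xcross (grad p))).neg
        rw [neg_zero] at h1
        refine h1.congr' ?_
        filter_upwards [hpos] with r hr
        rw [hNxx, h.left_xcross_grad hR hp hr]
        ring)
    intro r hr
    have hr' : (r : ℂ) ^ 2 ≠ 0 := pow_ne_zero _ (by exact_mod_cast (hR.trans hr).ne')
    exact ⟨(mul_eq_zero.1 (zM r hr)).resolve_left hr', (mul_eq_zero.1 (zN r hr)).resolve_left hr'⟩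

/-- The three spanning types are killed in turn: p x by `radial_eq_zero`, ∇p because Ampère's law
then has only the term κ²M(∇p), and x × ∇p because its moment is −r N(p x). -/
theorem left_eq_zero (h : IsMaxwellMoments κ R M N) (hκ : 0 < κ) (hR : 0 < R) {r : ℝ}
    (hr : R < r) : M r = 0 := by
  have hκ' : (κ : ℂ) ≠ 0 := by exact_mod_cast hκ.ne'
  refine linearMap_eq_zero (M r) (h.rsq_left r)
    (fun k p hp => (h.radial_eq_zero hκ hR k p hp r hr).1) (fun k p hp => ?_) fun k p hp => ?_
  · have h1 := h.ampere _ _ (Homog.grad hp) r hr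
    have h2 : ∀ s > R, (s : ℂ) ^ (k - 1 + 2) * N s (xcross (grad p)) = 0 := fun s hs => by
      rw [h.right_xcross_grad hR hp hs, (h.radial_eq_zero hκ hR k p hp s hs).1]; ring
    have h3 := hasDerivAt_unique_of_eqOn (g := fun _ => 0) hr h2 h1 (hasDerivAt_const r (0 : ℂ))
    rw [pcurl_grad, map_zero, mul_zero, zero_sub, neg_eq_zero] at h3
    have hr' : (r : ℂ) ≠ 0 := by exact_mod_cast (hR.trans hr).ne'
    exact (mul_eq_zero.1 h3).resolve_left (by simp [hκ', hr'])
  · rw [h.left_xcross_grad hR hp hr, (h.radial_eq_zero hκ hR k p hp r hr).2]; ring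

end IsMaxwellMoments

end MaxwellSource

namespace MaxwellSource

/-! ### Polar coordinates -/

/-- The surface measure of the unit sphere. -/
noncomputable def sphereMeasure : Measure (Metric.sphere (0 : Space) 1) :=
  (volume : Measure Space).toSphere

instance : IsFiniteMeasure sphereMeasure := by unfold sphereMeasure; infer_instance

instance : sphereMeasure.IsOpenPosMeasure := by unfold sphereMeasure; infer_instance

/-- Off the origin, a null set, polar coordinates carry Lebesgue measure to the product of the
surface measure and r² dr. -/
theorem integral_polar {f : Space → ℂ} (hf : Integrable f) :
    IntegrableOn (fun r : ℝ => (r : ℂ) ^ 2 * ∫ θ, f (r • (θ : Space)) ∂sphereMeasure) (Set.Ioi 0) ∧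
    ∫ x, f x = ∫ r in Set.Ioi (0 : ℝ), (r : ℂ) ^ 2 * ∫ θ, f (r • (θ : Space)) ∂sphereMeasure := by
  set g : Metric.sphere (0 : Space) 1 × Set.Ioi (0 : ℝ) → ℂ := fun p => f (p.2.1 • (p.1 : Space))
    with hg
  have mp := (volume : Measure Space).measurePreserving_homeomorphUnitSphereProd
  have hdim : Module.finrank ℝ Space - 1 = 2 := by simp
  rw [hdim] at mp
  have hemb := (homeomorphUnitSphereProd Space).measurableEmbedding
  have hgf : ∀ x : ({0}ᶜ : Set Space), g (homeomorphUnitSphereProd Space x) = f x := by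
    intro x
    have hx : ‖(x : Space)‖ ≠ 0 := norm_ne_zero_iff.2 fun h => x.2 h
    simp [hg, smul_smul, mul_inv_cancel₀ hx]
  have hmeas : MeasurableSet ({0}ᶜ : Set Space) := (measurableSet_singleton _).compl
  have h1 : ∫ x, f x = ∫ p, g p ∂(sphereMeasure.prod (Measure.volumeIoiPow 2)) := by
    rw [sphereMeasure, ← mp.integral_comp hemb g]
    simp only [hgf]
    rw [integral_subtype_comap hmeas f, restrict_compl_singleton]
  have hgi : Integrable g (sphereMeasure.prod (Measure.volumeIoiPow 2)) := by
    rw [sphereMeasure, ← mp.integrable_comp_emb hemb]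
    have : g ∘ homeomorphUnitSphereProd Space = f ∘ Subtype.val := funext hgf
    rw [this, ← integrableOn_iff_comap_subtypeVal hmeas, IntegrableOn, restrict_compl_singleton]
    exact hf
  have hm : Measurable fun r : Set.Ioi (0 : ℝ) => Real.toNNReal (r.1 ^ 2) :=
    (measurable_subtype_coe.pow_const _).real_toNNReal
  have hsm : ∀ (r : Set.Ioi (0 : ℝ)) (z : ℂ), Real.toNNReal (r.1 ^ 2) • z = (r.1 : ℂ) ^ 2 * z := by
    intro r z
    rw [NNReal.smul_def, Real.coe_toNNReal _ (by positivity), Complex.real_smul]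
    push_cast; rfl
  constructor
  · have h2 := hgi.integral_prod_right
    rw [Measure.volumeIoiPow] at h2
    have h3 := (integrable_withDensity_iff_integrable_smul (μ := Measure.comap Subtype.val volume)
      hm).1 h2
    simp only [hsm] at h3
    rw [integrableOn_iff_comap_subtypeVal measurableSet_Ioi]
    exact h3
  · rw [h1, integral_prod_symm _ hgi, Measure.volumeIoiPow]
    have h3 := integral_withDensity_eq_integral_smul (μ := Measure.comap Subtype.val volume) hm
      (fun r : Set.Ioi (0 : ℝ) => ∫ θ, g (θ, r) ∂sphereMeasure)
    refine h3.trans ?_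
    simp only [hsm]
    exact integral_subtype_comap measurableSet_Ioi
      fun r : ℝ => (r : ℂ) ^ 2 * ∫ θ, f (r • (θ : Space)) ∂sphereMeasure

/-! ### Evaluation of polynomial fields -/

/-- Evaluation of a polynomial at a point of space. -/
noncomputable def pEval (p : Poly) (x : Space) : ℂ := MvPolynomial.eval (fun j => (x j : ℂ)) p

/-- Evaluation of a polynomial field at a point of space. -/
noncomputable def evalV (V : PVec) (x : Space) : CVec := WithLp.toLp 2 fun i => pEval (V i) x

@[simp] theorem evalV_apply (V : PVec) (x : Space) (i : Fin 3) : evalV V x i = pEval (V i) x := rfl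

/-- The complex-valued coordinate functions. -/
noncomputable def coordL (i : Fin 3) : Space →L[ℝ] ℂ :=
  Complex.ofRealCLM.comp (EuclideanSpace.proj i)

theorem coordL_apply (i : Fin 3) (x : Space) : coordL i x = (x i : ℂ) := rfl

theorem hasFDerivAt_pEval (p : Poly) (x : Space) :
    HasFDerivAt (pEval p) (∑ i : Fin 3, pEval (MvPolynomial.pderiv i p) x • coordL i) x := by
  induction p using MvPolynomial.induction_on with
  | C a =>
    have : pEval (MvPolynomial.C a) = fun _ => a := by ext y; simp [pEval]
    rw [this]
    refine (hasFDerivAt_const a x).congr_fderiv (ContinuousLinearMap.ext fun v => ?_)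
    simp [pEval]
  | add p q hp hq =>
    have : pEval (p + q) = pEval p + pEval q := by ext y; simp [pEval]
    rw [this]
    refine (hp.add hq).congr_fderiv ?_
    rw [← Finset.sum_add_distrib]
    refine Finset.sum_congr rfl fun i _ => ?_
    rw [← add_smul]
    simp [pEval]
  | mul_X p j hp =>
    have : pEval (p * MvPolynomial.X j) = fun y => pEval p y * coordL j y := by
      ext y; simp [pEval, coordL_apply]
    rw [this]
    refine (hp.mul (coordL j).hasFDerivAt).congr_fderiv ?_
    rw [Fin.sum_univ_three, Fin.sum_univ_three]
    ext v
    fin_cases j <;> simp [pEval, coordL_apply, MvPolynomial.pderiv_X] <;> ring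

theorem contDiff_pEval (p : Poly) : ContDiff ℝ ∞ (pEval p) := by
  induction p using MvPolynomial.induction_on with
  | C a =>
    have : pEval (MvPolynomial.C a) = fun _ => a := by ext y; simp [pEval]
    rw [this]
    exact contDiff_const
  | add p q hp hq =>
    have : pEval (p + q) = pEval p + pEval q := by ext y; simp [pEval]
    rw [this]
    exact hp.add hq
  | mul_X p j hp =>
    have : pEval (p * MvPolynomial.X j) = fun y => pEval p y * coordL j y := by
      ext y; simp [pEval, coordL_apply]
    rw [this]
    exact hp.mul (coordL j).contDiff

theorem contDiff_evalV (V : PVec) : ContDiff ℝ ∞ (evalV V) := by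
  have : ContDiff ℝ ∞ fun x => (evalV V x).ofLp := contDiff_pi.2 fun i => contDiff_pEval (V i)
  exact (PiLp.continuousLinearEquiv 2 ℝ (fun _ : Fin 3 => ℂ)).symm.contDiff.comp this

theorem pEval_smul {p : Poly} {k : ℕ} (hp : p.IsHomogeneous k) (r : ℝ) (x : Space) :
    pEval p (r • x) = (r : ℂ) ^ k * pEval p x := by
  simp only [pEval, MvPolynomial.eval_eq', Finset.mul_sum]
  refine Finset.sum_congr rfl fun d hd => ?_
  have hk : ∑ i, d i = k := by
    have := hp (MvPolynomial.mem_support_iff.1 hd)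
    rw [← this, Finsupp.weight_apply, Finsupp.sum_fintype _ _ (by simp)]
    simp
  simp only [PiLp.smul_apply, smul_eq_mul, Complex.ofReal_mul, mul_pow, Finset.prod_mul_distrib,
    Finset.prod_pow_eq_pow_sum, hk]
  ring

theorem evalV_smul {V : PVec} {k : ℕ} (hV : PVec.Homog V k) (r : ℝ) (x : Space) :
    evalV V (r • x) = ((r : ℂ) ^ k) • evalV V x := by
  ext i
  simp [pEval_smul (hV i)]

theorem evalV_xcross (V : PVec) (x : Space) : evalV (PVec.xcross V) x = cross (toCVec x) (evalV V x) := by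
  apply CVec.ext_three <;>
    simp [PVec.xcross, cross_apply_zero, cross_apply_one, cross_apply_two, toCVec, pEval]

/-- Constancy of G near 0 is needed because the norm is not differentiable at the origin. The
quotient there is harmless, since it multiplies a coordinate that is 0. -/
theorem partialDeriv_radial_mul {G : ℝ → ℝ} (hG : Differentiable ℝ G) {a : ℝ} (ha : 0 < a) {c : ℝ}
    (hGa : ∀ r < a, G r = c) (V : PVec) (i j : Fin 3) (x : Space) :
    partialDeriv (fun y => G ‖y‖ • evalV V y) i j x =
      ((deriv G ‖x‖ / ‖x‖ : ℝ) : ℂ) * ((x i : ℂ) * pEval (V j) x) +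
        (G ‖x‖ : ℂ) * pEval (MvPolynomial.pderiv i (V j)) x := by
  have hN : HasFDerivAt (fun y : Space => G ‖y‖) ((deriv G ‖x‖ / ‖x‖) • innerSL ℝ x) x := by
    rcases eq_or_ne x 0 with rfl | hx
    · have : (fun y : Space => G ‖y‖) =ᶠ[𝓝 0] fun _ => c := by
        filter_upwards [Metric.ball_mem_nhds (0 : Space) ha] with y hy
        exact hGa _ (by simpa using hy)
      simpa using (hasFDerivAt_const c (0 : Space)).congr_of_eventuallyEq this
    · have h1 := (hasStrictFDerivAt_norm_sq x).hasFDerivAt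
      have hx0 : ‖x‖ ^ 2 ≠ 0 := by simpa using hx
      have h2 := h1.sqrt hx0
      have h3 : (fun y : Space => √(‖y‖ ^ 2)) = fun y => ‖y‖ := by
        ext y; exact Real.sqrt_sq (norm_nonneg _)
      simp only [h3] at h2
      have h4 := (hG ‖x‖).hasDerivAt.comp_hasFDerivAt x h2
      refine h4.congr_fderiv ?_
      rw [Real.sqrt_sq (norm_nonneg _)]
      have hx1 : ‖x‖ ≠ 0 := by simpa using hx
      ext v
      simp
      field_simp
  have hV := ((contDiff_evalV V).differentiable (by simp) x)
  have hd : DifferentiableAt ℝ (fun y => G ‖y‖ • evalV V y) x := hN.differentiableAt.smul hV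
  rw [partialDeriv_eq hd]
  have h5 : (fun y => (G ‖y‖ • evalV V y) j) = fun y => G ‖y‖ • pEval (V j) y := by
    ext y; simp
  have h7 : HasFDerivAt (fun y => G ‖y‖ • pEval (V j) y) _ x :=
    hN.smul (hasFDerivAt_pEval (V j) x)
  rw [h5, h7.fderiv]
  have h6 : inner ℝ x (EuclideanSpace.single i (1 : ℝ)) = x i := by
    simp [EuclideanSpace.inner_single_right]
  simp [h6, coordL_apply, Fin.sum_univ_three]
  fin_cases i <;> simp <;> ring

/-- The product rule with ∇G(|x|) = (G'(|x|) / |x|) x. These test fields turn Maxwell's equations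
into equations in r alone. -/
theorem curl_radial_mul {G : ℝ → ℝ} (hG : Differentiable ℝ G) {a : ℝ} (ha : 0 < a) {c : ℝ}
    (hGa : ∀ r < a, G r = c) (V : PVec) (x : Space) :
    curl (fun y => G ‖y‖ • evalV V y) x =
      (deriv G ‖x‖ / ‖x‖) • evalV (PVec.xcross V) x + G ‖x‖ • evalV (PVec.pcurl V) x := by
  apply CVec.ext_three <;>
    simp only [curl_apply_zero, curl_apply_one, curl_apply_two,
      partialDeriv_radial_mul hG ha hGa, PiLp.add_apply, PiLp.smul_apply, evalV_apply,
      Complex.real_smul] <;>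
    simp [PVec.xcross, PVec.pcurl, pEval] <;> ring

theorem contDiff_radial_mul {G : ℝ → ℝ} (hG : ContDiff ℝ ∞ G) {a : ℝ} (ha : 0 < a) {c : ℝ}
    (hGa : ∀ r < a, G r = c) (V : PVec) : ContDiff ℝ ∞ fun y : Space => G ‖y‖ • evalV V y := by
  suffices h : ContDiff ℝ ∞ fun y : Space => G ‖y‖ from h.smul (contDiff_evalV V)
  rw [contDiff_iff_contDiffAt]
  intro x
  rcases eq_or_ne x 0 with rfl | hx
  · have : (fun y : Space => G ‖y‖) =ᶠ[𝓝 0] fun _ => c := by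
      filter_upwards [Metric.ball_mem_nhds (0 : Space) ha] with y hy
      exact hGa _ (by simpa using hy)
    exact contDiffAt_const.congr_of_eventuallyEq this
  · exact hG.contDiffAt.comp x (contDiffAt_norm ℝ hx)

theorem hasCompactSupport_radial_mul {G : ℝ → ℝ} {b : ℝ} (hGb : ∀ r, b ≤ r → G r = 0) (V : PVec) :
    HasCompactSupport fun y : Space => G ‖y‖ • evalV V y := by
  refine HasCompactSupport.intro (isCompact_closedBall (0 : Space) b) fun x hx => ?_
  have : b ≤ ‖x‖ := by
    simp at hx; exact hx.le
  simp [hGb _ this]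

end MaxwellSource

namespace MaxwellSource

open PVec

/-! ### Moments of fields outside a ball -/

/-- The exterior of the closed ball of radius `R`. -/
def exterior (R : ℝ) : Set Space := {x | R < ‖x‖}

theorem isOpen_exterior (R : ℝ) : IsOpen (exterior R) := isOpen_lt continuous_const continuous_norm

/-- A field cut off to the exterior of a ball. -/
noncomputable def cut (R : ℝ) (u : Space → CVec) : Space → CVec := (exterior R).indicator u

theorem cut_of_mem {R : ℝ} {u : Space → CVec} {x : Space} (hx : R < ‖x‖) : cut R u x = u x :=
  Set.indicator_of_mem (s := exterior R) hx u

theorem cut_of_notMem {R : ℝ} {u : Space → CVec} {x : Space} (hx : ¬ R < ‖x‖) : cut R u x = 0 :=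
  Set.indicator_of_notMem (s := exterior R) hx u

theorem norm_smul_sphere (r : ℝ) (θ : Metric.sphere (0 : Space) 1) : ‖r • (θ : Space)‖ = |r| := by
  rw [norm_smul, mem_sphere_zero_iff_norm.1 θ.2, mul_one, Real.norm_eq_abs]

theorem continuous_cut_smul {R : ℝ} {u : Space → CVec} (hu : ContinuousOn u (exterior R)) (r : ℝ) :
    Continuous fun θ : Metric.sphere (0 : Space) 1 => cut R u (r • (θ : Space)) := by
  by_cases hr : R < |r|
  · have h1 : ∀ θ : Metric.sphere (0 : Space) 1, R < ‖r • (θ : Space)‖ := fun θ => by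
      rwa [norm_smul_sphere]
    have h2 : (fun θ : Metric.sphere (0 : Space) 1 => cut R u (r • (θ : Space))) =
        fun θ : Metric.sphere (0 : Space) 1 => u (r • (θ : Space)) := funext fun θ => cut_of_mem (h1 θ)
    rw [h2]
    exact hu.comp_continuous (by fun_prop) h1
  · have h2 : (fun θ : Metric.sphere (0 : Space) 1 => cut R u (r • (θ : Space))) = fun θ => 0 :=
      funext fun θ => cut_of_notMem (by rwa [norm_smul_sphere])
    rw [h2]
    exact continuous_const

theorem integrable_sphere {f : Metric.sphere (0 : Space) 1 → ℂ} (hf : Continuous f) :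
    Integrable f sphereMeasure :=
  hf.integrable_of_hasCompactSupport (HasCompactSupport.of_compactSpace f)

theorem continuous_evalV (V : PVec) : Continuous (evalV V) := (contDiff_evalV V).continuous

theorem continuous_cdot_cut {R : ℝ} {u : Space → CVec} (hu : ContinuousOn u (exterior R)) (r : ℝ)
    (V : PVec) : Continuous fun θ : Metric.sphere (0 : Space) 1 =>
      cdot (cut R u (r • (θ : Space))) (evalV V θ) :=
  continuous_cdot.comp ((continuous_cut_smul hu r).prodMk
    ((continuous_evalV V).comp continuous_subtype_val))

/-- The moments of a field on the sphere of radius `r`, as a functional of polynomial fields. -/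
noncomputable def moment (R : ℝ) (u : Space → CVec) (hu : ContinuousOn u (exterior R)) (r : ℝ) :
    PVec →ₗ[ℂ] ℂ where
  toFun V := ∫ θ, cdot (cut R u (r • (θ : Space))) (evalV V θ) ∂sphereMeasure
  map_add' V W := by
    rw [← integral_add (integrable_sphere (continuous_cdot_cut hu r V))
      (integrable_sphere (continuous_cdot_cut hu r W))]
    congr 1
    ext θ
    rw [← cdot_add_right]
    congr 1
    ext i
    simp [pEval]
  map_smul' c V := by
    simp only [RingHom.id_apply, smul_eq_mul]
    rw [← integral_const_mul]
    congr 1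
    ext θ
    rw [← cdot_smul_right]
    congr 1
    ext i
    simp [pEval, MvPolynomial.smul_eval]

theorem moment_apply {R : ℝ} {u : Space → CVec} (hu : ContinuousOn u (exterior R)) (r : ℝ) (V : PVec) :
    moment R u hu r V = ∫ θ, cdot (cut R u (r • (θ : Space))) (evalV V θ) ∂sphereMeasure := rfl

theorem moment_of_le {R : ℝ} {u : Space → CVec} (hu : ContinuousOn u (exterior R)) {r : ℝ}
    (hr : |r| ≤ R) (V : PVec) : moment R u hu r V = 0 := by
  rw [moment_apply]
  refine (integral_congr_ae (g := fun _ => 0) (Eventually.of_forall fun θ => ?_)).trans (by simp)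
  simp only
  rw [cut_of_notMem (by rw [norm_smul_sphere]; exact not_lt.2 hr), cdot_zero_left]

/-- Moments see V only on the unit sphere, where |θ|² = 1. This lets fields of different degrees be
compared. -/
theorem moment_rsq {R : ℝ} {u : Space → CVec} (hu : ContinuousOn u (exterior R)) (r : ℝ) (V : PVec) :
    moment R u hu r (rsq • V) = moment R u hu r V := by
  rw [moment_apply, moment_apply]
  congr 1
  ext θ
  congr 1
  ext i
  have h : (∑ i : Fin 3, ((θ : Space) i) ^ 2) = 1 := by
    have := mem_sphere_zero_iff_norm.1 θ.2
    rw [EuclideanSpace.norm_eq, Real.sqrt_eq_one] at this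
    simpa using this
  rw [Fin.sum_univ_three] at h
  have h' : ((θ : Space) 0 : ℂ) * (θ : Space) 0 + (θ : Space) 1 * (θ : Space) 1 +
      (θ : Space) 2 * (θ : Space) 2 = 1 := by
    have := congrArg (fun t : ℝ => (t : ℂ)) h
    simp only [Complex.ofReal_add, Complex.ofReal_pow, Complex.ofReal_one] at this
    rw [← this]; ring
  simp [pEval, rsq, h']

theorem continuousOn_cdot {X : Type*} [TopologicalSpace X] {s : Set X} {f g : X → CVec}
    (hf : ContinuousOn f s) (hg : ContinuousOn g s) :
    ContinuousOn (fun x => cdot (f x) (g x)) s := by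
  simp only [cdot_apply]
  fun_prop

theorem continuousOn_moment {R : ℝ} (hR : 0 < R) {u : Space → CVec}
    (hu : ContinuousOn u (exterior R)) (V : PVec) :
    ContinuousOn (fun r => moment R u hu r V) (Set.Ioi R) := by
  have hc : ContinuousOn (cut R u) (exterior R) := hu.congr fun x hx => cut_of_mem hx
  have h1 : ContinuousOn (fun p : ℝ × Metric.sphere (0 : Space) 1 => cut R u (p.1 • (p.2 : Space)))
      (Set.Ioi R ×ˢ Set.univ) := by
    refine hc.comp (f := fun p : ℝ × Metric.sphere (0 : Space) 1 => p.1 • (p.2 : Space))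
      (Continuous.continuousOn (by fun_prop)) ?_
    rintro ⟨r, θ⟩ ⟨hr, -⟩
    change R < ‖r • (θ : Space)‖
    rw [norm_smul_sphere, abs_of_pos (hR.trans hr)]
    exact hr
  have h2 : ContinuousOn (fun p : ℝ × Metric.sphere (0 : Space) 1 => evalV V p.2)
      (Set.Ioi R ×ˢ Set.univ) :=
    ((continuous_evalV V).comp (continuous_subtype_val.comp continuous_snd)).continuousOn
  have h3 : ContinuousOn (fun p : ℝ × Metric.sphere (0 : Space) 1 =>
      cdot (cut R u (p.1 • (p.2 : Space))) (evalV V p.2)) (Set.Ioi R ×ˢ Set.univ) :=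
    continuousOn_cdot h1 h2
  simp only [moment_apply]
  exact continuousOn_integral_of_compact_support (k := Set.univ)
    (f := fun r (θ : Metric.sphere (0 : Space) 1) => cdot (cut R u (r • (θ : Space))) (evalV V θ))
    isCompact_univ h3 (fun p x _ hx => absurd (Set.mem_univ x) hx)

/-- Integration of a field against a radial multiple of a homogeneous polynomial field. -/
theorem integral_radial {R : ℝ} (hR : 0 < R) {u : Space → CVec} (hu : ContinuousOn u (exterior R))
    (hL : ∀ r, MemLp (cut R u) 2 (ballMeasure r)) {V : PVec} {k : ℕ} (hV : Homog V k) {c : ℝ → ℝ}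
    (hc : Continuous c) {b : ℝ} (hb : ∀ r, b ≤ r → c r = 0) :
    Integrable (fun x => cdot (cut R u x) (c ‖x‖ • evalV V x)) ∧
    IntegrableOn (fun r : ℝ => (r : ℂ) ^ (k + 2) * moment R u hu r V * c r) (Set.Ioi R) ∧
    ∫ x, cdot (cut R u x) (c ‖x‖ • evalV V x) =
      ∫ r in Set.Ioi R, (r : ℂ) ^ (k + 2) * moment R u hu r V * c r := by
  have hi : Integrable (fun x => cdot (cut R u x) (c ‖x‖ • evalV V x)) :=
    integrable_cdot_of_local hL ((hc.comp continuous_norm).smul (continuous_evalV V))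
      (hasCompactSupport_radial_mul hb V)
  obtain ⟨h1, h2⟩ := integral_polar hi
  have he : ∀ r ∈ Set.Ioi (0 : ℝ), (r : ℂ) ^ 2 * ∫ θ, cdot (cut R u (r • (θ : Space)))
      (c ‖r • (θ : Space)‖ • evalV V (r • (θ : Space))) ∂sphereMeasure =
      (r : ℂ) ^ (k + 2) * moment R u hu r V * c r := by
    intro r hr
    have h3 : ∀ θ : Metric.sphere (0 : Space) 1, cdot (cut R u (r • (θ : Space)))
        (c ‖r • (θ : Space)‖ • evalV V (r • (θ : Space))) =
        (c r * (r : ℂ) ^ k) * cdot (cut R u (r • (θ : Space))) (evalV V θ) := fun θ => by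
      rw [norm_smul_sphere, abs_of_pos hr, evalV_smul hV, cdot_real_smul_right, cdot_smul_right]
      ring
    simp only [h3]
    rw [integral_const_mul, ← moment_apply hu]
    ring
  have h4 := h1.congr_fun he measurableSet_Ioi
  refine ⟨hi, h4.mono_set (Set.Ioi_subset_Ioi hR.le), ?_⟩
  rw [h2, setIntegral_congr_fun measurableSet_Ioi he]
  refine (setIntegral_eq_of_subset_of_forall_sdiff_eq_zero measurableSet_Ioi
    (Set.Ioi_subset_Ioi hR.le) fun r hr => ?_)
  rw [moment_of_le hu]
  · ring
  · rw [abs_of_pos hr.1]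
    exact not_lt.1 hr.2

theorem integrableOn_moment {R : ℝ} (hR : 0 < R) {u : Space → CVec} (hu : ContinuousOn u (exterior R))
    (hL : ∀ r, MemLp (cut R u) 2 (ballMeasure r)) {V : PVec} {k : ℕ} (hV : Homog V k) (b : ℝ) :
    IntegrableOn (fun r : ℝ => (r : ℂ) ^ (k + 2) * moment R u hu r V) (Set.Ioc R b) := by
  -- A continuous cutoff that equals 1 up to b and 0 from b + 1 on.
  have h := (integral_radial hR hu hL hV (c := fun r => max 0 (min 1 (b + 1 - r))) (by fun_prop)
    (b := b + 1) fun r hr => by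
      rw [max_eq_left]
      exact (min_le_right _ _).trans (by linarith)).2.1
  refine (h.mono_set (s := Set.Ioc R b) Set.Ioc_subset_Ioi_self).congr_fun (fun r hr => ?_)
    measurableSet_Ioc
  have : max 0 (min 1 (b + 1 - r)) = 1 := by
    rw [min_eq_left (by linarith [hr.2]), max_eq_right zero_le_one]
  simp [this]

/-- The form of `integral_radial` for the curl of a polynomial field, whose degree drops. -/
theorem integral_radial_pcurl {R : ℝ} (hR : 0 < R) {u : Space → CVec}
    (hu : ContinuousOn u (exterior R)) (hL : ∀ r, MemLp (cut R u) 2 (ballMeasure r)) {V : PVec} {k : ℕ}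
    (hV : Homog V k) {c : ℝ → ℝ} (hc : Continuous c) {b : ℝ} (hb : ∀ r, b ≤ r → c r = 0) :
    IntegrableOn (fun r : ℝ => (r : ℂ) ^ (k + 1) * moment R u hu r (pcurl V) * c r) (Set.Ioi R) ∧
    (∀ b, IntegrableOn (fun r : ℝ => (r : ℂ) ^ (k + 1) * moment R u hu r (pcurl V))
      (Set.Ioc R b)) ∧
    ∫ x, cdot (cut R u x) (c ‖x‖ • evalV (pcurl V) x) =
      ∫ r in Set.Ioi R, (r : ℂ) ^ (k + 1) * moment R u hu r (pcurl V) * c r := by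
  rcases k with _ | j
  -- For k = 0 the truncated degree k − 1 would give the wrong power of r, but the curl of a
  -- constant field is zero.
  · have h0 : pcurl V = 0 := by
      apply ext_three <;> simp [pcurl, pderiv_eq_zero (hV _)]
    have h1 : ∀ x, evalV (0 : PVec) x = 0 := fun x => by ext i; simp [pEval]
    simp [h0, h1, cdot_zero_right]
  · have := integral_radial hR hu hL hV.pcurl hc hb
    exact ⟨this.2.1, fun b => integrableOn_moment hR hu hL hV.pcurl b, this.2.2⟩

/-- The moment form of `∇ × u = v`. -/
theorem integral_moments {R : ℝ} (hR : 0 < R) {u v : Space → CVec} (hu : ContinuousOn u (exterior R))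
    (huL : ∀ r, MemLp (cut R u) 2 (ballMeasure r)) (hv : ContinuousOn v (exterior R))
    (hvL : ∀ r, MemLp (cut R v) 2 (ballMeasure r)) {V : PVec} {k : ℕ} (hV : Homog V k) (z : ℂ)
    {G : ℝ → ℝ} (hG : ContDiff ℝ ∞ G) {a : ℝ} (ha : R < a) {c : ℝ} (hGa : ∀ r < a, G r = c) {b : ℝ}
    (hGb : ∀ r, b ≤ r → G r = 0)
    (h : ∫ x, cdot (cut R u x) (curl (fun y => G ‖y‖ • evalV V y) x) =
      z * ∫ x, cdot (cut R v x) (G ‖x‖ • evalV V x)) :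
    ∫ r in Set.Ioi R, ((r : ℂ) ^ (k + 2) * moment R u hu r (xcross V) * ((deriv G r : ℝ) : ℂ) +
      ((r : ℂ) ^ (k + 1) * moment R u hu r (pcurl V) -
        z * (r : ℂ) ^ (k + 2) * moment R v hv r V) * (G r : ℂ)) = 0 := by
  have ha0 : 0 < a := hR.trans ha
  have hd0 : ∀ r < a, deriv G r = 0 := fun r hr => by
    have : G =ᶠ[𝓝 r] fun _ => c := by
      filter_upwards [Iio_mem_nhds hr] with s hs using hGa s hs
    rw [this.deriv_eq, deriv_const]
  have hdb : ∀ r, b + 1 ≤ r → deriv G r = 0 := fun r hr => by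
    have : G =ᶠ[𝓝 r] fun _ => 0 := by
      filter_upwards [Ioi_mem_nhds (show b < r by linarith)] with s hs using hGb s (le_of_lt hs)
    rw [this.deriv_eq, deriv_const]
  have hdc : Continuous fun r => deriv G r / r := by
    rw [continuous_iff_continuousAt]
    intro r
    rcases lt_or_ge r a with hr | hr
    · have : (fun r => deriv G r / r) =ᶠ[𝓝 r] fun _ => 0 := by
        filter_upwards [Iio_mem_nhds hr] with s hs
        rw [hd0 s hs, zero_div]
      exact continuousAt_const.congr this.symm
    · exact (hG.continuous_deriv (by simp)).continuousAt.div continuousAt_id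
        (ha0.trans_le hr).ne'
  -- The field x × V has degree k + 1; the weight G'(r) / r brings the power r^(k+3) back to
  -- r^(k+2).
  have e1 := integral_radial hR hu huL hV.xcross hdc (b := b + 1) fun r hr => by
    rw [hdb r hr, zero_div]
  have e2 := integral_radial_pcurl hR hu huL hV hG.continuous hGb
  have e3 := integral_radial hR hv hvL hV hG.continuous hGb
  have i2 : Integrable fun x => cdot (cut R u x) (G ‖x‖ • evalV (pcurl V) x) :=
    integrable_cdot_of_local huL ((hG.continuous.comp continuous_norm).smul (continuous_evalV _))
      (hasCompactSupport_radial_mul hGb _)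
  have i5 : IntegrableOn (fun r : ℝ =>
      (r : ℂ) ^ (k + 1 + 2) * moment R u hu r (xcross V) * ((deriv G r / r : ℝ) : ℂ) +
        (r : ℂ) ^ (k + 1) * moment R u hu r (pcurl V) * (G r : ℂ)) (Set.Ioi R) := e1.2.1.add e2.1
  simp only [curl_radial_mul (hG.differentiable (by simp)) ha0 hGa, cdot_add_right] at h
  rw [integral_add e1.1 i2, e1.2.2, e2.2.2, e3.2.2, ← integral_const_mul, ← sub_eq_zero,
    ← integral_add e1.2.1 e2.1, ← integral_sub i5 (e3.2.1.const_mul z)] at h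
  rw [← h]
  refine setIntegral_congr_fun measurableSet_Ioi fun r hr => ?_
  have hr0 : (r : ℂ) ≠ 0 := by exact_mod_cast (hR.trans hr).ne'
  simp only [Complex.ofReal_div]
  field_simp
  ring

/-- The moments of a Maxwell field outside `B_R` with vanishing tangential trace that satisfies the
Silver–Müller radiation condition. -/
theorem isMaxwellMoments {κ R : ℝ} (hR : 0 < R) {F H : Space → CVec}
    (hF : ContinuousOn F (exterior R)) (hH : ContinuousOn H (exterior R))
    (hFL : ∀ r, MemLp (cut R F) 2 (ballMeasure r)) (hHL : ∀ r, MemLp (cut R H) 2 (ballMeasure r))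
    (h1 : ∀ φ : Space → CVec, ContDiff ℝ ∞ φ → HasCompactSupport φ →
      ∫ x, cdot (cut R F x) (curl φ x) = ∫ x, cdot (cut R H x) (φ x))
    (h2 : ∀ φ : Space → CVec, ContDiff ℝ ∞ φ → HasCompactSupport φ → tsupport φ ⊆ exterior R →
      ∫ x, cdot (cut R H x) (curl φ x) = (κ : ℂ) ^ 2 * ∫ x, cdot (cut R F x) (φ x))
    (hrad : Tendsto (fun x => cross (H x) (toCVec x) - (Complex.I * κ * ‖x‖) • F x)
      (cocompact Space) (𝓝 0)) :
    IsMaxwellMoments κ R (moment R F hF) (moment R H hH) := by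
  have cpow : ∀ n : ℕ, ContinuousOn (fun r : ℝ => (r : ℂ) ^ n) (Set.Ioi R) := fun n =>
    (Complex.continuous_ofReal.pow n).continuousOn
  -- Faraday's law may be tested across the sphere of radius R, so G need not vanish there: one
  -- application gives both the equation and the boundary condition.
  have hw := fun (k : ℕ) (V : PVec) (hV : Homog V k) =>
    hasDerivAt_and_tendsto_of_weak (R := R)
      (m := fun r : ℝ => (r : ℂ) ^ (k + 2) * moment R F hF r (xcross V))
      (n := fun r : ℝ => (r : ℂ) ^ (k + 1) * moment R F hF r (pcurl V) -
        1 * (r : ℂ) ^ (k + 2) * moment R H hH r V)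
      ((cpow _).mul (continuousOn_moment hR hF _))
      (((cpow _).mul (continuousOn_moment hR hF _)).sub
        ((continuousOn_const.mul (cpow _)).mul (continuousOn_moment hR hH _)))
      (fun b => by
        have h := integrableOn_moment hR hF hFL hV.xcross b
        have h' := h.mul_continuousOn_of_subset (g' := fun r : ℝ => ((r : ℂ))⁻¹)
          (K := Set.Icc R b) (ContinuousOn.inv₀ Complex.continuous_ofReal.continuousOn fun r hr => by
            exact_mod_cast (hR.trans_le hr.1).ne') measurableSet_Ioc isCompact_Icc
          Set.Ioc_subset_Icc_self
        refine h'.congr_fun (fun r hr => ?_) measurableSet_Ioc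
        have hr0 : (r : ℂ) ≠ 0 := by exact_mod_cast (hR.trans hr.1).ne'
        field_simp
        ring)
      (fun b => by
        have h := (integral_radial_pcurl hR hF hFL hV (c := fun _ => 0) continuous_const
          (b := 0) fun _ _ => rfl).2.1 b
        have h' := (integrableOn_moment hR hH hHL hV b).const_mul 1
        refine (h.sub h').congr_fun (fun r _ => ?_) measurableSet_Ioc
        simp only [Pi.sub_apply]
        ring)
      (by
        rintro G hG ⟨a, ha, c, hGa⟩ ⟨b, hGb⟩
        refine integral_moments hR hF hFL hH hHL hV 1 hG ha hGa hGb ?_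
        rw [h1 _ (contDiff_radial_mul hG (hR.trans ha) hGa V) (hasCompactSupport_radial_mul hGb V),
          one_mul])
  refine ⟨moment_rsq hF, moment_rsq hH, fun k V hV r hr => ?_, fun k V hV => (hw k V hV).2,
    fun k V hV => ?_, fun V => ?_⟩
  · simpa using (hw k V hV).1 r hr
  -- Ampère's law is available only for test fields supported outside the closed ball, so it yields
  -- no condition at R.
  · refine hasDerivAt_of_weak (R := R)
      (m := fun r : ℝ => (r : ℂ) ^ (k + 2) * moment R H hH r (xcross V))
      (n := fun r : ℝ => (r : ℂ) ^ (k + 1) * moment R H hH r (pcurl V) -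
        (κ : ℂ) ^ 2 * (r : ℂ) ^ (k + 2) * moment R F hF r V)
      ((cpow _).mul (continuousOn_moment hR hH _))
      (((cpow _).mul (continuousOn_moment hR hH _)).sub
        ((continuousOn_const.mul (cpow _)).mul (continuousOn_moment hR hF _)))
      (fun b => by
        have h := integrableOn_moment hR hH hHL hV.xcross b
        have h' := h.mul_continuousOn_of_subset (g' := fun r : ℝ => ((r : ℂ))⁻¹)
          (K := Set.Icc R b) (ContinuousOn.inv₀ Complex.continuous_ofReal.continuousOn fun r hr => by
            exact_mod_cast (hR.trans_le hr.1).ne') measurableSet_Ioc isCompact_Icc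
          Set.Ioc_subset_Icc_self
        refine h'.congr_fun (fun r hr => ?_) measurableSet_Ioc
        have hr0 : (r : ℂ) ≠ 0 := by exact_mod_cast (hR.trans hr.1).ne'
        field_simp
        ring)
      (fun b => by
        have h := (integral_radial_pcurl hR hH hHL hV (c := fun _ => 0) continuous_const
          (b := 0) fun _ _ => rfl).2.1 b
        have h' := (integrableOn_moment hR hF hFL hV b).const_mul ((κ : ℂ) ^ 2)
        refine (h.sub h').congr_fun (fun r _ => ?_) measurableSet_Ioc
        simp only [Pi.sub_apply]
        ring)
      (by
        rintro G hG ⟨a, ha, hGa⟩ ⟨b, hGb⟩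
        refine integral_moments hR hH hHL hF hFL hV _ hG ha hGa hGb ?_
        refine h2 _ (contDiff_radial_mul hG (hR.trans ha) hGa V) (hasCompactSupport_radial_mul hGb V)
          ?_
        refine (closure_minimal (t := {x : Space | a ≤ ‖x‖}) ?_
          (isClosed_le continuous_const continuous_norm)).trans fun x hx => ha.trans_le hx
        intro x hx
        by_contra hlt
        apply hx
        simp [hGa _ (not_le.1 hlt)])
  · obtain ⟨C, hC⟩ : ∃ C, ∀ θ : Metric.sphere (0 : Space) 1, ‖evalV V θ‖ ≤ C := by
      obtain ⟨C, hC⟩ := isCompact_univ.exists_bound_of_continuousOn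
        ((continuous_evalV V).comp (continuous_subtype_val (p := (· ∈ Metric.sphere (0 : Space) 1)))
          ).continuousOn
      exact ⟨C, fun θ => hC θ trivial⟩
    set A : ℝ := sphereMeasure.real Set.univ with hA
    have hC' : 0 < |C| * A + 1 := by positivity
    rw [Metric.tendsto_atTop]
    intro ε hε
    have hδ : 0 < ε / (|C| * A + 1) := by positivity
    have h3 := (tendsto_zero_iff_norm_tendsto_zero.1 hrad).eventually (gt_mem_nhds hδ)
    rw [← Metric.cobounded_eq_cocompact, (Metric.hasBasis_cobounded_compl_closedBall
      (0 : Space)).eventually_iff] at h3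
    obtain ⟨b, -, hb⟩ := h3
    refine ⟨max (R + 1) (b + 1), fun r hr => ?_⟩
    have hrR : R < r := by linarith [le_max_left (R + 1) (b + 1)]
    have hrb : b < r := by linarith [le_max_right (R + 1) (b + 1)]
    have hr0 : 0 < r := hR.trans hrR
    -- The triple product (H × x)·V = H·(x × V) at x = rθ brings the radiation defect under one
    -- integral.
    have hint : (r : ℂ) * (moment R H hH r (xcross V) - Complex.I * κ * moment R F hF r V) =
        ∫ θ : Metric.sphere (0 : Space) 1, cdot (cross (H (r • (θ : Space)))
          (toCVec (r • (θ : Space))) - (Complex.I * κ * ‖r • (θ : Space)‖) • F (r • (θ : Space)))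
          (evalV V θ) ∂sphereMeasure := by
      rw [moment_apply, moment_apply, ← integral_const_mul, ← integral_sub
        (integrable_sphere (continuous_cdot_cut hH r _))
        ((integrable_sphere (continuous_cdot_cut hF r _)).const_mul _), ← integral_const_mul]
      congr 1
      ext θ
      have hθ : R < ‖r • (θ : Space)‖ := by rwa [norm_smul_sphere, abs_of_pos hr0]
      rw [cut_of_mem hθ, cut_of_mem hθ, norm_smul_sphere, abs_of_pos hr0, cdot_sub_left,
        cdot_smul_left, evalV_xcross]
      simp only [cdot_apply, cross_apply_zero, cross_apply_one, cross_apply_two, toCVec,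
        PiLp.smul_apply, smul_eq_mul, Complex.ofReal_mul]
      ring
    rw [hint, dist_zero_right]
    refine (norm_integral_le_of_norm_le_const (C := ε / (|C| * A + 1) * |C|)
      (Eventually.of_forall fun θ => ?_)).trans_lt ?_
    · refine (norm_cdot_le _ _).trans (mul_le_mul (le_of_lt (hb ?_))
        ((hC θ).trans (le_abs_self C)) (norm_nonneg _) hδ.le)
      simp only [Set.mem_compl_iff, Metric.mem_closedBall, dist_zero_right, not_le]
      rw [norm_smul_sphere, abs_of_pos hr0]
      exact hrb
    · rw [mul_assoc, div_mul_eq_mul_div, div_lt_iff₀ hC']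
      nlinarith

end MaxwellSource

namespace MaxwellSource

open PVec

/-! ### Completeness of polynomials on the sphere -/

/-- The coordinates on the unit sphere as continuous functions. -/
noncomputable def sphereCoord (i : Fin 3) : C(Metric.sphere (0 : Space) 1, ℝ) :=
  ⟨fun θ => (θ : Space) i, by fun_prop⟩

/-- Restriction of real polynomials to the unit sphere. -/
noncomputable def spherePoly : MvPolynomial (Fin 3) ℝ →ₐ[ℝ] C(Metric.sphere (0 : Space) 1, ℝ) :=
  MvPolynomial.aeval sphereCoord

theorem spherePoly_apply (p : MvPolynomial (Fin 3) ℝ) (θ : Metric.sphere (0 : Space) 1) :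
    ((spherePoly p θ : ℝ) : ℂ) = pEval (MvPolynomial.map Complex.ofRealHom p) θ := by
  induction p using MvPolynomial.induction_on with
  | C a => simp [spherePoly, pEval]
  | add p q hp hq =>
    rw [map_add, map_add, ContinuousMap.add_apply, Complex.ofReal_add, hp, hq]
    simp [pEval]
  | mul_X p j hp =>
    rw [map_mul, map_mul, ContinuousMap.mul_apply, Complex.ofReal_mul, hp]
    simp [pEval, spherePoly, sphereCoord]

/-- Stone–Weierstrass: the coordinate functions already separate points of the sphere. -/
theorem spherePoly_dense (g : C(Metric.sphere (0 : Space) 1, ℝ)) {ε : ℝ} (hε : 0 < ε) :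
    ∃ p, ‖spherePoly p - g‖ < ε := by
  have h := ContinuousMap.subalgebra_topologicalClosure_eq_top_of_separatesPoints
    spherePoly.range (by
      intro x y hxy
      have : ∃ i, (x : Space) i ≠ (y : Space) i := by
        by_contra! hall
        exact hxy (Subtype.ext (by ext i; exact hall i))
      obtain ⟨i, hi⟩ := this
      refine ⟨sphereCoord i, ⟨sphereCoord i, ⟨MvPolynomial.X i, ?_⟩, rfl⟩, hi⟩
      simp [spherePoly])
  have hg : g ∈ spherePoly.range.topologicalClosure := by rw [h]; trivial
  have hg' : g ∈ closure (Set.range spherePoly) := by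
    have : (spherePoly.range : Set C(Metric.sphere (0 : Space) 1, ℝ)) = Set.range spherePoly := by
      simp
    rw [← this]; exact hg
  obtain ⟨_, ⟨p, rfl⟩, hp⟩ := Metric.mem_closure_iff.1 hg' ε hε
  exact ⟨p, by rwa [dist_comm, dist_eq_norm] at hp⟩

/-- By density f is orthogonal to every real continuous function. Its own real and imaginary parts
are such functions, and together they give ∫ |f|² = 0. -/
theorem eq_zero_of_orthogonal_polynomials {f : Metric.sphere (0 : Space) 1 → ℂ}
    (hf : Continuous f) (h : ∀ p : Poly, ∫ θ, f θ * pEval p θ ∂sphereMeasure = 0) : f = 0 := by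
  have key : ∀ g : C(Metric.sphere (0 : Space) 1, ℝ), ∫ θ, f θ * (g θ : ℂ) ∂sphereMeasure = 0 := by
    intro g
    set B := ∫ θ, ‖f θ‖ ∂sphereMeasure
    have hB : 0 ≤ B := integral_nonneg fun _ => norm_nonneg _
    have hc : ∀ q : C(Metric.sphere (0 : Space) 1, ℝ), Integrable (fun θ => f θ * (q θ : ℂ))
        sphereMeasure := fun q =>
      integrable_sphere (hf.mul (Complex.continuous_ofReal.comp q.continuous))
    have hle : ∀ ε > 0, ‖∫ θ, f θ * (g θ : ℂ) ∂sphereMeasure‖ ≤ ε * B := by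
      intro ε hε
      obtain ⟨p, hp⟩ := spherePoly_dense g hε
      have h0 : ∫ θ, f θ * ((spherePoly p θ : ℝ) : ℂ) ∂sphereMeasure = 0 := by
        simp only [spherePoly_apply]
        exact h _
      rw [← sub_zero (∫ θ, f θ * (g θ : ℂ) ∂sphereMeasure), ← h0, ← integral_sub (hc g) (hc _),
        ← integral_const_mul]
      refine norm_integral_le_of_norm_le ((integrable_sphere hf).norm.const_mul ε)
        (Eventually.of_forall fun θ => ?_)
      rw [← mul_sub, norm_mul, mul_comm, ← Complex.ofReal_sub, Complex.norm_real]
      refine mul_le_mul_of_nonneg_right ?_ (norm_nonneg _)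
      rw [norm_sub_rev]
      exact ((spherePoly p - g).norm_coe_le_norm θ).trans hp.le
    have h2 : ‖∫ θ, f θ * (g θ : ℂ) ∂sphereMeasure‖ ≤ 0 := by
      refine le_of_forall_pos_le_add fun ε hε => ?_
      refine (hle (ε / (B + 1)) (by positivity)).trans ?_
      rw [zero_add, div_mul_eq_mul_div, div_le_iff₀ (by positivity)]
      nlinarith
    exact norm_le_zero_iff.1 h2
  have hre := key ⟨fun θ => (f θ).re, Complex.continuous_re.comp hf⟩
  have him := key ⟨fun θ => (f θ).im, Complex.continuous_im.comp hf⟩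
  simp only [ContinuousMap.coe_mk] at hre him
  have cre : Continuous fun θ => f θ * ((f θ).re : ℂ) :=
    hf.mul (Complex.continuous_ofReal.comp (Complex.continuous_re.comp hf))
  have cim : Continuous fun θ => f θ * ((f θ).im : ℂ) :=
    hf.mul (Complex.continuous_ofReal.comp (Complex.continuous_im.comp hf))
  have hsum : ∫ θ, ((‖f θ‖ ^ 2 : ℝ) : ℂ) ∂sphereMeasure = 0 := by
    have h1 : ∀ θ, ((‖f θ‖ ^ 2 : ℝ) : ℂ) =
        f θ * ((f θ).re : ℂ) - Complex.I * (f θ * ((f θ).im : ℂ)) := by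
      intro θ
      rw [← Complex.normSq_eq_norm_sq, ← Complex.mul_conj]
      have hz : (starRingEnd ℂ) (f θ) = (f θ).re - Complex.I * (f θ).im :=
        Complex.ext (by simp) (by simp)
      rw [hz]
      ring
    simp only [h1]
    rw [integral_sub (integrable_sphere cre) ((integrable_sphere cim).const_mul _),
      integral_const_mul, hre, him]
    simp
  rw [integral_complex_ofReal, Complex.ofReal_eq_zero] at hsum
  have hi : Integrable (fun θ => ‖f θ‖ ^ 2) sphereMeasure :=
    (hf.norm.pow 2).integrable_of_hasCompactSupport (HasCompactSupport.of_compactSpace _)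
  have h3 := (integral_eq_zero_iff_of_nonneg (fun θ => by positivity) hi).1 hsum
  have h4 := (Continuous.ae_eq_iff_eq sphereMeasure (hf.norm.pow 2) continuous_const).1 h3
  ext θ
  have : ‖f θ‖ ^ 2 = 0 := congrFun h4 θ
  exact norm_eq_zero.1 ((pow_eq_zero_iff two_ne_zero).1 this)

theorem eq_zero_of_moment_eq_zero {R : ℝ} (hR : 0 < R) {u : Space → CVec}
    (hu : ContinuousOn u (exterior R)) (h : ∀ r > R, moment R u hu r = 0) {x : Space} (hx : R < ‖x‖) :
    u x = 0 := by
  have hx0 : 0 < ‖x‖ := hR.trans hx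
  have key : ∀ i : Fin 3, (fun θ : Metric.sphere (0 : Space) 1 => cut R u (‖x‖ • (θ : Space)) i) =
      0 := fun i => by
    refine eq_zero_of_orthogonal_polynomials
      ((EuclideanSpace.proj (𝕜 := ℂ) i).continuous.comp (continuous_cut_smul hu _)) fun p => ?_
    have h1 := LinearMap.congr_fun (h _ hx) (Pi.single i p)
    rw [moment_apply] at h1
    rw [LinearMap.zero_apply] at h1
    rw [← h1]
    congr 1
    ext θ
    fin_cases i <;> simp [cdot_apply, pEval]
  have hθ : ‖x‖⁻¹ • x ∈ Metric.sphere (0 : Space) 1 := by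
    simp [norm_smul, hx0.ne']
  ext i
  have h2 := congrFun (key i) ⟨_, hθ⟩
  simp only [smul_smul, mul_inv_cancel₀ hx0.ne', one_smul] at h2
  rw [cut_of_mem hx] at h2
  exact h2

/-- A radiating Maxwell field outside a ball with vanishing tangential trace vanishes. -/
theorem exterior_eq_zero {κ R : ℝ} (hκ : 0 < κ) (hR : 0 < R) {F H : Space → CVec}
    (hF : ContinuousOn F (exterior R)) (hH : ContinuousOn H (exterior R))
    (hFL : ∀ r, MemLp (cut R F) 2 (ballMeasure r)) (hHL : ∀ r, MemLp (cut R H) 2 (ballMeasure r))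
    (h1 : ∀ φ : Space → CVec, ContDiff ℝ ∞ φ → HasCompactSupport φ →
      ∫ x, cdot (cut R F x) (curl φ x) = ∫ x, cdot (cut R H x) (φ x))
    (h2 : ∀ φ : Space → CVec, ContDiff ℝ ∞ φ → HasCompactSupport φ → tsupport φ ⊆ exterior R →
      ∫ x, cdot (cut R H x) (curl φ x) = (κ : ℂ) ^ 2 * ∫ x, cdot (cut R F x) (φ x))
    (hrad : Tendsto (fun x => cross (H x) (toCVec x) - (Complex.I * κ * ‖x‖) • F x)
      (cocompact Space) (𝓝 0)) {x : Space} (hx : R < ‖x‖) : F x = 0 :=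
  eq_zero_of_moment_eq_zero hR hF (fun _ hr =>
    (isMaxwellMoments hR hF hH hFL hHL h1 h2 hrad).left_eq_zero hκ hR hr) hx

end MaxwellSource

namespace MaxwellSource

/-! ### Mollification -/

/-- The convolution of a field with a scalar kernel. -/
noncomputable def mollify (η : Space → ℝ) (u : Space → CVec) : Space → CVec :=
  convolution η u (ContinuousLinearMap.lsmul ℝ ℝ) volume

theorem mollify_apply (η : Space → ℝ) (u : Space → CVec) (x : Space) :
    mollify η u x = ∫ t, η (x - t) • u t :=
  convolution_lsmul_swap

theorem contDiff_shift {η : Space → ℝ} (hη : ContDiff ℝ ∞ η) (x : Space) :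
    ContDiff ℝ ∞ fun t => η (x - t) :=
  hη.comp (contDiff_const.sub contDiff_id)

theorem hasCompactSupport_shift {η : Space → ℝ} (hc : HasCompactSupport η) (x : Space) :
    HasCompactSupport fun t => η (x - t) :=
  hc.comp_homeomorph (Homeomorph.subLeft x)

theorem integrable_shift_smul {η : Space → ℝ} (hη : Continuous η) (hc : HasCompactSupport η)
    {u : Space → CVec} (hu : LocallyIntegrable u) (x : Space) :
    Integrable fun t => η (x - t) • u t :=
  hu.integrable_smul_left_of_hasCompactSupport (hη.comp (continuous_const.sub continuous_id))
    (hasCompactSupport_shift hc x)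

theorem contDiff_mollify {η : Space → ℝ} (hη : ContDiff ℝ ∞ η) (hc : HasCompactSupport η)
    {u : Space → CVec} (hu : LocallyIntegrable u) : ContDiff ℝ ∞ (mollify η u) :=
  hc.contDiff_convolution_left _ hη hu

theorem partialDeriv_mollify {η : Space → ℝ} (hη : ContDiff ℝ ∞ η) (hc : HasCompactSupport η)
    {u : Space → CVec} (hu : LocallyIntegrable u) (i j : Fin 3) (x : Space) :
    partialDeriv (mollify η u) i j x =
      ∫ t, ((fderiv ℝ η (x - t) (EuclideanSpace.single i 1) : ℝ) : ℂ) * u t j := by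
  set L : CVec →L[ℝ] ℝ →L[ℝ] CVec := (ContinuousLinearMap.lsmul ℝ ℝ).flip
  have e1 : mollify η u = convolution u η L volume := (convolution_flip _).symm
  have h1 := hc.hasFDerivAt_convolution_right L hu (hη.of_le (by simp)) x
  have hd : Continuous (fderiv ℝ η) := hη.continuous_fderiv (by simp)
  rw [partialDeriv, e1, h1.fderiv, convolution_precompR_apply L hu (hc.fderiv ℝ) hd]
  obtain ⟨v, hv⟩ : ∃ v : Space, v = EuclideanSpace.single i 1 := ⟨_, rfl⟩
  rw [← hv]
  have e2 : convolution u (fun a => fderiv ℝ η a v) L volume x =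
      ∫ t, fderiv ℝ η (x - t) v • u t := by
    rw [convolution_flip]
    exact convolution_lsmul_swap
  rw [e2]
  have hi : Integrable fun t => fderiv ℝ η (x - t) v • u t :=
    integrable_shift_smul (hd.clm_apply continuous_const) (hc.fderiv_apply ℝ v) hu x
  have h3 := (EuclideanSpace.proj (𝕜 := ℂ) (ι := Fin 3) j).integral_comp_comm hi
  change (EuclideanSpace.proj (𝕜 := ℂ) j) (∫ t, fderiv ℝ η (x - t) v • u t) = _
  rw [← h3]
  congr 1

theorem integrable_deriv_mul {η : Space → ℝ} (hη : ContDiff ℝ ∞ η) (hc : HasCompactSupport η)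
    {u : Space → CVec} (hu : LocallyIntegrable u) (i j : Fin 3) (x : Space) :
    Integrable fun t => ((fderiv ℝ η (x - t) (EuclideanSpace.single i 1) : ℝ) : ℂ) * u t j := by
  have hi : Integrable fun t => fderiv ℝ η (x - t) (EuclideanSpace.single i 1) • u t :=
    integrable_shift_smul ((hη.continuous_fderiv (by simp)).clm_apply continuous_const)
      (hc.fderiv_apply ℝ _) hu x
  refine ((EuclideanSpace.proj (𝕜 := ℂ) (ι := Fin 3) j).integrable_comp hi).congr
    (Eventually.of_forall fun t => ?_)
  simp

theorem partialDeriv_shift_single {η : Space → ℝ} (hη : ContDiff ℝ ∞ η) (x : Space)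
    (i j k : Fin 3) (t : Space) :
    partialDeriv (fun t => η (x - t) • EuclideanSpace.single k (1 : ℂ)) i j t =
      if j = k then -((fderiv ℝ η (x - t) (EuclideanSpace.single i 1) : ℝ) : ℂ) else 0 := by
  have h1 : HasFDerivAt (fun t => η (x - t)) (-(fderiv ℝ η (x - t))) t := by
    have h := ((hη.differentiable (by simp)) (x - t)).hasFDerivAt.comp t
      ((hasFDerivAt_id t).const_sub x)
    refine h.congr_fderiv ?_
    ext v
    simp
  have h2 : HasFDerivAt (fun t => η (x - t) • EuclideanSpace.single k (1 : ℂ)) _ t :=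
    h1.smul_const (EuclideanSpace.single k (1 : ℂ))
  rw [partialDeriv, h2.fderiv]
  by_cases hjk : j = k <;> simp [hjk]

/-- Mollification commutes with the weak curl. -/
theorem curl_mollify {η : Space → ℝ} (hη : ContDiff ℝ ∞ η) (hc : HasCompactSupport η)
    {u v : Space → CVec} (hu : LocallyIntegrable u) (hv : LocallyIntegrable v)
    (h : ∀ φ : Space → CVec, ContDiff ℝ ∞ φ → HasCompactSupport φ →
      ∫ x, cdot (u x) (curl φ x) = ∫ x, cdot (v x) (φ x)) (x : Space) :
    curl (mollify η u) x = mollify η v x := by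
  -- The weak identity is tested with t ↦ η(x − t) e_k, which produces the k-th component of the
  -- convolution.
  have key : ∀ k : Fin 3, ∫ t, cdot (u t) (curl (fun t => η (x - t) •
      EuclideanSpace.single k (1 : ℂ)) t) = mollify η v x k := by
    intro k
    rw [h (fun t => η (x - t) • EuclideanSpace.single k (1 : ℂ))
      ((contDiff_shift hη x).smul contDiff_const)
      (hasCompactSupport_shift hc x).smul_right, mollify_apply]
    have h3 := (EuclideanSpace.proj (𝕜 := ℂ) (ι := Fin 3) k).integral_comp_comm
      (integrable_shift_smul hη.continuous hc hv x)
    change _ = (EuclideanSpace.proj (𝕜 := ℂ) k) (∫ t, η (x - t) • v t)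
    rw [← h3]
    congr 1
    ext t
    rw [cdot_real_smul_right]
    simp [cdot]
  have hi := fun i j => integrable_deriv_mul hη hc hu i j x
  apply CVec.ext_three
  · rw [← key 0, curl_apply_zero, partialDeriv_mollify hη hc hu, partialDeriv_mollify hη hc hu,
      ← integral_sub (hi _ _) (hi _ _)]
    congr 1
    ext t
    rw [cdot_apply, curl_apply_zero, curl_apply_one, curl_apply_two]
    simp only [partialDeriv_shift_single hη]
    simp
    ring
  · rw [← key 1, curl_apply_one, partialDeriv_mollify hη hc hu, partialDeriv_mollify hη hc hu,
      ← integral_sub (hi _ _) (hi _ _)]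
    congr 1
    ext t
    rw [cdot_apply, curl_apply_zero, curl_apply_one, curl_apply_two]
    simp only [partialDeriv_shift_single hη]
    simp
    ring
  · rw [← key 2, curl_apply_two, partialDeriv_mollify hη hc hu, partialDeriv_mollify hη hc hu,
      ← integral_sub (hi _ _) (hi _ _)]
    congr 1
    ext t
    rw [cdot_apply, curl_apply_zero, curl_apply_one, curl_apply_two]
    simp only [partialDeriv_shift_single hη]
    simp
    ring

theorem mollify_sub {η : Space → ℝ} (hη : Continuous η) (hc : HasCompactSupport η)
    {u v : Space → CVec} (hu : LocallyIntegrable u) (hv : LocallyIntegrable v) (x : Space) :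
    mollify η (u - v) x = mollify η u x - mollify η v x := by
  rw [mollify_apply, mollify_apply, mollify_apply, ← integral_sub
    (integrable_shift_smul hη hc hu x) (integrable_shift_smul hη hc hv x)]
  congr 1
  ext1 t
  rw [Pi.sub_apply, smul_sub]

theorem mollify_eq_zero {R ε : ℝ} {η : Space → ℝ} (hη : ∀ x, ε ≤ ‖x‖ → η x = 0) {u : Space → CVec}
    (hu : ∀ᵐ x : Space, R < ‖x‖ → u x = 0) {x : Space} (hx : R + ε ≤ ‖x‖) : mollify η u x = 0 := by
  rw [mollify_apply]
  refine integral_eq_zero_of_ae ?_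
  filter_upwards [hu] with t ht
  by_cases h : R < ‖t‖
  · simp [ht h]
  · rw [hη, zero_smul]; · rfl
    have := norm_sub_norm_le x t
    linarith [not_lt.1 h]

/-! ### Convergence in `L²` -/

theorem norm_integral_cdot_le {μ : Measure Space} {u v : Space → CVec} (hu : MemLp u 2 μ)
    (hv : MemLp v 2 μ) :
    ‖∫ x, cdot (u x) (v x) ∂μ‖ ≤ √(∫ x, ‖u x‖ ^ 2 ∂μ) * √(∫ x, ‖v x‖ ^ 2 ∂μ) := by
  have h2 : ENNReal.ofReal 2 = 2 := by simp
  have h := integral_mul_norm_le_Lp_mul_Lq (μ := μ) (f := u) (g := v) Real.HolderConjugate.two_two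
    (by rwa [h2]) (by rwa [h2])
  simp only [Real.rpow_two, ← Real.sqrt_eq_rpow] at h
  refine le_trans ?_ h
  refine norm_integral_le_of_norm_le ?_ (Eventually.of_forall fun x => norm_cdot_le _ _)
  exact hu.norm.integrable_mul hv.norm

theorem memLp_ball_of_continuous {u : Space → CVec} (hu : Continuous u) (R : ℝ) :
    MemLp u 2 (ballMeasure R) := by
  obtain ⟨C, hC⟩ := (isCompact_closedBall (0 : Space) R).exists_bound_of_continuousOn
    hu.continuousOn
  have : IsFiniteMeasure (ballMeasure R) :=
    ⟨by rw [ballMeasure, Measure.restrict_apply_univ]; exact measure_ball_lt_top⟩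
  refine MemLp.of_bound hu.aestronglyMeasurable C ?_
  rw [ballMeasure, ae_restrict_iff' measurableSet_ball]
  exact Eventually.of_forall fun x hx => hC x (Metric.ball_subset_closedBall hx)

/-- Jensen's inequality for the probability density η(x − ·), obtained from the nonnegativity of the
variance of |u|. -/
theorem sq_norm_mollify_le {η : Space → ℝ} (hη : Continuous η) (hc : HasCompactSupport η)
    (h0 : ∀ x, 0 ≤ η x) (h1 : ∫ x, η x = 1) {u : Space → CVec} (hu : MemLp u 2) (x : Space) :
    ‖mollify η u x‖ ^ 2 ≤ convolution η (fun t => ‖u t‖ ^ 2) (ContinuousLinearMap.lsmul ℝ ℝ)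
      volume x := by
  have hul : LocallyIntegrable u := hu.locallyIntegrable (by norm_num)
  have hs : Continuous fun t => η (x - t) := hη.comp (continuous_const.sub continuous_id)
  have hsc := hasCompactSupport_shift hc x
  have i0 : Integrable fun t => η (x - t) := hs.integrable_of_hasCompactSupport hsc
  have i1 : Integrable fun t => η (x - t) * ‖u t‖ :=
    (integrable_shift_smul hη hc hul x).norm.congr (Eventually.of_forall fun t => by
      simp only [norm_smul, Real.norm_of_nonneg (h0 _)])
  have i2 : Integrable fun t => η (x - t) * ‖u t‖ ^ 2 :=
    hu.integrable_norm_pow (by norm_num) |>.locallyIntegrable.integrable_smul_left_of_hasCompactSupport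
      hs hsc
  set m := ∫ t, η (x - t) * ‖u t‖ with hm
  have e0 : ∫ t, η (x - t) = 1 := by
    rw [integral_sub_left_eq_self (fun y => η y) volume x]
    exact h1
  have hle : ‖mollify η u x‖ ≤ m := by
    rw [mollify_apply]
    refine norm_integral_le_of_norm_le i1 (Eventually.of_forall fun t => ?_)
    rw [norm_smul, Real.norm_of_nonneg (h0 _)]
  have hvar : 0 ≤ ∫ t, η (x - t) * (‖u t‖ - m) ^ 2 :=
    integral_nonneg fun t => mul_nonneg (h0 _) (sq_nonneg _)
  have hexp : ∫ t, η (x - t) * (‖u t‖ - m) ^ 2 = (∫ t, η (x - t) * ‖u t‖ ^ 2) - m ^ 2 := by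
    have : ∀ t, η (x - t) * (‖u t‖ - m) ^ 2 =
        (η (x - t) * ‖u t‖ ^ 2 - 2 * m * (η (x - t) * ‖u t‖)) + m ^ 2 * η (x - t) := fun t => by
      ring
    simp only [this]
    have i3 : Integrable fun t => η (x - t) * ‖u t‖ ^ 2 - 2 * m * (η (x - t) * ‖u t‖) :=
      i2.sub (i1.const_mul (2 * m))
    rw [integral_add i3 (i0.const_mul _), integral_sub i2 (i1.const_mul _), integral_const_mul,
      integral_const_mul, e0, ← hm]
    ring
  have hconv : convolution η (fun t => ‖u t‖ ^ 2) (ContinuousLinearMap.lsmul ℝ ℝ) volume x =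
      ∫ t, η (x - t) * ‖u t‖ ^ 2 := convolution_lsmul_swap
  rw [hconv]
  have : ‖mollify η u x‖ ^ 2 ≤ m ^ 2 := pow_le_pow_left₀ (norm_nonneg _) hle 2
  linarith

/-- Jensen's bound is integrated, and convolution with a probability density preserves the integral
of |u|². The dilation contributes l⁻³ ≤ 1. -/
theorem integral_sq_norm_mollify_le {η : Space → ℝ} (hη : ContDiff ℝ ∞ η)
    (hc : HasCompactSupport η) (h0 : ∀ x, 0 ≤ η x) (h1 : ∫ x, η x = 1) {u : Space → CVec}
    (hu : MemLp u 2) {l : ℝ} (hl : 1 ≤ l) (R : ℝ) :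
    ∫ x, ‖mollify η u (l • x)‖ ^ 2 ∂(ballMeasure R) ≤ ∫ x, ‖u x‖ ^ 2 := by
  have hul : LocallyIntegrable u := hu.locallyIntegrable (by norm_num)
  have hcont : Continuous (mollify η u) := (contDiff_mollify hη hc hul).continuous
  have iη : Integrable η := hη.continuous.integrable_of_hasCompactSupport hc
  have iu : Integrable fun t => ‖u t‖ ^ 2 := hu.integrable_norm_pow (by norm_num)
  have ic := iη.integrable_convolution (ContinuousLinearMap.lsmul ℝ ℝ) iu
  have hle := sq_norm_mollify_le hη.continuous hc h0 h1 hu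
  have im : Integrable fun x => ‖mollify η u x‖ ^ 2 := by
    refine ic.mono' (hcont.norm.pow 2).aestronglyMeasurable (Eventually.of_forall fun x => ?_)
    rw [Real.norm_of_nonneg (by positivity)]
    exact hle x
  have hl0 : l ≠ 0 := by linarith
  have iml : Integrable fun x => ‖mollify η u (l • x)‖ ^ 2 := im.comp_smul hl0
  calc ∫ x, ‖mollify η u (l • x)‖ ^ 2 ∂(ballMeasure R)
      ≤ ∫ x, ‖mollify η u (l • x)‖ ^ 2 :=
        setIntegral_le_integral iml (Eventually.of_forall fun x => by positivity)
    _ = |(l ^ 3)⁻¹| * ∫ x, ‖mollify η u x‖ ^ 2 := by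
        have := Measure.integral_comp_smul (volume : Measure Space)
          (fun x => ‖mollify η u x‖ ^ 2) l
        rw [this]
        simp
    _ ≤ 1 * ∫ x, ‖mollify η u x‖ ^ 2 := by
        refine mul_le_mul_of_nonneg_right ?_ (integral_nonneg fun x => by positivity)
        rw [abs_of_nonneg (by positivity)]
        exact inv_le_one_of_one_le₀ (one_le_pow₀ hl)
    _ ≤ ∫ x, convolution η (fun t => ‖u t‖ ^ 2) (ContinuousLinearMap.lsmul ℝ ℝ) volume x := by
        rw [one_mul]
        exact integral_mono im ic hle
    _ = ∫ x, ‖u x‖ ^ 2 := by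
        rw [integral_convolution (ContinuousLinearMap.lsmul ℝ ℝ) iη iu, h1]
        simp

/-- The standard mollifier of radius `ε`. -/
noncomputable def bump (ε : ℝ) (hε : 0 < ε) : ContDiffBump (0 : Space) where
  rIn := ε / 2
  rOut := ε
  rIn_pos := by positivity
  rIn_lt_rOut := by linarith

/-- Dilated mollifications converge weakly in `L²` of a ball. -/
theorem tendsto_integral_cdot_mollify {R : ℝ} {ξ : Space → CVec}
    (hξ : MemLp ξ 2 (ballMeasure R)) {u : Space → CVec} (hu : MemLp u 2) {ε l : ℕ → ℝ}
    (hε : ∀ n, 0 < ε n) (hε0 : Tendsto ε atTop (𝓝 0)) (hl : ∀ n, 1 ≤ l n)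
    (hl1 : Tendsto l atTop (𝓝 1)) :
    Tendsto (fun n => ∫ x, cdot (ξ x) (mollify ((bump (ε n) (hε n)).normed volume) u (l n • x))
      ∂(ballMeasure R)) atTop (𝓝 (∫ x, cdot (ξ x) (u x) ∂(ballMeasure R))) := by
  set η : ℕ → Space → ℝ := fun n => (bump (ε n) (hε n)).normed volume
  have hηs : ∀ n, ContDiff ℝ ∞ (η n) := fun n => (bump (ε n) (hε n)).contDiff_normed
  have hηc : ∀ n, HasCompactSupport (η n) := fun n => (bump (ε n) (hε n)).hasCompactSupport_normed
  have hη0 : ∀ n x, 0 ≤ η n x := fun n x => (bump (ε n) (hε n)).nonneg_normed x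
  have hη1 : ∀ n, ∫ x, η n x = 1 := fun n => (bump (ε n) (hε n)).integral_normed
  have hul : LocallyIntegrable u := hu.locallyIntegrable (by norm_num)
  set A := √(∫ x, ‖ξ x‖ ^ 2 ∂(ballMeasure R)) with hA
  set m := (volume : Measure Space).real (Metric.ball 0 R) with hm
  rw [Metric.tendsto_atTop]
  intro δ hδ
  -- Three errors of size at most Aρ ≤ δ/4 will add up to less than δ; the +1 covers A = 0.
  set ρ : ℝ := δ / (4 * (A + 1)) with hρ
  have hA0 : 0 ≤ A := Real.sqrt_nonneg _
  have hρ0 : 0 < ρ := by positivity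
  have hAρ : A * ρ ≤ δ / 4 := by
    rw [hρ, mul_div_assoc', div_le_div_iff₀ (by positivity) (by norm_num)]
    nlinarith
  obtain ⟨g, hgc, hgle, hg, hgL⟩ := (show MemLp u (ENNReal.ofReal 2) from by simpa using hu
    ).exists_hasCompactSupport_integral_rpow_sub_le (by norm_num) (show 0 < ρ ^ 2 by positivity)
  simp only [Real.rpow_two] at hgle
  have hgL2 : MemLp g 2 := by simpa using hgL
  have hgl : LocallyIntegrable g := hgL2.locallyIntegrable (by norm_num)
  -- A uniform error τ on the ball has L² norm at most τ√m ≤ ρ.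
  set τ : ℝ := ρ / (√m + 1) with hτ
  have hτ0 : 0 < τ := by positivity
  have huc := hgc.uniformContinuous_of_continuous hg
  obtain ⟨s₀, hs₀, hsg⟩ := Metric.uniformContinuous_iff.1 huc (τ / 2) (by positivity)
  have hev : ∀ᶠ n in atTop, (l n - 1) * R + ε n < s₀ ∧ ε n < s₀ := by
    have h1 : Tendsto (fun n => (l n - 1) * R + ε n) atTop (𝓝 0) := by
      have := ((hl1.sub_const 1).mul_const R).add hε0
      simpa using this
    exact (h1.eventually (gt_mem_nhds hs₀)).and (hε0.eventually (gt_mem_nhds hs₀))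
  obtain ⟨n₀, hn₀⟩ := eventually_atTop.1 hev
  refine ⟨n₀, fun n hn => ?_⟩
  obtain ⟨hn1, hn2⟩ := hn₀ n hn
  have hcl : ∀ {f : Space → CVec}, LocallyIntegrable f →
      Continuous fun x => mollify (η n) f (l n • x) := fun hf =>
    (contDiff_mollify (hηs n) (hηc n) hf).continuous.comp (continuous_const_smul _)
  have L1 : MemLp (fun x => mollify (η n) (u - g) (l n • x)) 2 (ballMeasure R) :=
    memLp_ball_of_continuous (hcl (hul.sub hgl)) R
  have L2 : MemLp (fun x => mollify (η n) g (l n • x) - g x) 2 (ballMeasure R) :=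
    memLp_ball_of_continuous ((hcl hgl).sub hg) R
  have L3 : MemLp (u - g) 2 (ballMeasure R) := (hu.sub hgL2).restrict _
  have b1 := norm_integral_cdot_le hξ L1
  have b2 := norm_integral_cdot_le hξ L2
  have b3 := norm_integral_cdot_le hξ L3
  have c1 : √(∫ x, ‖mollify (η n) (u - g) (l n • x)‖ ^ 2 ∂(ballMeasure R)) ≤ ρ := by
    refine Real.sqrt_le_iff.2 ⟨hρ0.le, ?_⟩
    exact (integral_sq_norm_mollify_le (hηs n) (hηc n) (hη0 n) (hη1 n) (hu.sub hgL2) (hl n) R).trans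
      hgle
  have c3 : √(∫ x, ‖(u - g) x‖ ^ 2 ∂(ballMeasure R)) ≤ ρ := by
    refine Real.sqrt_le_iff.2 ⟨hρ0.le, ?_⟩
    refine (setIntegral_le_integral ((hu.sub hgL2).integrable_norm_pow (by norm_num))
      (Eventually.of_forall fun x => by positivity)).trans hgle
  have c2 : √(∫ x, ‖mollify (η n) g (l n • x) - g x‖ ^ 2 ∂(ballMeasure R)) ≤ ρ := by
    refine Real.sqrt_le_iff.2 ⟨hρ0.le, ?_⟩
    have hpt : ∀ x ∈ Metric.ball (0 : Space) R,
        ‖mollify (η n) g (l n • x) - g x‖ ^ 2 ≤ τ ^ 2 := by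
      intro x hx
      have hx' : ‖x‖ < R := by simpa using hx
      refine pow_le_pow_left₀ (norm_nonneg _) ?_ 2
      have d1 : dist (mollify (η n) g (l n • x)) (g (l n • x)) ≤ τ / 2 := by
        refine (bump (ε n) (hε n)).dist_normed_convolution_le hg.aestronglyMeasurable fun y hy => ?_
        exact (hsg (lt_trans (Metric.mem_ball.1 hy) hn2)).le
      have d2 : dist (g (l n • x)) (g x) ≤ τ / 2 := by
        refine (hsg ?_).le
        rw [dist_eq_norm]
        have : l n • x - x = (l n - 1) • x := by rw [sub_smul, one_smul]
        rw [this, norm_smul, Real.norm_of_nonneg (by linarith [hl n])]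
        have := mul_le_mul_of_nonneg_left hx'.le (show 0 ≤ l n - 1 by linarith [hl n])
        linarith [hε n]
      rw [← dist_eq_norm]
      linarith [dist_triangle (mollify (η n) g (l n • x)) (g (l n • x)) (g x)]
    have hint : ∫ x, ‖mollify (η n) g (l n • x) - g x‖ ^ 2 ∂(ballMeasure R) ≤ τ ^ 2 * m := by
      have := setIntegral_mono_on (μ := volume) (s := Metric.ball (0 : Space) R)
        (f := fun x => ‖mollify (η n) g (l n • x) - g x‖ ^ 2) (g := fun _ => τ ^ 2)
        (show Integrable _ (ballMeasure R) from L2.integrable_norm_pow (by norm_num))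
        (integrableOn_const measure_ball_lt_top.ne) measurableSet_ball hpt
      rw [setIntegral_const, smul_eq_mul, mul_comm] at this
      exact this
    refine hint.trans ?_
    have hm0 : 0 ≤ m := measureReal_nonneg
    have hsm : √m ^ 2 = m := Real.sq_sqrt hm0
    have hτm : τ * √m ≤ ρ := by
      rw [hτ, div_mul_eq_mul_div, div_le_iff₀ (by positivity)]
      nlinarith [Real.sqrt_nonneg m]
    calc τ ^ 2 * m = (τ * √m) ^ 2 := by rw [mul_pow, hsm]
      _ ≤ ρ ^ 2 := pow_le_pow_left₀ (by positivity) hτm 2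
  have i0 := integrable_cdot hξ (hu.restrict (Metric.ball 0 R))
  have i1 := integrable_cdot hξ L1
  have i2 := integrable_cdot hξ L2
  have i3 := integrable_cdot hξ L3
  have iu := integrable_cdot hξ (memLp_ball_of_continuous (hcl hul) R)
  -- Replace u by a continuous compactly supported g: two errors come from u − g, with and without
  -- mollification, and the third from the uniform continuity of g.
  have hsplit : ∫ x, cdot (ξ x) (mollify (η n) u (l n • x)) ∂(ballMeasure R) -
      ∫ x, cdot (ξ x) (u x) ∂(ballMeasure R) =
      (∫ x, cdot (ξ x) (mollify (η n) (u - g) (l n • x)) ∂(ballMeasure R) +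
        ∫ x, cdot (ξ x) (mollify (η n) g (l n • x) - g x) ∂(ballMeasure R)) -
      ∫ x, cdot (ξ x) ((u - g) x) ∂(ballMeasure R) := by
    have i12 : Integrable (fun x => cdot (ξ x) (mollify (η n) (u - g) (l n • x)) +
      cdot (ξ x) (mollify (η n) g (l n • x) - g x)) (ballMeasure R) := i1.add i2
    rw [← integral_sub iu i0, ← integral_add i1 i2, ← integral_sub i12 i3]
    congr 1
    ext x
    rw [mollify_sub (hηs n).continuous (hηc n) hul hgl]
    simp only [cdot_apply, PiLp.sub_apply, Pi.sub_apply]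
    ring
  rw [dist_eq_norm, hsplit]
  refine (norm_sub_le _ _).trans_lt ?_
  have hb1 := b1.trans (mul_le_mul_of_nonneg_left c1 hA0)
  have hb2 := b2.trans (mul_le_mul_of_nonneg_left c2 hA0)
  have hb3 := b3.trans (mul_le_mul_of_nonneg_left c3 hA0)
  have hb4 := norm_add_le (∫ x, cdot (ξ x) (mollify (η n) (u - g) (l n • x)) ∂(ballMeasure R))
    (∫ x, cdot (ξ x) (mollify (η n) g (l n • x) - g x) ∂(ballMeasure R))
  linarith

end MaxwellSource

namespace MaxwellSource

/-! ### Sources that radiate nothing outside the ball -/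

theorem curl_const_smul {F : Space → CVec} {x : Space} (hF : DifferentiableAt ℝ F x) (c : ℝ) :
    curl (fun y => c • F y) x = c • curl F x := by
  obtain ⟨L, hL⟩ := exists_curlL
  rw [hL, hL, fderiv_fun_const_smul hF, map_smul]

theorem curl_comp_smul {F : Space → CVec} {l : ℝ} {x : Space} (hF : DifferentiableAt ℝ F (l • x)) :
    curl (fun y => F (l • y)) x = l • curl F (l • x) := by
  obtain ⟨L, hL⟩ := exists_curlL
  have h : HasFDerivAt (fun y => F (l • y)) (l • fderiv ℝ F (l • x)) x :=
    (hF.hasFDerivAt.comp x ((hasFDerivAt_id x).const_smul l)).congr_fderiv (by ext v; simp)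
  rw [hL, hL, h.fderiv, map_smul]

/-- A homogeneous solution in the ball is orthogonal to `curl curl E - κ² E` for every
square integrable field `E` that vanishes outside the ball. -/
theorem integral_cdot_curl_curl {κ R : ℝ} (hR : 0 < R) {ξ : Space → CVec}
    (hξ : IsHomogeneousMaxwellSolution κ R ξ) {E w g : Space → CVec} (hE : MemLp E 2)
    (hw : MemLp w 2) (hg : MemLp g 2) (hE0 : ∀ᵐ x : Space, R < ‖x‖ → E x = 0)
    (h1 : ∀ φ : Space → CVec, ContDiff ℝ ∞ φ → HasCompactSupport φ →
      ∫ x, cdot (E x) (curl φ x) = ∫ x, cdot (w x) (φ x))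
    (h2 : ∀ φ : Space → CVec, ContDiff ℝ ∞ φ → HasCompactSupport φ →
      ∫ x, cdot (w x) (curl φ x) = ∫ x, cdot (g x) (φ x)) :
    ∫ x, cdot (ξ x) (g x) ∂(ballMeasure R) =
      (κ : ℂ) ^ 2 * ∫ x, cdot (ξ x) (E x) ∂(ballMeasure R) := by
  obtain ⟨v, ⟨hξL, hvL, hv⟩, hsol⟩ := hξ
  have hEl : LocallyIntegrable E := hE.locallyIntegrable (by norm_num)
  have hwl : LocallyIntegrable w := hw.locallyIntegrable (by norm_num)
  have hgl : LocallyIntegrable g := hg.locallyIntegrable (by norm_num)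
  -- Mollification enlarges the support to radius R(1 + 1/(n+1)); the contraction by 1 + 2/(n+1)
  -- brings it strictly inside the ball.
  set ε : ℕ → ℝ := fun n => R * (1 / ((n : ℝ) + 1)) with hε_def
  set l : ℕ → ℝ := fun n => 1 + 2 * (1 / ((n : ℝ) + 1)) with hl_def
  have hpos : ∀ n : ℕ, 0 < 1 / ((n : ℝ) + 1) := fun n => by positivity
  have hε : ∀ n, 0 < ε n := fun n => mul_pos hR (hpos n)
  have hl : ∀ n, 1 ≤ l n := fun n => by simp only [hl_def]; linarith [hpos n]
  have hε0 : Tendsto ε atTop (𝓝 0) := by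
    simpa [hε_def] using (tendsto_one_div_add_atTop_nhds_zero_nat (𝕜 := ℝ)).const_mul R
  have hl1 : Tendsto l atTop (𝓝 1) := by
    simpa [hl_def] using ((tendsto_one_div_add_atTop_nhds_zero_nat (𝕜 := ℝ)).const_mul 2).const_add 1
  have key : ∀ n, ((l n : ℝ) : ℂ) ^ 2 *
      ∫ x, cdot (ξ x) (mollify ((bump (ε n) (hε n)).normed volume) g (l n • x)) ∂(ballMeasure R) =
      (κ : ℂ) ^ 2 * ∫ x, cdot (ξ x) (mollify ((bump (ε n) (hε n)).normed volume) E (l n • x))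
        ∂(ballMeasure R) := by
    intro n
    set η : Space → ℝ := (bump (ε n) (hε n)).normed volume
    have hη : ContDiff ℝ ∞ η := (bump (ε n) (hε n)).contDiff_normed
    have hηc : HasCompactSupport η := (bump (ε n) (hε n)).hasCompactSupport_normed
    have hη0 : ∀ x, ε n ≤ ‖x‖ → η x = 0 := fun x hx => by
      have : x ∉ Function.support η := by
        rw [(bump (ε n) (hε n)).support_normed_eq]
        simpa [bump] using hx
      simpa using this
    have sE : ContDiff ℝ ∞ (mollify η E) := contDiff_mollify hη hηc hEl
    have sw : ContDiff ℝ ∞ (mollify η w) := contDiff_mollify hη hηc hwl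
    have cE : curl (mollify η E) = mollify η w := funext (curl_mollify hη hηc hEl hwl h1)
    have cw : curl (mollify η w) = mollify η g := funext (curl_mollify hη hηc hwl hgl h2)
    have hln : 0 < l n := lt_of_lt_of_le one_pos (hl n)
    set ψ : Space → CVec := fun y => mollify η E (l n • y) with hψ_def
    have hψ : ContDiff ℝ ∞ ψ := sE.comp (contDiff_const_smul _)
    have hcψ : curl ψ = fun y => l n • mollify η w (l n • y) := by
      funext y
      rw [hψ_def, curl_comp_smul (sE.differentiable (by simp) _), cE]
    have hccψ : curl (curl ψ) = fun y => l n • l n • mollify η g (l n • y) := by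
      funext y
      have hd : Differentiable ℝ fun y => mollify η w (l n • y) :=
        (sw.comp (contDiff_const_smul _)).differentiable (by simp)
      rw [hcψ, curl_const_smul (hd y), curl_comp_smul (sw.differentiable (by simp) _), cw]
    have hts : tsupport ψ ⊆ Metric.closedBall 0 ((R + ε n) / l n) := by
      refine closure_minimal (fun y hy => ?_) Metric.isClosed_closedBall
      rw [mem_closedBall_zero_iff, le_div_iff₀ hln]
      by_contra! hlt
      refine hy (mollify_eq_zero hη0 hE0 ?_)
      rw [norm_smul, Real.norm_of_nonneg hln.le, mul_comm]
      exact hlt.le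
    have hlt : (R + ε n) / l n < R := by
      rw [div_lt_iff₀ hln]
      simp only [hε_def, hl_def]
      nlinarith [mul_pos hR (hpos n)]
    have htb : tsupport ψ ⊆ Metric.ball 0 R := hts.trans (Metric.closedBall_subset_ball hlt)
    have hcs : HasCompactSupport ψ :=
      (isCompact_closedBall _ _).of_isClosed_subset (isClosed_tsupport _) hts
    have hcurl : tsupport (curl ψ) ⊆ tsupport ψ := tsupport_curl_subset ψ
    -- ψ tests the equation of ξ and curl ψ tests the weak curl of ξ. Together they move both curls
    -- onto ψ.
    have e1 := hsol ⟨ψ, hψ, hcs, htb⟩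
    have e2 := hv ⟨curl ψ, ContDiff.curl hψ, hcs.of_isClosed_subset (isClosed_tsupport _) hcurl,
      hcurl.trans htb⟩
    change ∫ x, (cdot (v x) (curl ψ x) - (κ : ℂ) ^ 2 * cdot (ξ x) (ψ x)) ∂(ballMeasure R) = 0 at e1
    change ∫ x, cdot (ξ x) (curl (curl ψ) x) ∂(ballMeasure R) =
      ∫ x, cdot (v x) (curl ψ x) ∂(ballMeasure R) at e2
    rw [integral_sub (integrable_cdot hvL (memLp_ball_of_continuous (ContDiff.curl hψ).continuous R))
      ((integrable_cdot hξL (memLp_ball_of_continuous hψ.continuous R)).const_mul _),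
      integral_const_mul, sub_eq_zero, ← e2, hccψ] at e1
    rw [← e1, ← integral_const_mul]
    congr 1
    ext x
    rw [cdot_real_smul_right, cdot_real_smul_right]
    ring
  have t1 := tendsto_integral_cdot_mollify hξL hg hε hε0 hl hl1
  have t2 := (tendsto_integral_cdot_mollify hξL hE hε hε0 hl hl1).const_mul ((κ : ℂ) ^ 2)
  have t3 : Tendsto (fun n => ((l n : ℝ) : ℂ) ^ 2) atTop (𝓝 1) := by
    have := ((Complex.continuous_ofReal.tendsto 1).comp hl1).pow 2
    simpa using this
  have t4 := t3.mul t1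
  rw [one_mul] at t4
  exact tendsto_nhds_unique t4 (t2.congr fun n => (key n).symm)

/-! ### Complex conjugation -/

/-- Componentwise complex conjugation. -/
noncomputable def conjVec : CVec →L[ℝ] CVec :=
  LinearMap.toContinuousLinearMap
    { toFun := fun u => WithLp.toLp 2 fun i => star (u i)
      map_add' := fun u v => by ext i; simp
      map_smul' := fun c u => by ext i; simp }

theorem conjVec_apply (u : CVec) (i : Fin 3) : conjVec u i = star (u i) := rfl

theorem conjVec_conjVec (u : CVec) : conjVec (conjVec u) = u := by
  ext i; simp [conjVec_apply]

theorem cdot_conjVec (u v : CVec) : cdot (conjVec u) (conjVec v) = star (cdot u v) := by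
  simp [cdot_apply, conjVec_apply]

theorem cdot_conjVec_left (u v : CVec) : cdot (conjVec u) v = star (cdot u (conjVec v)) := by
  rw [← cdot_conjVec, conjVec_conjVec]

theorem inner_eq_cdot (u v : CVec) : inner ℂ u v = cdot (conjVec u) v := by
  simp [cdot, PiLp.inner_apply, mul_comm, conjVec_apply]

theorem curl_conjVec {F : Space → CVec} {x : Space} (hF : DifferentiableAt ℝ F x) :
    curl (fun y => conjVec (F y)) x = conjVec (curl F x) := by
  have h : HasFDerivAt (fun y => conjVec (F y)) (conjVec.comp (fderiv ℝ F x)) x :=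
    conjVec.hasFDerivAt.comp x hF.hasFDerivAt
  have hp : ∀ i j, partialDeriv (fun y => conjVec (F y)) i j x = star (partialDeriv F i j x) := by
    intro i j
    rw [partialDeriv, h.fderiv]
    rfl
  apply CVec.ext_three <;>
    simp only [conjVec_apply, curl_apply_zero, curl_apply_one, curl_apply_two, hp, star_sub]

theorem integral_star {μ : Measure Space} (f : Space → ℂ) :
    ∫ x, star (f x) ∂μ = star (∫ x, f x ∂μ) := integral_conj

theorem exists_conjVec_testFunction {Ω : Opens Space} (φ : 𝓓(Ω, CVec)) :
    ∃ ψ : 𝓓(Ω, CVec), (∀ x, ψ x = conjVec (φ x)) ∧ ∀ x, curl ψ x = conjVec (curl φ x) := by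
  have hs : tsupport (fun x => conjVec (φ x)) ⊆ tsupport φ :=
    closure_mono fun x hx h => hx (by simp only [h, map_zero])
  exact ⟨⟨fun x => conjVec (φ x), conjVec.contDiff.comp φ.contDiff,
    φ.hasCompactSupport.of_isClosed_subset (isClosed_tsupport _) hs, hs.trans φ.tsupport_subset⟩,
    fun x => rfl, fun x => curl_conjVec (φ.contDiff.differentiable (by simp) x)⟩

theorem HasWeakCurl.conj {Ω : Opens Space} {u w : Space → CVec} (h : HasWeakCurl Ω u w) :
    HasWeakCurl Ω (fun x => conjVec (u x)) (fun x => conjVec (w x)) := by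
  intro φ
  obtain ⟨ψ, h1, h2⟩ := exists_conjVec_testFunction φ
  simp only [cdot_conjVec_left, ← h1, ← h2, integral_star]
  rw [h ψ]

/-- The equation has real coefficients, κ being real, so conjugating the test field conjugates the
identity. -/
theorem IsHomogeneousMaxwellSolution.conj {κ R : ℝ} {ξ : Space → CVec}
    (h : IsHomogeneousMaxwellSolution κ R ξ) :
    IsHomogeneousMaxwellSolution κ R fun x => conjVec (ξ x) := by
  obtain ⟨w, ⟨h1, h2, h3⟩, h4⟩ := h
  refine ⟨fun x => conjVec (w x), ⟨conjVec.comp_memLp' h1, conjVec.comp_memLp' h2, h3.conj⟩,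
    fun φ => ?_⟩
  obtain ⟨ψ, e1, e2⟩ := exists_conjVec_testFunction φ
  have : ∀ x, cdot (conjVec (w x)) (curl φ x) - (κ : ℂ) ^ 2 * cdot (conjVec (ξ x)) (φ x) =
      star (cdot (w x) (curl ψ x) - (κ : ℂ) ^ 2 * cdot (ξ x) (ψ x)) := fun x => by
    rw [cdot_conjVec_left, cdot_conjVec_left, ← e1, ← e2, star_sub, star_mul', star_pow]
    simp
  simp only [this, integral_star]
  rw [h4 ψ, star_zero]

/-! ### Fields without tangential trace -/

theorem locallyIntegrable_of_memLp_ball {u : Space → CVec} (hu : ∀ r, MemLp u 2 (ballMeasure r)) :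
    LocallyIntegrable u := by
  intro x
  refine ⟨Metric.ball 0 (‖x‖ + 1), Metric.isOpen_ball.mem_nhds (by simp), ?_⟩
  have : IsFiniteMeasure (ballMeasure (‖x‖ + 1)) :=
    ⟨by rw [ballMeasure, Measure.restrict_apply_univ]; exact measure_ball_lt_top⟩
  exact (hu (‖x‖ + 1)).integrable (by norm_num)

theorem ae_norm_ne (R : ℝ) : ∀ᵐ x : Space, ‖x‖ ≠ R := by
  have h : volume (Metric.sphere (0 : Space) R) = 0 := Measure.addHaar_sphere _ _ _
  filter_upwards [measure_eq_zero_iff_ae_notMem.1 h] with x hx hn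
  exact hx (by simpa using hn)

/-- The space splits into the ball, its exterior and a null sphere. The formula turns identities on
the space and on the ball into identities for the cut fields. -/
theorem integral_cut {R : ℝ} {u φ : Space → CVec}
    (h : Integrable fun x => cdot (u x) (φ x)) :
    ∫ x, cdot (cut R u x) (φ x) =
      (∫ x, cdot (u x) (φ x)) - ∫ x, cdot (u x) (φ x) ∂(ballMeasure R) := by
  rw [ballMeasure, eq_sub_iff_add_eq', ← integral_indicator measurableSet_ball,
    ← integral_add (h.indicator measurableSet_ball)]
  · refine integral_congr_ae ?_
    filter_upwards [ae_norm_ne R] with x hx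
    rcases lt_or_gt_of_ne hx with h1 | h1
    · rw [cut_of_notMem h1.not_gt, cdot_zero_left, add_zero,
        Set.indicator_of_mem (by simpa using h1)]
    · rw [cut_of_mem h1, Set.indicator_of_notMem (by simpa using h1.le), zero_add]
  · refine (h.indicator (isOpen_exterior R).measurableSet).congr (Eventually.of_forall fun x => ?_)
    by_cases hx : x ∈ exterior R
    · simp only [Set.indicator_of_mem hx, cut]
    · simp only [Set.indicator_of_notMem hx, cut, cdot_zero_left]

/-- A radiating field without tangential trace on the sphere vanishes outside the ball. -/
theorem ae_eq_zero_of_trace_eq_zero {κ R : ℝ} (hκ : 0 < κ) (hR : 0 < R) {E w F J : Space → CVec}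
    (hE : ∀ r, MemLp E 2 (ballMeasure r)) (hw : ∀ r, MemLp w 2 (ballMeasure r))
    (hcurl : ∀ φ : Space → CVec, ContDiff ℝ ∞ φ → HasCompactSupport φ →
      ∫ x, cdot (E x) (curl φ x) = ∫ x, cdot (w x) (φ x))
    (hmax : ∀ φ : Space → CVec, ContDiff ℝ ∞ φ → HasCompactSupport φ →
      ∫ x, cdot (w x) (curl φ x) = (κ : ℂ) ^ 2 * (∫ x, cdot (E x) (φ x)) +
        Complex.I * κ * ∫ x, cdot (J x) (φ x) ∂(ballMeasure R))
    (htr : ∀ φ : Space → CVec, ContDiff ℝ ∞ φ → HasCompactSupport φ →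
      ∫ x, cdot (E x) (curl φ x) ∂(ballMeasure R) = ∫ x, cdot (w x) (φ x) ∂(ballMeasure R))
    (hF : ContDiffOn ℝ ∞ F (exterior R)) (hEF : ∀ᵐ x : Space, R < ‖x‖ → E x = F x)
    (hrad : Tendsto (fun x => cross (curl F x) (toCVec x) - (Complex.I * κ * ‖x‖) • F x)
      (cocompact Space) (𝓝 0)) :
    (∀ᵐ x : Space, R < ‖x‖ → E x = 0) ∧ ∀ᵐ x : Space, R < ‖x‖ → w x = 0 := by
  have hH : ContDiffOn ℝ ∞ (curl F) (exterior R) := ContDiffOn.curl_of_isOpen (isOpen_exterior R) hF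
  have hcc : ∀ {φ : Space → CVec}, HasCompactSupport φ → HasCompactSupport (curl φ) := fun hc =>
    hc.of_isClosed_subset (isClosed_tsupport _) (tsupport_curl_subset _)
  have hcutE : cut R E =ᵐ[volume] cut R F := by
    filter_upwards [hEF] with x hx
    by_cases h : R < ‖x‖
    · rw [cut_of_mem h, cut_of_mem h, hx h]
    · rw [cut_of_notMem h, cut_of_notMem h]
  -- The radiation condition involves the classical curl of F, the weak equations involve w. Outside
  -- the ball the two agree by uniqueness of weak curls.
  have hwH0 : ∀ᵐ x : Space, x ∈ exterior R → w x - curl F x = 0 := by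
    refine ae_eq_zero_of_integral_cdot (isOpen_exterior R)
      (((locallyIntegrable_of_memLp_ball hw).locallyIntegrableOn _).sub
        (hH.continuousOn.locallyIntegrableOn (isOpen_exterior R).measurableSet)) fun φ hφ hc hs => ?_
    have i1 : Integrable fun x => cdot (w x) (φ x) := integrable_cdot_of_local hw hφ.continuous hc
    have hts : tsupport (fun x => cdot (curl F x) (φ x)) ⊆ tsupport φ :=
      closure_mono fun x hx h => hx (by simp only [h, cdot_zero_right])
    have i2 : Integrable fun x => cdot (curl F x) (φ x) :=
      (ContinuousOn.continuous_of_tsupport_subset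
        (continuousOn_cdot hH.continuousOn hφ.continuous.continuousOn) (isOpen_exterior R)
        (hts.trans hs)).integrable_of_hasCompactSupport
        (hc.of_isClosed_subset (isClosed_tsupport _) hts)
    simp only [cdot_sub_left]
    rw [integral_sub i1 i2, ← integral_cdot_curl (isOpen_exterior R) hF hφ hc hs, ← hcurl φ hφ hc,
      sub_eq_zero]
    refine integral_congr_ae ?_
    filter_upwards [hEF] with x hx
    by_cases h : R < ‖x‖
    · rw [hx h]
    · have : x ∉ tsupport (curl φ) := fun h' => h (hs (tsupport_curl_subset _ h'))
      rw [image_eq_zero_of_notMem_tsupport this, cdot_zero_right, cdot_zero_right]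
  have hwH : ∀ᵐ x : Space, R < ‖x‖ → w x = curl F x := by
    filter_upwards [hwH0] with x hx h
    exact sub_eq_zero.1 (hx h)
  have hcutw : cut R w =ᵐ[volume] cut R (curl F) := by
    filter_upwards [hwH] with x hx
    by_cases h : R < ‖x‖
    · rw [cut_of_mem h, cut_of_mem h, hx h]
    · rw [cut_of_notMem h, cut_of_notMem h]
  have cE : ∀ φ : Space → CVec, ∫ x, cdot (cut R F x) (φ x) = ∫ x, cdot (cut R E x) (φ x) :=
    fun φ => integral_congr_ae (by filter_upwards [hcutE] with x hx; rw [hx])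
  have cw : ∀ φ : Space → CVec, ∫ x, cdot (cut R (curl F) x) (φ x) = ∫ x, cdot (cut R w x) (φ x) :=
    fun φ => integral_congr_ae (by filter_upwards [hcutw] with x hx; rw [hx])
  have ball0 : ∀ (u φ : Space → CVec), tsupport φ ⊆ exterior R →
      ∫ x, cdot (u x) (φ x) ∂(ballMeasure R) = 0 := by
    intro u φ hs
    refine setIntegral_eq_zero_of_forall_eq_zero fun x hx => ?_
    have h1 : ‖x‖ < R := by simpa using hx
    have : x ∉ tsupport φ := fun h' => (hs h').not_gt h1
    rw [image_eq_zero_of_notMem_tsupport this, cdot_zero_right]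
  have hF0 : ∀ x, R < ‖x‖ → F x = 0 := by
    intro x hx
    refine exterior_eq_zero hκ hR hF.continuousOn hH.continuousOn (fun r => ?_) (fun r => ?_)
      (fun φ hφ hc => ?_) (fun φ hφ hc hs => ?_) hrad hx
    · exact ((hE r).indicator (isOpen_exterior R).measurableSet).ae_eq (ae_restrict_of_ae hcutE)
    · exact ((hw r).indicator (isOpen_exterior R).measurableSet).ae_eq (ae_restrict_of_ae hcutw)
    -- Subtracting the trace identity on the ball from the curl identity on the space leaves no
    -- interface term: the field cut to the exterior has the cut curl.
    · have i1 := integrable_cdot_of_local hE (ContDiff.curl hφ).continuous (hcc hc)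
      have i2 := integrable_cdot_of_local hw hφ.continuous hc
      rw [cE, cw, integral_cut i1, integral_cut i2, hcurl φ hφ hc, htr φ hφ hc]
    · have i1 := integrable_cdot_of_local hw (ContDiff.curl hφ).continuous (hcc hc)
      have i2 := integrable_cdot_of_local hE hφ.continuous hc
      rw [cE, cw, integral_cut i1, integral_cut i2, hmax φ hφ hc, ball0 J φ hs,
        ball0 E φ hs, ball0 w (curl φ) ((tsupport_curl_subset φ).trans hs)]
      ring
  constructor
  · filter_upwards [hEF] with x hx h
    rw [hx h, hF0 x h]
  · filter_upwards [hwH] with x hx h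
    obtain ⟨L, hL⟩ := exists_curlL
    have : F =ᶠ[𝓝 x] fun _ => 0 := by
      filter_upwards [(isOpen_exterior R).mem_nhds h] with y hy using hF0 y hy
    rw [hx h, hL, this.fderiv_eq]
    simp

end MaxwellSource

/-! ### Independence of the trace from the weak curl, density, and the uniqueness theorem -/

namespace MaxwellSource

/-- The tangential trace may be computed with any global weak curl of the field. -/
theorem HasTangentialTrace.eq_of_memHCurlLoc {R : ℝ} {E w : Space → CVec}
    {τ : 𝓓((⊤ : Opens Space), CVec) → ℂ} (hτ : HasTangentialTrace R E τ) (hE : MemHCurlLoc E w)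
    (φ : 𝓓((⊤ : Opens Space), CVec)) :
    τ φ = ∫ x, (cdot (E x) (curl φ x) - cdot (w x) (φ x)) ∂(ballMeasure R) := by
  obtain ⟨w', ⟨-, hw'L, hw'⟩, ht⟩ := hτ
  have hi : Integrable (fun x => w x - w' x) (ballMeasure R) := by
    have : IsFiniteMeasure (ballMeasure R) :=
      ⟨by rw [ballMeasure, Measure.restrict_apply_univ]; exact measure_ball_lt_top⟩
    exact ((hE.memLp_curl R).sub hw'L).integrable (by norm_num)
  -- Both fields are weak curls of E in the ball, so their difference is orthogonal to all test
  -- fields supported there.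
  have h0 : ∀ᵐ x : Space, x ∈ Metric.ball (0 : Space) R → w x - w' x = 0 := by
    refine ae_eq_zero_of_integral_cdot Metric.isOpen_ball
      (IntegrableOn.locallyIntegrableOn hi) fun ψ hψ hc hs => ?_
    have e1 := hw' ⟨ψ, hψ, hc, hs⟩
    have e2 := hE.hasWeakCurl ⟨ψ, hψ, hc, Set.subset_univ _⟩
    change ∫ x in Metric.ball 0 R, cdot (E x) (curl ψ x) =
      ∫ x in Metric.ball 0 R, cdot (w' x) (ψ x) at e1
    change ∫ x in Set.univ, cdot (E x) (curl ψ x) = ∫ x in Set.univ, cdot (w x) (ψ x) at e2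
    rw [Measure.restrict_univ] at e2
    have hball : ∀ u v : Space → CVec, tsupport v ⊆ Metric.ball 0 R →
        ∫ x, cdot (u x) (v x) = ∫ x in Metric.ball 0 R, cdot (u x) (v x) := fun u v hv =>
      (setIntegral_eq_integral_of_forall_compl_eq_zero fun x hx => by
        rw [image_eq_zero_of_notMem_tsupport fun h => hx (hv h), cdot_zero_right]).symm
    rw [hball _ _ ((tsupport_curl_subset ψ).trans hs), hball _ _ hs, e1] at e2
    rw [hball _ _ hs]
    simp only [cdot_sub_left]
    have hψL : MemLp ψ 2 (ballMeasure R) := memLp_ball_of_continuous hψ.continuous R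
    exact (integral_sub (integrable_cdot (hE.memLp_curl R) hψL) (integrable_cdot hw'L hψL)).trans
      (sub_eq_zero.2 e2.symm)
  rw [ht φ]
  refine integral_congr_ae ?_
  filter_upwards [(ae_restrict_iff' measurableSet_ball).2 h0] with x hx
  rw [sub_eq_zero.1 hx]

/-- A source that is orthogonal to all homogeneous solutions and lies in the radiating space
vanishes. -/
theorem eq_zero_of_mem_radiatingSpace {κ R : ℝ} {J₁ J₂ : L2Ball R}
    (h₁ : J₁ ∈ radiatingSpace κ R) (h₂ : J₂ ∈ radiatingSpace κ R)
    (h : ∀ ξ : Space → CVec, IsHomogeneousMaxwellSolution κ R ξ →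
      ∫ x, cdot (ξ x) ((J₁ - J₂ : L2Ball R) x) ∂(ballMeasure R) = 0) : J₁ = J₂ := by
  have hcl : IsClosed {ξ : L2Ball R | inner ℂ ξ (J₁ - J₂) = 0} :=
    isClosed_eq (continuous_id.inner continuous_const) continuous_const
  have hsub : radiatingSpace κ R ⊆ {ξ : L2Ball R | inner ℂ ξ (J₁ - J₂) = 0} := by
    refine closure_minimal (fun ξ hξ => ?_) hcl
    change inner ℂ ξ (J₁ - J₂) = 0
    rw [L2.inner_def]
    simp only [inner_eq_cdot]
    -- The Hermitian product with ξ is the bilinear product with its conjugate, which is again a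
    -- homogeneous solution.
    exact h _ (IsHomogeneousMaxwellSolution.conj hξ)
  -- Each source separately is orthogonal to the difference, so no linear structure on the radiating
  -- space is used.
  have h3 : inner ℂ (J₁ - J₂) (J₁ - J₂) = 0 := by
    rw [inner_sub_left, hsub h₁, hsub h₂, sub_zero]
  exact sub_eq_zero.1 (inner_self_eq_zero.1 h3)

theorem memLp_of_ae_eq_zero {R : ℝ} {u : Space → CVec} (hu : MemLp u 2 (ballMeasure R))
    (h : ∀ᵐ x : Space, R < ‖x‖ → u x = 0) : MemLp u 2 := by
  have h1 : MemLp ((Metric.ball (0 : Space) R).indicator u) 2 :=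
    (memLp_indicator_iff_restrict measurableSet_ball).2 hu
  refine h1.ae_eq ?_
  filter_upwards [h, ae_norm_ne R] with x hx hn
  by_cases hb : x ∈ Metric.ball (0 : Space) R
  · rw [Set.indicator_of_mem hb]
  · rw [Set.indicator_of_notMem hb, hx (lt_of_le_of_ne (by simpa using hb) hn.symm)]

theorem MemHCurlLoc.integral_cdot_curl {u w : Space → CVec} (h : MemHCurlLoc u w)
    {φ : Space → CVec} (hφ : ContDiff ℝ ∞ φ) (hc : HasCompactSupport φ) :
    ∫ x, cdot (u x) (curl φ x) = ∫ x, cdot (w x) (φ x) := by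
  have := h.hasWeakCurl ⟨φ, hφ, hc, Set.subset_univ _⟩
  change ∫ x in Set.univ, cdot (u x) (curl φ x) = ∫ x in Set.univ, cdot (w x) (φ x) at this
  rwa [Measure.restrict_univ] at this

end MaxwellSource

/-- At a fixed wavenumber, a current density in the radiating space `𝕏(B_R)` is determined by
the tangential trace `E × ν` on `Γ_R` of the electric field that it radiates. -/
theorem mainTheorem7 (κ R : ℝ) (hκ : 0 < κ) (hR : 0 < R)
    (J₁ J₂ : L2Ball R) (hJ₁ : J₁ ∈ radiatingSpace κ R) (hJ₂ : J₂ ∈ radiatingSpace κ R)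
    (E₁ E₂ : Space → CVec) (hE₁ : IsRadiatedField κ R J₁ E₁) (hE₂ : IsRadiatedField κ R J₂ E₂)
    (τ : 𝓓((⊤ : Opens Space), CVec) → ℂ)
    (hτ₁ : HasTangentialTrace R E₁ τ) (hτ₂ : HasTangentialTrace R E₂ τ) :
    J₁ = J₂ := by
  obtain ⟨⟨w₁, hw₁, hm₁⟩, F₁, hF₁, hEF₁, hr₁⟩ := hE₁
  obtain ⟨⟨w₂, hw₂, hm₂⟩, F₂, hF₂, hEF₂, hr₂⟩ := hE₂
  set J : Space → CVec := fun x => J₁ x - J₂ x with hJ_def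
  have hJ₁L : MemLp J₁ 2 (ballMeasure R) := Lp.memLp J₁
  have hJ₂L : MemLp J₂ 2 (ballMeasure R) := Lp.memLp J₂
  have hJL : MemLp J 2 (ballMeasure R) := hJ₁L.sub hJ₂L
  have hE : ∀ r, MemLp (E₁ - E₂) 2 (ballMeasure r) := fun r => (hw₁.memLp r).sub (hw₂.memLp r)
  have hw : ∀ r, MemLp (w₁ - w₂) 2 (ballMeasure r) := fun r =>
    (hw₁.memLp_curl r).sub (hw₂.memLp_curl r)
  have hcc : ∀ {φ : Space → CVec}, HasCompactSupport φ → HasCompactSupport (curl φ) := fun hc =>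
    hc.of_isClosed_subset (isClosed_tsupport _) (tsupport_curl_subset _)
  have hcurl : ∀ φ : Space → CVec, ContDiff ℝ ∞ φ → HasCompactSupport φ →
      ∫ x, cdot ((E₁ - E₂) x) (curl φ x) = ∫ x, cdot ((w₁ - w₂) x) (φ x) := by
    intro φ hφ hc
    have hs := (ContDiff.curl hφ).continuous
    simp only [Pi.sub_apply, cdot_sub_left]
    rw [integral_sub (integrable_cdot_of_local hw₁.memLp hs (hcc hc))
      (integrable_cdot_of_local hw₂.memLp hs (hcc hc)),
      integral_sub (integrable_cdot_of_local hw₁.memLp_curl hφ.continuous hc)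
      (integrable_cdot_of_local hw₂.memLp_curl hφ.continuous hc),
      hw₁.integral_cdot_curl hφ hc, hw₂.integral_cdot_curl hφ hc]
  have hmax : ∀ φ : Space → CVec, ContDiff ℝ ∞ φ → HasCompactSupport φ →
      ∫ x, cdot ((w₁ - w₂) x) (curl φ x) = (κ : ℂ) ^ 2 * (∫ x, cdot ((E₁ - E₂) x) (φ x)) +
        Complex.I * κ * ∫ x, cdot (J x) (φ x) ∂(ballMeasure R) := by
    intro φ hφ hc
    have hs := (ContDiff.curl hφ).continuous
    have hφL : MemLp φ 2 (ballMeasure R) := memLp_ball_of_continuous hφ.continuous R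
    have a1 := integrable_cdot_of_local hw₁.memLp_curl hs (hcc hc)
    have a2 := integrable_cdot_of_local hw₂.memLp_curl hs (hcc hc)
    have b1 := integrable_cdot_of_local hw₁.memLp hφ.continuous hc
    have b2 := integrable_cdot_of_local hw₂.memLp hφ.continuous hc
    have e1 := hm₁ ⟨φ, hφ, hc, Set.subset_univ _⟩
    have e2 := hm₂ ⟨φ, hφ, hc, Set.subset_univ _⟩
    change ∫ x, (cdot (w₁ x) (curl φ x) - (κ : ℂ) ^ 2 * cdot (E₁ x) (φ x)) =
      Complex.I * κ * ∫ x, cdot (J₁ x) (φ x) ∂(ballMeasure R) at e1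
    change ∫ x, (cdot (w₂ x) (curl φ x) - (κ : ℂ) ^ 2 * cdot (E₂ x) (φ x)) =
      Complex.I * κ * ∫ x, cdot (J₂ x) (φ x) ∂(ballMeasure R) at e2
    rw [integral_sub a1 (b1.const_mul _), integral_const_mul] at e1
    rw [integral_sub a2 (b2.const_mul _), integral_const_mul] at e2
    simp only [hJ_def, Pi.sub_apply, cdot_sub_left]
    rw [integral_sub a1 a2, integral_sub b1 b2,
      integral_sub (integrable_cdot hJ₁L hφL) (integrable_cdot hJ₂L hφL)]
    linear_combination e1 - e2
  have htr : ∀ φ : Space → CVec, ContDiff ℝ ∞ φ → HasCompactSupport φ →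
      ∫ x, cdot ((E₁ - E₂) x) (curl φ x) ∂(ballMeasure R) =
        ∫ x, cdot ((w₁ - w₂) x) (φ x) ∂(ballMeasure R) := by
    intro φ hφ hc
    have hφL : MemLp φ 2 (ballMeasure R) := memLp_ball_of_continuous hφ.continuous R
    have hcL : MemLp (curl φ) 2 (ballMeasure R) :=
      memLp_ball_of_continuous (ContDiff.curl hφ).continuous R
    have a1 := integrable_cdot (hw₁.memLp R) hcL
    have a2 := integrable_cdot (hw₂.memLp R) hcL
    have b1 := integrable_cdot (hw₁.memLp_curl R) hφL
    have b2 := integrable_cdot (hw₂.memLp_curl R) hφL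
    -- The weak curls attached to the traces may differ from w₁ and w₂ as functions, so the common
    -- trace is first rewritten in terms of the latter.
    have e := (hτ₁.eq_of_memHCurlLoc hw₁ ⟨φ, hφ, hc, Set.subset_univ _⟩).symm.trans
      (hτ₂.eq_of_memHCurlLoc hw₂ ⟨φ, hφ, hc, Set.subset_univ _⟩)
    change ∫ x, (cdot (E₁ x) (curl φ x) - cdot (w₁ x) (φ x)) ∂(ballMeasure R) =
      ∫ x, (cdot (E₂ x) (curl φ x) - cdot (w₂ x) (φ x)) ∂(ballMeasure R) at e
    rw [integral_sub a1 b1, integral_sub a2 b2] at e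
    simp only [Pi.sub_apply, cdot_sub_left]
    rw [integral_sub a1 a2, integral_sub b1 b2]
    linear_combination e
  have hcF : ∀ x, R < ‖x‖ → curl (F₁ - F₂) x = curl F₁ x - curl F₂ x := fun x hx => by
    have hd : ∀ {F : Space → CVec}, ContDiffOn ℝ ∞ F {x | R < ‖x‖} → DifferentiableAt ℝ F x :=
      fun hF => (hF.differentiableOn (by simp)).differentiableAt ((isOpen_exterior R).mem_nhds hx)
    exact curl_sub (hd hF₁) (hd hF₂)
  have hrad : Tendsto (fun x => cross (curl (F₁ - F₂) x) (toCVec x) -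
      (Complex.I * κ * ‖x‖) • (F₁ - F₂) x) (cocompact Space) (𝓝 0) := by
    have h := hr₁.sub hr₂
    rw [sub_zero] at h
    refine h.congr' ?_
    filter_upwards [tendsto_norm_cocompact_atTop.eventually_gt_atTop R] with x hx
    rw [hcF x hx]
    apply CVec.ext_three <;>
      simp only [PiLp.sub_apply, PiLp.smul_apply, Pi.sub_apply, cross_apply_zero, cross_apply_one,
        cross_apply_two, smul_eq_mul] <;> ring
  have hEF : ∀ᵐ x : Space, R < ‖x‖ → (E₁ - E₂) x = (F₁ - F₂) x := by
    filter_upwards [hEF₁, hEF₂] with x h1 h2 hx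
    rw [Pi.sub_apply, Pi.sub_apply, h1 hx, h2 hx]
  obtain ⟨hE0, hw0⟩ := ae_eq_zero_of_trace_eq_zero hκ hR hE hw hcurl hmax htr (hF₁.sub hF₂) hEF hrad
  have hEL : MemLp (E₁ - E₂) 2 := memLp_of_ae_eq_zero (hE R) hE0
  have hwL : MemLp (w₁ - w₂) 2 := memLp_of_ae_eq_zero (hw R) hw0
  set J' : Space → CVec := (Metric.ball (0 : Space) R).indicator J with hJ'_def
  have hJ'L : MemLp J' 2 := (memLp_indicator_iff_restrict measurableSet_ball).2 hJL
  -- g is the weak curl of w₁ − w₂ on the whole space, with the source extended by zero.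
  set g : Space → CVec := fun x => (κ : ℂ) ^ 2 • (E₁ - E₂) x + (Complex.I * κ) • J' x with hg_def
  have hgL : MemLp g 2 := (hEL.const_smul ((κ : ℂ) ^ 2)).add (hJ'L.const_smul (Complex.I * (κ : ℂ)))
  have hg : ∀ φ : Space → CVec, ContDiff ℝ ∞ φ → HasCompactSupport φ →
      ∫ x, cdot ((w₁ - w₂) x) (curl φ x) = ∫ x, cdot (g x) (φ x) := by
    intro φ hφ hc
    have hφL : MemLp φ 2 := memLp_of_continuous hφ.continuous hc
    have e : ∀ x, cdot (g x) (φ x) =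
        (κ : ℂ) ^ 2 * cdot ((E₁ - E₂) x) (φ x) + Complex.I * κ * cdot (J' x) (φ x) := fun x => by
      simp only [hg_def, cdot_apply, PiLp.add_apply, PiLp.smul_apply, smul_eq_mul]
      ring
    simp only [e]
    rw [integral_add ((integrable_cdot hEL hφL).const_mul _) ((integrable_cdot hJ'L hφL).const_mul _),
      integral_const_mul, integral_const_mul, hmax φ hφ hc, ballMeasure,
      ← integral_indicator measurableSet_ball]
    congr 3
    ext x
    by_cases hx : x ∈ Metric.ball (0 : Space) R
    · rw [Set.indicator_of_mem hx, hJ'_def, Set.indicator_of_mem hx]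
    · rw [Set.indicator_of_notMem hx, hJ'_def, Set.indicator_of_notMem hx, cdot_zero_left]
  refine eq_zero_of_mem_radiatingSpace hJ₁ hJ₂ fun ξ hξ => ?_
  -- The terms κ²∫ ξ·E on both sides cancel, and iκ∫ ξ·J = 0 remains.
  have h := integral_cdot_curl_curl hR hξ hEL hwL hgL hE0 hcurl hg
  obtain ⟨-, ⟨hξL, -, -⟩, -⟩ := id hξ
  have e : ∀ x, cdot (ξ x) (g x) =
      (κ : ℂ) ^ 2 * cdot (ξ x) ((E₁ - E₂) x) + Complex.I * κ * cdot (ξ x) (J' x) := fun x => by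
    simp only [hg_def, cdot_add_right, cdot_smul_right]
  simp only [e] at h
  have hJ'R : MemLp J' 2 (ballMeasure R) := hJ'L.restrict _
  rw [integral_add ((integrable_cdot hξL (hE R)).const_mul _)
    ((integrable_cdot hξL hJ'R).const_mul _), integral_const_mul, integral_const_mul,
    add_eq_left] at h
  have hne : Complex.I * (κ : ℂ) ≠ 0 :=
    mul_ne_zero Complex.I_ne_zero (Complex.ofReal_ne_zero.2 hκ.ne')
  rw [← (mul_eq_zero.1 h).resolve_left hne]
  refine integral_congr_ae ?_
  filter_upwards [Lp.coeFn_sub J₁ J₂, ae_restrict_mem measurableSet_ball] with x hx hb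
  rw [hx, hJ'_def, Set.indicator_of_mem hb]
  rfl
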